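/- Let $\Bbbk$ be a field, let $V$ be a $\Bbbk$-vector space of dimension $n\ge 1$ with basis $v_1,\dots,v_n$ and dual basis $\theta_1,\dots,\theta_n$ of $V^*$, and let $m\ge N\ge 2$ be integers. An $m$-linear form $t$ on a finite-dimensional vector space $Z$ is *preregular* if (i) $t(z_1,z_2,\dots,z_m)=0$ for all $z_2,\dots,z_m$ implies $z_1=0$, and (ii) there is $\phi\in GL(Z)$ with $t(z_1,\dots,z_m)=t(\phi(z_m),z_1,\dots,z_{m-1})$ for all $z_i\in Z$. Let $e$ be a preregular $m$-linear form on $V$ and $f$ a preregular $m$-linear form on $V^*$, and put $e_{i_1\cdots i_m}=e(v_{i_1},\dots,v_{i_m})$, $f_{i_1\cdots i_m}=f(\theta_{i_1},\dots,\theta_{i_m})$. The associated *superpotential algebras* are $$A(e,N)=\Bbbk\langle x_1,\dots,x_n\rangle\Big/\Big(\sum_{j_1,\dots,j_N=1}^n e_{i_1\cdots i_{m-N}j_1\cdots j_N}\,x_{j_1}\cdots x_{j_N}\;:\;1\le i_1,\dots,i_{m-N}\le n\Big),$$ $$A(f,N)=\Bbbk\langle y_1,\dots,y_n\rangle\Big/\Big(\sum_{j_1,\dots,j_N=1}^n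 f_{i_1\cdots i_{m-N}j_1\cdots j_N}\,y_{j_1}\cdots y_{j_N}\;:\;1\le i_1,\dots,i_{m-N}\le n\Big).$$ Assume that both algebras are $N$-Koszul and Artin--Schelter regular of global dimension $d$, where $m=d$ if $N=2$, and $d$ is odd and $m=\tfrac{d-1}{2}N+1$ if $N\ge 3$ (that is, $m$ is the internal degree of the last term of the minimal resolution of $\Bbbk$). Let $\mathcal H(e,f)$ be the algebra with generators $u_{ij}$ ($1\le i,j\le n$), $D_e^{\pm1}$, $D_f^{\pm1}$ and relations $D_eD_e^{-1}=D_e^{-1}D_e=D_fD_f^{-1}=D_f^{-1}D_f=1$ and, for all $1\le j_1,\dots,j_m\le n$, $$\sum_{i_1,\dots,i_m=1}^n e_{i_1\cdots i_m}u_{i_1j_1}\cdots u_{i_mj_m}=e_{j_1\cdots j_m}D_e,\qquad \sum_{i_1,\dots,i_m=1}^n f_{i_1\cdots i_m}u_{j_1i_1}\cdots u_{j_mi_m}=f_{j_1\cdots j_m}D_f^{-1}.$$ It is a Hopf algebra with $\Delta(u_{ij})=\sum_l u_{il}\otimes u_{lj}$, $\varepsilon(u_{ij})=\delta_{ij}$,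 and $D_e^{\pm1},D_f^{\pm1}$ grouplike; let $\mathcal S(e,f)=\mathcal H(e,f)/(D_e-1,\,D_f-1)$ be its Hopf quotient. A *balanced coaction* of a Hopf algebra $K$ is a pair consisting of a left $K$-comodule algebra structure $\rho^\ell_K$ on $A(e,N)$ and a right $K$-comodule algebra structure $\rho^r_K$ on $A(f,N)$ for which there are elements $k_{ij}\in K$ with $\rho^\ell_K(x_i)=\sum_j k_{ij}\otimes x_j$ and $\rho^r_K(y_j)=\sum_i y_i\otimes k_{ij}$ for all $i,j$. It has *trivial homological codeterminants* if the coactions that $K$ induces on the one-dimensional spaces $\mathrm{Ext}^d_{A(e,N)}(\Bbbk,\Bbbk)$ and $\mathrm{Ext}^d_{A(f,N)}(\Bbbk,\Bbbk)$ are both trivial. Then: (a) There is a balanced coaction of $\mathcal H(e,f)$ with $\rho^\ell_{\mathcal H}(x_i)=\sum_j u_{ij}\otimes x_j$ and $\rho^r_{\mathcal H}(y_j)=\sum_i y_i\otimes u_{ij}$, and it is universal: for every Hopf algebra $K$ with a balanced coaction there is a unique Hopf algebra map $\varphi:\mathcal H(e,f)\to K$ with $(\varphi\otimes\mathrm{id})\circ\rho^\ell_{\mathcal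 H}=\rho^\ell_K$ and $(\mathrm{id}\otimes\varphi)\circ\rho^r_{\mathcal H}=\rho^r_K$. In other words, $\mathcal H(e,f)$ is the balanced quantum general linear group $\mathcal O_{A(e,N),A(f,N)}(GL)$. (b) There is a balanced coaction of $\mathcal S(e,f)$ given by the same formulas (with $u_{ij}$ now denoting the images in $\mathcal S(e,f)$). It has trivial homological codeterminants, and it is universal among the balanced coactions with trivial homological codeterminants: for every Hopf algebra $K$ with such a coaction there is a unique Hopf algebra map $\varphi:\mathcal S(e,f)\to K$ with $(\varphi\otimes\mathrm{id})\circ\rho^\ell_{\mathcal S}=\rho^\ell_K$ and $(\mathrm{id}\otimes\varphi)\circ\rho^r_{\mathcal S}=\rho^r_K$. In other words, $\mathcal S(e,f)$ is the balanced quantum special linear group $\mathcal O_{A(e,N),A(f,N)}(SL)$. -/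

import Mathlib

open scoped TensorProduct

universe u v w

namespace PreregularPair

/-! ## Preregular forms -/

/-- A preregular `m`-linear form `t` on `Z`: nondegenerate in the first argument, and
`t(z₁, …, z_m) = t(φ(z_m), z₁, …, z_{m-1})` for some `φ ∈ GL(Z)`.
(`(finRotate m).symm` sends a position to its cyclic predecessor.) -/
structure PreregularForm (k : Type u) (Z : Type v) [Field k] [AddCommGroup Z] [Module k Z]
    (m : ℕ) where
  form : MultilinearMap k (fun _ : Fin m => Z) k
  nondegenerate : ∀ x : Z,
    (∀ (z : Fin m → Z) (i : Fin m), i.val = 0 → z i = x → form z = 0) → x = 0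
  cyclic : ∃ φ : Z ≃ₗ[k] Z, ∀ z : Fin m → Z,
    form z = form fun i => if i.val = 0 then φ (z ((finRotate m).symm i))
      else z ((finRotate m).symm i)

/-- The coefficient `t_{i₁ ⋯ i_m} = t(b_{i₁}, …, b_{i_m})` with respect to a basis `b`. -/
noncomputable def PreregularForm.coeff {k : Type u} {Z : Type v} [Field k] [AddCommGroup Z] [Module k Z]
    {m n : ℕ} (t : PreregularForm k Z m) (b : Module.Basis (Fin n) k Z)
    (i : Fin m → Fin n) : k :=
  t.form fun p => b (i p)

/-- The ordered product `a (i 0) (j 0) * a (i 1) (j 1) * ⋯ * a (i (m-1)) (j (m-1))`. -/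
def wordProd {H : Type u} [Monoid H] {m n : ℕ} (a : Fin n → Fin n → H) (i j : Fin m → Fin n) : H :=
  (List.ofFn fun p => a (i p) (j p)).prod

/-! ## The Hopf algebras `H(e, f)` and `S(e, f)` -/

/-- The generators `u_{ij}`, `D_e`, `D_e⁻¹`, `D_f`, `D_f⁻¹` of `H(e, f)`. -/
inductive Gen (n : ℕ) : Type
  | u (i j : Fin n)
  | De | DeInv | Df | DfInv

/-- The defining relations of `H(e, f)`, with `E`, `F` the coefficient arrays of `e`, `f`. -/
inductive HRel (k : Type u) [Field k] {m n : ℕ} (E F : (Fin m → Fin n) → k) :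
    FreeAlgebra k (Gen n) → FreeAlgebra k (Gen n) → Prop
  | relE (j : Fin m → Fin n) : HRel k E F
      (∑ i : Fin m → Fin n, E i • wordProd (fun a b => FreeAlgebra.ι k (Gen.u a b)) i j)
      (E j • FreeAlgebra.ι k Gen.De)
  | relF (j : Fin m → Fin n) : HRel k E F
      (∑ i : Fin m → Fin n, F i • wordProd (fun a b => FreeAlgebra.ι k (Gen.u a b)) j i)
      (F j • FreeAlgebra.ι k Gen.DfInv)
  | De_mul : HRel k E F (FreeAlgebra.ι k Gen.De * FreeAlgebra.ι k Gen.DeInv) 1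
  | mul_De : HRel k E F (FreeAlgebra.ι k Gen.DeInv * FreeAlgebra.ι k Gen.De) 1
  | Df_mul : HRel k E F (FreeAlgebra.ι k Gen.Df * FreeAlgebra.ι k Gen.DfInv) 1
  | mul_Df : HRel k E F (FreeAlgebra.ι k Gen.DfInv * FreeAlgebra.ι k Gen.Df) 1

/-- The algebra presented by the generators `Gen` and the relations `HRel`. -/
def HAlg (k : Type u) [Field k] {m n : ℕ} (E F : (Fin m → Fin n) → k) : Type u :=
  RingQuot (HRel k E F)

namespace HAlg
variable {k : Type u} [Field k] {m n : ℕ} (E F : (Fin m → Fin n) → k)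

noncomputable instance : Ring (HAlg k E F) := inferInstanceAs (Ring (RingQuot (HRel k E F)))
noncomputable instance : Algebra k (HAlg k E F) :=
  inferInstanceAs (Algebra k (RingQuot (HRel k E F)))

/-- The image of a generator. -/
noncomputable def gen (g : Gen n) : HAlg k E F :=
  RingQuot.mkAlgHom k (HRel k E F) (FreeAlgebra.ι k g)


end HAlg

section words
variable {k : Type u} [Field k] {n : ℕ}

lemma wordProd_succ {H : Type u} [Monoid H] {m : ℕ} (a : Fin n → Fin n → H)
    (i j : Fin (m + 1) → Fin n) :
    wordProd a i j = a (i 0) (j 0) * wordProd a (Fin.tail i) (Fin.tail j) := by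
  simp only [wordProd, List.ofFn_succ, List.prod_cons, Fin.tail]

lemma wordProd_succ_last {H : Type u} [Monoid H] {m : ℕ} (a : Fin n → Fin n → H)
    (i j : Fin (m + 1) → Fin n) :
    wordProd a i j = wordProd a (Fin.init i) (Fin.init j) * a (i (Fin.last m)) (j (Fin.last m)) := by
  simp only [wordProd, List.ofFn_succ', List.concat_eq_append, List.prod_append,
    List.prod_cons, List.prod_nil, mul_one, Fin.init]

lemma map_wordProd {H : Type u} {H' : Type v} [Monoid H] [Monoid H'] {m : ℕ} (φ : H →* H')
    (a : Fin n → Fin n → H) (i j : Fin m → Fin n) :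
    φ (wordProd a i j) = (List.ofFn fun p => φ (a (i p) (j p))).prod := by
  simp only [wordProd, map_list_prod, List.map_ofFn, Function.comp_def]

lemma sum_word_cons {M : Type v} [AddCommMonoid M] {m : ℕ} (g : (Fin (m + 1) → Fin n) → M) :
    ∑ i, g i = ∑ x : Fin n, ∑ i : Fin m → Fin n, g (Fin.cons x i) := by
  rw [← (Fin.consEquiv fun _ : Fin (m + 1) => Fin n).sum_comp, Fintype.sum_prod_type]
  rfl

lemma sum_word_snoc {M : Type v} [AddCommMonoid M] {m : ℕ} (g : (Fin (m + 1) → Fin n) → M) :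
    ∑ i, g i = ∑ x : Fin n, ∑ i : Fin m → Fin n, g (Fin.snoc i x) := by
  rw [← (Fin.snocEquiv fun _ : Fin (m + 1) => Fin n).sum_comp, Fintype.sum_prod_type]
  rfl

lemma wordProd_tmul {H : Type u} [Ring H] [Algebra k H] {m : ℕ}
    (a b : Fin n → Fin n → H) (i j : Fin m → Fin n) :
    wordProd (fun x y => ∑ l, a x l ⊗ₜ[k] b l y) i j
      = ∑ l : Fin m → Fin n, wordProd a i l ⊗ₜ[k] wordProd b l j := by
  induction m with
  | zero => simp [wordProd, Algebra.TensorProduct.one_def]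
  | succ m ih =>
    rw [wordProd_succ, ih, sum_word_cons, Finset.sum_mul_sum]
    simp only [wordProd_succ, Fin.cons_zero, Fin.tail_cons, Algebra.TensorProduct.tmul_mul_tmul]

lemma wordProd_delta {H : Type u} [Semiring H] {m : ℕ} (i j : Fin m → Fin n) :
    wordProd (fun x y => if x = y then (1 : H) else 0) i j = if i = j then 1 else 0 := by
  induction m with
  | zero => simp [wordProd, Subsingleton.elim i j]
  | succ m ih =>
    rw [wordProd_succ, ih]
    have : i = j ↔ i 0 = j 0 ∧ Fin.tail i = Fin.tail j := by
      conv_lhs => rw [← Fin.cons_self_tail i, ← Fin.cons_self_tail j, Fin.cons_inj]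
    by_cases h0 : i 0 = j 0 <;> by_cases h1 : Fin.tail i = Fin.tail j <;> simp [this, h0, h1]

open MulOpposite in
lemma sum_wordProd_mul_op {H : Type u} [Ring H] {m : ℕ} (a c : Fin n → Fin n → H)
    (h : ∀ x y, ∑ l, a x l * c l y = if x = y then 1 else 0) (r j : Fin m → Fin n) :
    ∑ i, wordProd a r i * unop (wordProd (fun x y => op (c x y)) i j)
      = if r = j then 1 else 0 := by
  induction m with
  | zero => simp [wordProd, Subsingleton.elim r j]
  | succ m ih =>
    have key : r = j ↔ r 0 = j 0 ∧ Fin.tail r = Fin.tail j := by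
      conv_lhs => rw [← Fin.cons_self_tail r, ← Fin.cons_self_tail j, Fin.cons_inj]
    rw [sum_word_cons]
    simp only [wordProd_succ, Fin.cons_zero, Fin.tail_cons, unop_mul, unop_op]
    have : ∀ x : Fin n, ∑ i : Fin m → Fin n, a (r 0) x * wordProd a (Fin.tail r) i *
        (unop (wordProd (fun x y => op (c x y)) i (Fin.tail j)) * c x (j 0))
        = a (r 0) x * (if Fin.tail r = Fin.tail j then 1 else 0) * c x (j 0) := by
      intro x
      rw [← ih, Finset.mul_sum, Finset.sum_mul]
      simp only [mul_assoc]
    simp only [this]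
    by_cases h1 : Fin.tail r = Fin.tail j
    · simp [h1, h, key]
    · simp [h1, key]

open MulOpposite in
lemma sum_op_mul_wordProd {H : Type u} [Ring H] {m : ℕ} (a c : Fin n → Fin n → H)
    (h : ∀ x y, ∑ l, c x l * a l y = if x = y then 1 else 0) (j r : Fin m → Fin n) :
    ∑ i, unop (wordProd (fun x y => op (c x y)) j i) * wordProd a i r
      = if j = r then 1 else 0 := by
  induction m with
  | zero => simp [wordProd, Subsingleton.elim r j]
  | succ m ih =>
    have key : j = r ↔ j 0 = r 0 ∧ Fin.tail j = Fin.tail r := by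
      conv_lhs => rw [← Fin.cons_self_tail r, ← Fin.cons_self_tail j, Fin.cons_inj]
    rw [sum_word_cons, Finset.sum_comm]
    simp only [wordProd_succ, Fin.cons_zero, Fin.tail_cons, unop_mul, unop_op]
    have : ∀ i : Fin m → Fin n, ∑ x : Fin n,
        (unop (wordProd (fun x y => op (c x y)) (Fin.tail j) i) * c (j 0) x) *
          (a x (r 0) * wordProd a i (Fin.tail r))
        = (if j 0 = r 0 then 1 else 0) *
          (unop (wordProd (fun x y => op (c x y)) (Fin.tail j) i) * wordProd a i (Fin.tail r)) := by
      intro i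
      have e : ∀ x : Fin n, (unop (wordProd (fun x y => op (c x y)) (Fin.tail j) i) * c (j 0) x) *
          (a x (r 0) * wordProd a i (Fin.tail r)) =
          unop (wordProd (fun x y => op (c x y)) (Fin.tail j) i) * (c (j 0) x * a x (r 0)) *
          wordProd a i (Fin.tail r) := fun x => by simp only [mul_assoc]
      simp only [e, ← Finset.sum_mul, ← Finset.mul_sum, h]
      by_cases h0 : j 0 = r 0 <;> simp [h0]
    simp only [this, ← Finset.mul_sum, ih]
    by_cases h0 : j 0 = r 0 <;> simp [h0, key]

end words

namespace HAlg
variable {k : Type u} [Field k] {m n : ℕ} (E F : (Fin m → Fin n) → k)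

section lift
variable {B : Type v} [Ring B] [Algebra k B]

/-- The universal property of the presentation. -/
noncomputable def lift (t : Gen n → B)
    (hE : ∀ j : Fin m → Fin n,
      ∑ i : Fin m → Fin n, E i • (List.ofFn fun p => t (.u (i p) (j p))).prod = E j • t .De)
    (hF : ∀ j : Fin m → Fin n,
      ∑ i : Fin m → Fin n, F i • (List.ofFn fun p => t (.u (j p) (i p))).prod = F j • t .DfInv)
    (h1 : t .De * t .DeInv = 1) (h2 : t .DeInv * t .De = 1)
    (h3 : t .Df * t .DfInv = 1) (h4 : t .DfInv * t .Df = 1) : HAlg k E F →ₐ[k] B :=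
  RingQuot.liftAlgHom k ⟨FreeAlgebra.lift k t, by
    intro x y h
    induction h with
    | relE j =>
      simpa [map_list_prod, wordProd, List.map_ofFn, Function.comp_def] using hE j
    | relF j =>
      simpa [map_list_prod, wordProd, List.map_ofFn, Function.comp_def] using hF j
    | De_mul => simpa using h1
    | mul_De => simpa using h2
    | Df_mul => simpa using h3
    | mul_Df => simpa using h4⟩

lemma lift_gen (t : Gen n → B) (hE hF h1 h2 h3 h4) (g : Gen n) :
    lift E F t hE hF h1 h2 h3 h4 (gen E F g) = t g := by
  simp only [lift, gen]
  erw [RingQuot.liftAlgHom_mkAlgHom_apply]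
  simp

variable {E F}
lemma hom_ext {φ ψ : HAlg k E F →ₐ[k] B} (h : ∀ g, φ (gen E F g) = ψ (gen E F g)) : φ = ψ := by
  refine RingQuot.ringQuot_ext' k φ ψ (FreeAlgebra.hom_ext ?_)
  funext g
  exact h g

end lift

variable {E F} in
@[elab_as_elim]
lemma induction {C : HAlg k E F → Prop} (x : HAlg k E F)
    (hs : ∀ r : k, C (algebraMap k _ r)) (hg : ∀ g, C (gen E F g))
    (hm : ∀ x y, C x → C y → C (x * y)) (ha : ∀ x y, C x → C y → C (x + y)) : C x := by
  obtain ⟨y, rfl⟩ := RingQuot.mkAlgHom_surjective k (HRel k E F) x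
  induction y using FreeAlgebra.induction with
  | grade0 r => simpa using! hs r
  | grade1 g => exact hg g
  | mul a b ha' hb' => rw [map_mul]; exact hm _ _ ha' hb'
  | add a b ha' hb' => rw [map_add]; exact ha _ _ ha' hb'

/-- The generator `u_{ij}`. -/
noncomputable abbrev u (i j : Fin n) : HAlg k E F := gen E F (.u i j)

lemma relE (j : Fin m → Fin n) :
    ∑ i : Fin m → Fin n, E i • wordProd (u E F) i j = E j • gen E F .De := by
  have := RingQuot.mkAlgHom_rel k (HRel.relE (k := k) (E := E) (F := F) j)
  simpa [map_list_prod, wordProd, List.map_ofFn, Function.comp_def] using! this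

lemma relF (j : Fin m → Fin n) :
    ∑ i : Fin m → Fin n, F i • wordProd (u E F) j i = F j • gen E F .DfInv := by
  have := RingQuot.mkAlgHom_rel k (HRel.relF (k := k) (E := E) (F := F) j)
  simpa [map_list_prod, wordProd, List.map_ofFn, Function.comp_def] using! this

lemma De_mul : gen E F .De * gen E F .DeInv = 1 := by
  have := RingQuot.mkAlgHom_rel k (HRel.De_mul (k := k) (E := E) (F := F))
  simpa using! this
lemma mul_De : gen E F .DeInv * gen E F .De = 1 := by
  have := RingQuot.mkAlgHom_rel k (HRel.mul_De (k := k) (E := E) (F := F))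
  simpa using! this
lemma Df_mul : gen E F .Df * gen E F .DfInv = 1 := by
  have := RingQuot.mkAlgHom_rel k (HRel.Df_mul (k := k) (E := E) (F := F))
  simpa using! this
lemma mul_Df : gen E F .DfInv * gen E F .Df = 1 := by
  have := RingQuot.mkAlgHom_rel k (HRel.mul_Df (k := k) (E := E) (F := F))
  simpa using! this


section coalgebra

/-- `Δ(u_{ij}) = ∑ u_{il} ⊗ u_{lj}`, with `D_e^{±1}` and `D_f^{±1}` grouplike. -/
noncomputable def comulAlg : HAlg k E F →ₐ[k] HAlg k E F ⊗[k] HAlg k E F :=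
  lift E F
    (fun g => match g with
      | .u i j => ∑ l, u E F i l ⊗ₜ[k] u E F l j
      | g => gen E F g ⊗ₜ[k] gen E F g)
    (fun j => by
      change ∑ i : Fin m → Fin n, E i •
        wordProd (fun x y => ∑ l, u E F x l ⊗ₜ[k] u E F l y) i j = _
      simp only [wordProd_tmul, Finset.smul_sum]
      rw [Finset.sum_comm]
      simp only [TensorProduct.smul_tmul', ← TensorProduct.sum_tmul, relE]
      simp only [TensorProduct.smul_tmul, ← TensorProduct.tmul_sum, relE])
    (fun j => by
      change ∑ i : Fin m → Fin n, F i •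
        wordProd (fun x y => ∑ l, u E F x l ⊗ₜ[k] u E F l y) j i = _
      simp only [wordProd_tmul, Finset.smul_sum]
      rw [Finset.sum_comm]
      simp only [← TensorProduct.tmul_smul, ← TensorProduct.tmul_sum, relF]
      simp only [← TensorProduct.smul_tmul, ← TensorProduct.sum_tmul, relF])
    (by simp [De_mul, Algebra.TensorProduct.one_def])
    (by simp [mul_De, Algebra.TensorProduct.one_def])
    (by simp [Df_mul, Algebra.TensorProduct.one_def])
    (by simp [mul_Df, Algebra.TensorProduct.one_def])

/-- `ε(u_{ij}) = δ_{ij}`, `ε(D_e^{±1}) = ε(D_f^{±1}) = 1`. -/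
noncomputable def counitAlg : HAlg k E F →ₐ[k] k :=
  lift E F
    (fun g => match g with
      | .u i j => if i = j then 1 else 0
      | _ => 1)
    (fun j => by
      change ∑ i : Fin m → Fin n, E i •
        wordProd (fun x y => if x = y then (1 : k) else 0) i j = _
      simp [wordProd_delta])
    (fun j => by
      change ∑ i : Fin m → Fin n, F i •
        wordProd (fun x y => if x = y then (1 : k) else 0) j i = _
      simp [wordProd_delta])
    (by simp) (by simp) (by simp) (by simp)

lemma comulAlg_u (i j : Fin n) :
    comulAlg E F (u E F i j) = ∑ l, u E F i l ⊗ₜ[k] u E F l j := lift_gen ..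
lemma comulAlg_De : comulAlg E F (gen E F .De) = gen E F .De ⊗ₜ gen E F .De := lift_gen ..
lemma comulAlg_DeInv :
    comulAlg E F (gen E F .DeInv) = gen E F .DeInv ⊗ₜ gen E F .DeInv := lift_gen ..
lemma comulAlg_Df : comulAlg E F (gen E F .Df) = gen E F .Df ⊗ₜ gen E F .Df := lift_gen ..
lemma comulAlg_DfInv :
    comulAlg E F (gen E F .DfInv) = gen E F .DfInv ⊗ₜ gen E F .DfInv := lift_gen ..
lemma counitAlg_u (i j : Fin n) :
    counitAlg E F (u E F i j) = if i = j then 1 else 0 := lift_gen ..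
lemma counitAlg_De : counitAlg E F (gen E F .De) = 1 := lift_gen ..
lemma counitAlg_DeInv : counitAlg E F (gen E F .DeInv) = 1 := lift_gen ..
lemma counitAlg_Df : counitAlg E F (gen E F .Df) = 1 := lift_gen ..
lemma counitAlg_DfInv : counitAlg E F (gen E F .DfInv) = 1 := lift_gen ..

noncomputable instance : Bialgebra k (HAlg k E F) :=
  Bialgebra.ofAlgHom (comulAlg E F) (counitAlg E F)
    (hom_ext fun g => by
      cases g <;> simp [comulAlg_u, comulAlg_De, comulAlg_DeInv, comulAlg_Df, comulAlg_DfInv,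
        TensorProduct.sum_tmul, TensorProduct.tmul_sum]
      exact Finset.sum_comm)
    (hom_ext fun g => by
      cases g <;> simp [comulAlg_u, comulAlg_De, comulAlg_DeInv, comulAlg_Df, comulAlg_DfInv,
        counitAlg_u, counitAlg_De, counitAlg_DeInv, counitAlg_Df, counitAlg_DfInv,
        TensorProduct.ite_tmul])
    (hom_ext fun g => by
      cases g <;> simp [comulAlg_u, comulAlg_De, comulAlg_DeInv, comulAlg_Df, comulAlg_DfInv,
        counitAlg_u, counitAlg_De, counitAlg_DeInv, counitAlg_Df, counitAlg_DfInv,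
        TensorProduct.tmul_ite])

end coalgebra

section antipode
open MulOpposite

variable {E F}
variable (c : Fin n → Fin n → HAlg k E F)

/-- The antipode as an anti-homomorphism, for `c` the inverse of the matrix `(u_{ij})`. -/
noncomputable def antipodeAlg
    (huc : ∀ x y, ∑ l, u E F x l * c l y = if x = y then 1 else 0)
    (hcu : ∀ x y, ∑ l, c x l * u E F l y = if x = y then 1 else 0) :
    HAlg k E F →ₐ[k] (HAlg k E F)ᵐᵒᵖ :=
  lift E F
    (fun g => match g with
      | .u i j => op (c i j)
      | .De => op (gen E F .DeInv)
      | .DeInv => op (gen E F .De)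
      | .Df => op (gen E F .DfInv)
      | .DfInv => op (gen E F .Df))
    (fun j => by
      change ∑ i : Fin m → Fin n, E i • wordProd (fun x y => op (c x y)) i j = _
      apply unop_injective
      have h : ∀ i : Fin m → Fin n, E i • (1 : HAlg k E F) =
          ∑ r : Fin m → Fin n, E r • (gen E F .DeInv * wordProd (u E F) r i) := by
        intro i
        simp only [← mul_smul_comm, ← Finset.mul_sum, relE]
        rw [mul_smul_comm, mul_De]
      simp only [Finset.unop_sum, unop_smul, unop_op]
      have h' : ∀ i : Fin m → Fin n, E i • unop (wordProd (fun x y => op (c x y)) i j) =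
          ∑ r : Fin m → Fin n, E r • (gen E F .DeInv * (wordProd (u E F) r i *
            unop (wordProd (fun x y => op (c x y)) i j))) := by
        intro i
        rw [← one_mul (unop _), ← smul_mul_assoc, h, Finset.sum_mul]
        simp only [one_mul, smul_mul_assoc, mul_assoc]
      simp only [h']
      rw [Finset.sum_comm]
      simp only [← Finset.smul_sum, ← Finset.mul_sum, sum_wordProd_mul_op _ _ huc]
      simp)
    (fun j => by
      change ∑ i : Fin m → Fin n, F i • wordProd (fun x y => op (c x y)) j i = _
      apply unop_injective
      have h : ∀ i : Fin m → Fin n, F i • (1 : HAlg k E F) =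
          ∑ r : Fin m → Fin n, F r • (wordProd (u E F) i r * gen E F .Df) := by
        intro i
        simp only [← smul_mul_assoc, ← Finset.sum_mul, relF]
        rw [smul_mul_assoc, mul_Df]
      simp only [Finset.unop_sum, unop_smul, unop_op]
      have h' : ∀ i : Fin m → Fin n, F i • unop (wordProd (fun x y => op (c x y)) j i) =
          ∑ r : Fin m → Fin n, F r • ((unop (wordProd (fun x y => op (c x y)) j i) *
            wordProd (u E F) i r) * gen E F .Df) := by
        intro i
        rw [← mul_one (unop _), ← mul_smul_comm, h, Finset.mul_sum]
        simp only [mul_one, mul_smul_comm, mul_assoc]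
      simp only [h']
      rw [Finset.sum_comm]
      simp only [← Finset.smul_sum, ← Finset.sum_mul, sum_op_mul_wordProd _ _ hcu]
      simp)
    (by rw [← op_mul, De_mul, op_one]) (by rw [← op_mul, mul_De, op_one])
    (by rw [← op_mul, Df_mul, op_one]) (by rw [← op_mul, mul_Df, op_one])

/-- The antipode as a linear map. -/
noncomputable def antipodeLin
    (huc : ∀ x y, ∑ l, u E F x l * c l y = if x = y then 1 else 0)
    (hcu : ∀ x y, ∑ l, c x l * u E F l y = if x = y then 1 else 0) :
    HAlg k E F →ₗ[k] HAlg k E F :=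
  (opLinearEquiv k).symm.toLinearMap ∘ₗ (antipodeAlg c huc hcu).toLinearMap

lemma antipodeLin_mul (x y : HAlg k E F)
    (huc : ∀ x y, ∑ l, u E F x l * c l y = if x = y then 1 else 0)
    (hcu : ∀ x y, ∑ l, c x l * u E F l y = if x = y then 1 else 0) : antipodeLin c huc hcu (x * y) =
    antipodeLin c huc hcu y * antipodeLin c huc hcu x := by
  simp [antipodeLin]

lemma antipodeLin_algebraMap (r : k)
    (huc : ∀ x y, ∑ l, u E F x l * c l y = if x = y then 1 else 0)
    (hcu : ∀ x y, ∑ l, c x l * u E F l y = if x = y then 1 else 0) : antipodeLin c huc hcu (algebraMap k _ r) =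
    algebraMap k _ r := by
  simp [antipodeLin]

lemma antipodeLin_u (i j : Fin n)
    (huc : ∀ x y, ∑ l, u E F x l * c l y = if x = y then 1 else 0)
    (hcu : ∀ x y, ∑ l, c x l * u E F l y = if x = y then 1 else 0) : antipodeLin c huc hcu (u E F i j) = c i j := by
  simp only [antipodeLin, LinearMap.comp_apply, AlgHom.toLinearMap_apply, antipodeAlg]
  rw [lift_gen]; rfl
lemma antipodeLin_De
    (huc : ∀ x y, ∑ l, u E F x l * c l y = if x = y then 1 else 0)
    (hcu : ∀ x y, ∑ l, c x l * u E F l y = if x = y then 1 else 0) : antipodeLin c huc hcu (gen E F .De) = gen E F .DeInv := by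
  simp only [antipodeLin, LinearMap.comp_apply, AlgHom.toLinearMap_apply, antipodeAlg]
  rw [lift_gen]; rfl
lemma antipodeLin_DeInv
    (huc : ∀ x y, ∑ l, u E F x l * c l y = if x = y then 1 else 0)
    (hcu : ∀ x y, ∑ l, c x l * u E F l y = if x = y then 1 else 0) : antipodeLin c huc hcu (gen E F .DeInv) = gen E F .De := by
  simp only [antipodeLin, LinearMap.comp_apply, AlgHom.toLinearMap_apply, antipodeAlg]
  rw [lift_gen]; rfl
lemma antipodeLin_Df
    (huc : ∀ x y, ∑ l, u E F x l * c l y = if x = y then 1 else 0)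
    (hcu : ∀ x y, ∑ l, c x l * u E F l y = if x = y then 1 else 0) : antipodeLin c huc hcu (gen E F .Df) = gen E F .DfInv := by
  simp only [antipodeLin, LinearMap.comp_apply, AlgHom.toLinearMap_apply, antipodeAlg]
  rw [lift_gen]; rfl
lemma antipodeLin_DfInv
    (huc : ∀ x y, ∑ l, u E F x l * c l y = if x = y then 1 else 0)
    (hcu : ∀ x y, ∑ l, c x l * u E F l y = if x = y then 1 else 0) : antipodeLin c huc hcu (gen E F .DfInv) = gen E F .Df := by
  simp only [antipodeLin, LinearMap.comp_apply, AlgHom.toLinearMap_apply, antipodeAlg]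
  rw [lift_gen]; rfl

end antipode


end HAlg

section antihom
variable {k : Type u} {H : Type v} [Field k] [Ring H] [Bialgebra k H]

lemma antihom_left_mul (S : H →ₗ[k] H) (hS : ∀ x y, S (x * y) = S y * S x) (t s : H ⊗[k] H)
    (r : k) (ht : LinearMap.mul' k H (S.rTensor H t) = algebraMap k H r) :
    LinearMap.mul' k H (S.rTensor H (t * s)) =
      algebraMap k H r * LinearMap.mul' k H (S.rTensor H s) := by
  have key : ∀ (c d : H) (t : H ⊗[k] H), LinearMap.mul' k H (S.rTensor H (t * c ⊗ₜ d)) =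
      S c * LinearMap.mul' k H (S.rTensor H t) * d := by
    intro c d t
    induction t with
    | zero => simp
    | tmul a b => simp [hS, mul_assoc]
    | add x y hx hy => simp only [add_mul, map_add, hx, hy, mul_add]
  induction s with
  | zero => simp
  | tmul c d =>
    rw [key, ht]
    simp only [LinearMap.rTensor_tmul, LinearMap.mul'_apply]
    rw [← Algebra.commutes, mul_assoc]
  | add x y hx hy => simp only [mul_add, map_add, hx, hy]

lemma antihom_right_mul (S : H →ₗ[k] H) (hS : ∀ x y, S (x * y) = S y * S x) (t s : H ⊗[k] H)
    (r : k) (hs : LinearMap.mul' k H (S.lTensor H s) = algebraMap k H r) :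
    LinearMap.mul' k H (S.lTensor H (t * s)) =
      algebraMap k H r * LinearMap.mul' k H (S.lTensor H t) := by
  have key : ∀ (a b : H) (s : H ⊗[k] H), LinearMap.mul' k H (S.lTensor H (a ⊗ₜ b * s)) =
      a * LinearMap.mul' k H (S.lTensor H s) * S b := by
    intro a b s
    induction s with
    | zero => simp
    | tmul a b => simp [hS, mul_assoc]
    | add x y hx hy => simp only [add_mul, map_add, hx, hy, mul_add]
  induction t with
  | zero => simp
  | tmul c d =>
    rw [key, hs]
    simp only [LinearMap.lTensor_tmul, LinearMap.mul'_apply]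
    rw [← Algebra.commutes, mul_assoc]
  | add x y hx hy => simp only [add_mul, mul_add, map_add, hx, hy]

end antihom

namespace HAlg
variable {k : Type u} [Field k] {m n : ℕ} {E F : (Fin m → Fin n) → k}

lemma comul_gen (x : HAlg k E F) : Coalgebra.comul (R := k) x = comulAlg E F x := rfl
lemma counit_gen (x : HAlg k E F) : Coalgebra.counit (R := k) x = counitAlg E F x := rfl

lemma antipode_left (c : Fin n → Fin n → HAlg k E F)
    (huc : ∀ x y, ∑ l, u E F x l * c l y = if x = y then 1 else 0)
    (hcu : ∀ x y, ∑ l, c x l * u E F l y = if x = y then 1 else 0) (x : HAlg k E F) :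
    LinearMap.mul' k _ ((antipodeLin c huc hcu).rTensor _ (comulAlg E F x)) =
      algebraMap k _ (counitAlg E F x) := by
  induction x using HAlg.induction with
  | hs r => simp [Algebra.TensorProduct.algebraMap_apply, antipodeLin_algebraMap]
  | hg g =>
    cases g <;> simp [comulAlg_u, comulAlg_De, comulAlg_DeInv, comulAlg_Df, comulAlg_DfInv,
      counitAlg_u, counitAlg_De, counitAlg_DeInv, counitAlg_Df, counitAlg_DfInv,
      antipodeLin_u, antipodeLin_De, antipodeLin_DeInv, antipodeLin_Df, antipodeLin_DfInv,
      hcu, De_mul, mul_De, Df_mul, mul_Df]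
  | hm x y hx hy =>
    rw [map_mul, antihom_left_mul _ (fun x y => antipodeLin_mul c x y huc hcu) _ _ _ hx, hy, map_mul, map_mul]
  | ha x y hx hy => simp only [map_add, hx, hy]

lemma antipode_right (c : Fin n → Fin n → HAlg k E F)
    (huc : ∀ x y, ∑ l, u E F x l * c l y = if x = y then 1 else 0)
    (hcu : ∀ x y, ∑ l, c x l * u E F l y = if x = y then 1 else 0) (x : HAlg k E F) :
    LinearMap.mul' k _ ((antipodeLin c huc hcu).lTensor _ (comulAlg E F x)) =
      algebraMap k _ (counitAlg E F x) := by
  induction x using HAlg.induction with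
  | hs r =>
    have h1 : antipodeLin c huc hcu 1 = 1 := by simpa using antipodeLin_algebraMap c 1 huc hcu
    simp [Algebra.TensorProduct.algebraMap_apply, h1]
  | hg g =>
    cases g <;> simp [comulAlg_u, comulAlg_De, comulAlg_DeInv, comulAlg_Df, comulAlg_DfInv,
      counitAlg_u, counitAlg_De, counitAlg_DeInv, counitAlg_Df, counitAlg_DfInv,
      antipodeLin_u, antipodeLin_De, antipodeLin_DeInv, antipodeLin_Df, antipodeLin_DfInv,
      huc, De_mul, mul_De, Df_mul, mul_Df]
  | hm x y hx hy =>
    rw [map_mul, antihom_right_mul _ (fun x y => antipodeLin_mul c x y huc hcu) _ _ _ hy, hx, map_mul, map_mul,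
      Algebra.commutes]
  | ha x y hx hy => simp only [map_add, hx, hy]

end HAlg

/-! ### Polar forms, and invertibility of the matrix `(u_{ij})` -/

section polar
variable {k : Type u} {Z : Type v} [Field k] [AddCommGroup Z] [Module k Z] {m n : ℕ}

/-- A family of functionals separating points has a dual family. -/
lemma exists_dual_family {ι : Type} [Fintype ι] [DecidableEq ι] (b : Module.Basis (Fin n) k Z)
    (L : Z →ₗ[k] (ι → k)) (hL : Function.Injective L) :
    ∃ g : ι → Fin n → k, ∀ i j, ∑ w, L (b i) w * g w j = if i = j then 1 else 0 := by
  obtain ⟨g, hg⟩ := L.exists_leftInverse_of_injective (LinearMap.ker_eq_bot.mpr hL)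
  refine ⟨fun w j => b.repr (g (Pi.single w 1)) j, fun i j => ?_⟩
  have h1 : g (L (b i)) = b i := LinearMap.congr_fun hg (b i)
  have h2 : L (b i) = ∑ w, L (b i) w • (Pi.single w 1 : ι → k) := by
    ext w; simp [Finset.sum_apply, Pi.single_apply]
  have h3 : b.repr (g (L (b i))) j = ∑ w, L (b i) w * b.repr (g (Pi.single w 1)) j := by
    conv_lhs => rw [h2]
    simp [map_sum]
  rw [← h3, h1, b.repr_self, Finsupp.single_apply]

/-- The map `x ↦ t(x, -, …, -)`, recorded on words in the basis. -/
noncomputable def PreregularForm.slice (t : PreregularForm k Z (m + 1))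
    (b : Module.Basis (Fin n) k Z) : Z →ₗ[k] ((Fin m → Fin n) → k) where
  toFun x w := t.form.curryLeft x fun p => b (w p)
  map_add' x y := by ext; simp
  map_smul' r x := by ext; simp

lemma PreregularForm.slice_injective (t : PreregularForm k Z (m + 1))
    (b : Module.Basis (Fin n) k Z) : Function.Injective (t.slice b) := by
  rw [injective_iff_map_eq_zero]
  intro x hx
  have h0 : t.form.curryLeft x = 0 :=
    Module.Basis.ext_multilinear (fun _ => b) fun w => congrFun hx w
  refine t.nondegenerate x fun z i hi hz => ?_
  obtain rfl : i = 0 := Fin.ext hi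
  have := congrArg (fun f => f (Fin.tail z)) h0
  simpa [← hz, Fin.cons_self_tail] using this

lemma PreregularForm.exists_polar_first (t : PreregularForm k Z (m + 1))
    (b : Module.Basis (Fin n) k Z) :
    ∃ g : (Fin m → Fin n) → Fin n → k, ∀ i j,
      ∑ w : Fin m → Fin n, t.coeff b (Fin.cons i w) * g w j = if i = j then 1 else 0 := by
  obtain ⟨g, hg⟩ := exists_dual_family b (t.slice b) (t.slice_injective b)
  refine ⟨g, fun i j => ?_⟩
  rw [← hg i j]
  refine Finset.sum_congr rfl fun w _ => ?_
  congr 1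
  change t.form _ = t.form _
  congr 1
  funext p
  refine Fin.cases ?_ (fun p => ?_) p <;> simp

lemma PreregularForm.exists_polar_last (t : PreregularForm k Z (m + 1))
    (b : Module.Basis (Fin n) k Z) :
    ∃ g : (Fin m → Fin n) → Fin n → k, ∀ i j,
      ∑ w : Fin m → Fin n, t.coeff b (Fin.snoc w i) * g w j = if i = j then 1 else 0 := by
  obtain ⟨φ, hφ⟩ := t.cyclic
  obtain ⟨g, hg⟩ := exists_dual_family b (t.slice b ∘ₗ φ.toLinearMap)
    ((t.slice_injective b).comp φ.injective)
  refine ⟨g, fun i j => ?_⟩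
  rw [← hg i j]
  refine Finset.sum_congr rfl fun w _ => ?_
  congr 1
  change t.form _ = t.form _
  rw [hφ]
  congr 1
  funext p
  refine Fin.cases ?_ (fun p => ?_) p
  · have : (finRotate (m + 1)).symm 0 = Fin.last m := by
      rw [Equiv.symm_apply_eq, finRotate_last]
    simp [this]
  · have : (finRotate (m + 1)).symm p.succ = p.castSucc := by
      rw [Equiv.symm_apply_eq]; simp
    simp [this]

end polar

namespace HAlg
variable {k : Type u} {V : Type v} [Field k] [AddCommGroup V] [Module k V] {m n : ℕ}

lemma exists_left_inverse (E F : (Fin (m + 1) → Fin n) → k)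
    (g : (Fin m → Fin n) → Fin n → k)
    (hg : ∀ i j, ∑ w : Fin m → Fin n, E (Fin.snoc w i) * g w j = if i = j then 1 else 0) :
    ∃ c : Fin n → Fin n → HAlg k E F,
      ∀ x y, ∑ l, c x l * u E F l y = if x = y then 1 else 0 := by
  refine ⟨fun x l => gen E F .DeInv * ∑ w : Fin m → Fin n, ∑ w' : Fin m → Fin n,
    (g w x * E (Fin.snoc w' l)) • wordProd (u E F) w' w, fun x y => ?_⟩
  have h : ∀ w : Fin m → Fin n, ∑ l, ∑ w' : Fin m → Fin n,
      E (Fin.snoc w' l) • (wordProd (u E F) w' w * u E F l y) =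
      E (Fin.snoc w y) • gen E F .De := by
    intro w
    rw [← relE, sum_word_snoc]
    simp [wordProd_succ_last]
  have h2 : ∑ l, (∑ w : Fin m → Fin n, ∑ w' : Fin m → Fin n,
      (g w x * E (Fin.snoc w' l)) • wordProd (u E F) w' w) * u E F l y =
      ∑ w : Fin m → Fin n, (E (Fin.snoc w y) * g w x) • gen E F .De := by
    simp only [Finset.sum_mul, smul_mul_assoc]
    rw [Finset.sum_comm]
    refine Finset.sum_congr rfl fun w _ => ?_
    rw [mul_comm, mul_smul, ← h w, Finset.smul_sum]
    simp only [Finset.smul_sum, mul_smul]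
  simp only [mul_assoc, ← Finset.mul_sum, h2, ← Finset.sum_smul, hg]
  rw [mul_smul_comm, mul_De]
  by_cases hxy : x = y
  · simp [hxy]
  · simp [hxy, Ne.symm hxy]

lemma exists_right_inverse (E F : (Fin (m + 1) → Fin n) → k)
    (g : (Fin m → Fin n) → Fin n → k)
    (hg : ∀ i j, ∑ w : Fin m → Fin n, F (Fin.cons i w) * g w j = if i = j then 1 else 0) :
    ∃ c : Fin n → Fin n → HAlg k E F,
      ∀ x y, ∑ l, u E F x l * c l y = if x = y then 1 else 0 := by
  refine ⟨fun l y => (∑ w' : Fin m → Fin n, ∑ w : Fin m → Fin n,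
    (g w' y * F (Fin.cons l w)) • wordProd (u E F) w' w) * gen E F .Df, fun x y => ?_⟩
  have h : ∀ w' : Fin m → Fin n, ∑ l, ∑ w : Fin m → Fin n,
      F (Fin.cons l w) • (u E F x l * wordProd (u E F) w' w) =
      F (Fin.cons x w') • gen E F .DfInv := by
    intro w
    rw [← relF, sum_word_cons]
    simp [wordProd_succ]
  have h2 : ∑ l, u E F x l * (∑ w' : Fin m → Fin n, ∑ w : Fin m → Fin n,
      (g w' y * F (Fin.cons l w)) • wordProd (u E F) w' w) =
      ∑ w : Fin m → Fin n, (F (Fin.cons x w) * g w y) • gen E F .DfInv := by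
    simp only [Finset.mul_sum, mul_smul_comm]
    rw [Finset.sum_comm]
    refine Finset.sum_congr rfl fun w _ => ?_
    rw [mul_comm, mul_smul, ← h w, Finset.smul_sum]
    simp only [Finset.smul_sum, mul_smul]
  simp only [← mul_assoc, ← Finset.sum_mul, h2, ← Finset.sum_smul, hg]
  rw [smul_mul_assoc, mul_Df]
  by_cases hxy : x = y <;> simp [hxy]

end HAlg

/-- The Hopf algebra `H(e, f)`, in coordinates for a basis `v` of `V` and its dual basis. -/
abbrev QuantumH {k : Type u} {V : Type v} [Field k] [AddCommGroup V] [Module k V] {m n : ℕ}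
    (v : Module.Basis (Fin n) k V) (e : PreregularForm k V m)
    (f : PreregularForm k (Module.Dual k V) m) : Type u :=
  HAlg k (e.coeff v) (f.coeff v.dualBasis)

namespace QuantumH
variable {k : Type u} {V : Type v} [Field k] [AddCommGroup V] [Module k V] {m n : ℕ}
    (v : Module.Basis (Fin n) k V) (e : PreregularForm k V m)
    (f : PreregularForm k (Module.Dual k V) m)

lemma exists_inverse : ∃ c : Fin n → Fin n → QuantumH v e f,
    (∀ x y, ∑ l, HAlg.u _ _ x l * c l y = if x = y then 1 else 0) ∧
    (∀ x y, ∑ l, c x l * HAlg.u _ _ l y = if x = y then 1 else 0) := by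
  cases m with
  | zero =>
    have hn : ∀ x : Fin n, False := fun x =>
      v.ne_zero x (e.nondegenerate (v x) fun _ i => i.elim0)
    exact ⟨fun x => (hn x).elim, fun x => (hn x).elim, fun x => (hn x).elim⟩
  | succ m =>
    obtain ⟨g, hg⟩ := e.exists_polar_last v
    obtain ⟨g', hg'⟩ := f.exists_polar_first v.dualBasis
    obtain ⟨c, hc⟩ := HAlg.exists_left_inverse _ (f.coeff v.dualBasis) g hg
    obtain ⟨d, hd⟩ := HAlg.exists_right_inverse (e.coeff v) _ g' hg'
    let U : Matrix (Fin n) (Fin n) (QuantumH v e f) := Matrix.of (HAlg.u _ _)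
    have h1 : Matrix.of c * U = 1 := by
      ext x y; simpa [Matrix.mul_apply, Matrix.one_apply, U] using hc x y
    have h2 : U * Matrix.of d = 1 := by
      ext x y; simpa [Matrix.mul_apply, Matrix.one_apply, U] using hd x y
    have hcd : c = d := Matrix.of.injective (left_inv_eq_right_inv h1 h2)
    subst hcd
    exact ⟨c, hd, hc⟩

/-- The inverse of the matrix `(u_{ij})`; it is `(S(u_{ij}))`. -/
noncomputable def invMatrix : Fin n → Fin n → QuantumH v e f := (exists_inverse v e f).choose

lemma mul_invMatrix (x y : Fin n) :
    ∑ l, HAlg.u _ _ x l * invMatrix v e f l y = if x = y then 1 else 0 :=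
  (exists_inverse v e f).choose_spec.1 x y

lemma invMatrix_mul (x y : Fin n) :
    ∑ l, invMatrix v e f x l * HAlg.u _ _ l y = if x = y then 1 else 0 :=
  (exists_inverse v e f).choose_spec.2 x y

noncomputable instance : HopfAlgebra k (QuantumH v e f) where
  antipode := HAlg.antipodeLin (invMatrix v e f) (mul_invMatrix v e f) (invMatrix_mul v e f)
  mul_antipode_rTensor_comul := LinearMap.ext fun x =>
    HAlg.antipode_left _ (mul_invMatrix v e f) (invMatrix_mul v e f) x
  mul_antipode_lTensor_comul := LinearMap.ext fun x =>
    HAlg.antipode_right _ (mul_invMatrix v e f) (invMatrix_mul v e f) x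

end QuantumH


namespace QuantumH
variable {k : Type u} {V : Type v} [Field k] [AddCommGroup V] [Module k V] {m n : ℕ}
    (v : Module.Basis (Fin n) k V) (e : PreregularForm k V m)
    (f : PreregularForm k (Module.Dual k V) m)

/-- The two-sided ideal `(D_e - 1, D_f - 1)` of `H(e, f)`. -/
noncomputable def slIdeal : Ideal (QuantumH v e f) :=
  (TwoSidedIdeal.span {HAlg.gen _ _ .De - 1, HAlg.gen _ _ .Df - 1}).asIdeal

instance : (slIdeal v e f).IsTwoSided := by unfold slIdeal; infer_instance

lemma map_eq_zero_of_mem_slIdeal {B : Type*} [Ring B] (φ : QuantumH v e f →+* B)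
    (h1 : φ (HAlg.gen _ _ .De) = 1) (h2 : φ (HAlg.gen _ _ .Df) = 1) {x : QuantumH v e f}
    (hx : x ∈ slIdeal v e f) : φ x = 0 := by
  have h : TwoSidedIdeal.span {HAlg.gen _ _ .De - 1, HAlg.gen _ _ .Df - 1} ≤
      TwoSidedIdeal.ker φ := by
    rw [TwoSidedIdeal.span_le]
    rintro y (rfl | rfl)
    · simp [TwoSidedIdeal.mem_ker, h1]
    · simp [TwoSidedIdeal.mem_ker, h2]
  exact (TwoSidedIdeal.mem_ker φ).1 (h (TwoSidedIdeal.mem_asIdeal.1 hx))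

lemma mk_De : Ideal.Quotient.mk (slIdeal v e f) (HAlg.gen _ _ .De) = 1 := by
  rw [← sub_eq_zero, ← map_one (Ideal.Quotient.mk (slIdeal v e f)), ← map_sub,
    Ideal.Quotient.eq_zero_iff_mem]
  exact TwoSidedIdeal.mem_asIdeal.2 (TwoSidedIdeal.subset_span (by simp))

lemma mk_Df : Ideal.Quotient.mk (slIdeal v e f) (HAlg.gen _ _ .Df) = 1 := by
  rw [← sub_eq_zero, ← map_one (Ideal.Quotient.mk (slIdeal v e f)), ← map_sub,
    Ideal.Quotient.eq_zero_iff_mem]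
  exact TwoSidedIdeal.mem_asIdeal.2 (TwoSidedIdeal.subset_span (by simp))

lemma mk_DeInv : Ideal.Quotient.mk (slIdeal v e f) (HAlg.gen _ _ .DeInv) = 1 := by
  have := congrArg (Ideal.Quotient.mk (slIdeal v e f)) (HAlg.De_mul _ _)
  simpa [mk_De] using this

lemma mk_DfInv : Ideal.Quotient.mk (slIdeal v e f) (HAlg.gen _ _ .DfInv) = 1 := by
  have := congrArg (Ideal.Quotient.mk (slIdeal v e f)) (HAlg.Df_mul _ _)
  simpa [mk_Df] using this

instance : (slIdeal v e f).IsHopfIdeal k where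
  counit_eq_zero x hx := by
    change HAlg.counitAlg _ _ x = 0
    exact map_eq_zero_of_mem_slIdeal v e f
      (HAlg.counitAlg (e.coeff v) (f.coeff v.dualBasis)).toRingHom
      (HAlg.counitAlg_De _ _) (HAlg.counitAlg_Df _ _) hx
  map_mkQ_comul_eq_zero x hx :=
    map_eq_zero_of_mem_slIdeal v e f
      (((Algebra.TensorProduct.map (Ideal.Quotient.mkₐ k (slIdeal v e f))
        (Ideal.Quotient.mkₐ k (slIdeal v e f))).comp (HAlg.comulAlg _ _)) :
        QuantumH v e f →+* (QuantumH v e f ⧸ slIdeal v e f) ⊗[k] (QuantumH v e f ⧸ slIdeal v e f))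
      (by simp [HAlg.comulAlg_De, mk_De, Algebra.TensorProduct.one_def])
      (by simp [HAlg.comulAlg_Df, mk_Df, Algebra.TensorProduct.one_def]) hx
  antipode_mem x hx := by
    rw [← Ideal.Quotient.eq_zero_iff_mem]
    apply MulOpposite.op_injective
    refine map_eq_zero_of_mem_slIdeal v e f
      ((Ideal.Quotient.mk (slIdeal v e f)).op.comp
        (HAlg.antipodeAlg (invMatrix v e f) (mul_invMatrix v e f) (invMatrix_mul v e f) : QuantumH v e f →+* (QuantumH v e f)ᵐᵒᵖ)) ?_ ?_ hx
    · change MulOpposite.op (Ideal.Quotient.mk (slIdeal v e f)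
        (HAlg.antipodeLin (invMatrix v e f) (mul_invMatrix v e f) (invMatrix_mul v e f) (HAlg.gen _ _ .De))) = 1
      rw [HAlg.antipodeLin_De, mk_DeInv]; rfl
    · change MulOpposite.op (Ideal.Quotient.mk (slIdeal v e f)
        (HAlg.antipodeLin (invMatrix v e f) (mul_invMatrix v e f) (invMatrix_mul v e f) (HAlg.gen _ _ .Df))) = 1
      rw [HAlg.antipodeLin_Df, mk_DfInv]; rfl

end QuantumH

/-- The Hopf quotient `S(e, f) = H(e, f) / (D_e - 1, D_f - 1)`. -/
abbrev QuantumS {k : Type u} {V : Type v} [Field k] [AddCommGroup V] [Module k V] {m n : ℕ}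
    (v : Module.Basis (Fin n) k V) (e : PreregularForm k V m)
    (f : PreregularForm k (Module.Dual k V) m) : Type u :=
  QuantumH v e f ⧸ QuantumH.slIdeal v e f


/-- The image of `u_{ij}` in `S(e, f)`. -/
noncomputable def QuantumS.u {k : Type u} {V : Type v} [Field k] [AddCommGroup V] [Module k V]
    {m n : ℕ} (v : Module.Basis (Fin n) k V) (e : PreregularForm k V m)
    (f : PreregularForm k (Module.Dual k V) m) (i j : Fin n) : QuantumS v e f :=
  Ideal.Quotient.mk (QuantumH.slIdeal v e f) (HAlg.u _ _ i j)

/-! ## Superpotential algebras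

A form of degree `m ≥ N` is given by its array of coefficients, and `m` is written `r + N`. -/

section superpotential
variable {k : Type u} [Field k] {r N n : ℕ}

/-- The relations `∑_{j₁, …, j_N} c_{l₁ ⋯ l_r j₁ ⋯ j_N} x_{j₁} ⋯ x_{j_N} = 0`. -/
inductive SuperpotentialRel (c : (Fin (r + N) → Fin n) → k) :
    FreeAlgebra k (Fin n) → FreeAlgebra k (Fin n) → Prop
  | rel (l : Fin r → Fin n) : SuperpotentialRel c
      (∑ j : Fin N → Fin n,
        c (Fin.append l j) • (List.ofFn fun p => FreeAlgebra.ι k (j p)).prod) 0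

/-- The superpotential algebra: the free algebra on `x_1, …, x_n` modulo the relation space
`∂^{m-N}`. -/
def SuperpotentialAlgebra (c : (Fin (r + N) → Fin n) → k) : Type u :=
  RingQuot (SuperpotentialRel c)

namespace SuperpotentialAlgebra
variable (c : (Fin (r + N) → Fin n) → k)

noncomputable instance : Ring (SuperpotentialAlgebra c) :=
  inferInstanceAs (Ring (RingQuot (SuperpotentialRel c)))

noncomputable instance : Algebra k (SuperpotentialAlgebra c) :=
  inferInstanceAs (Algebra k (RingQuot (SuperpotentialRel c)))

/-- The generator `x_i`. -/
noncomputable def x (i : Fin n) : SuperpotentialAlgebra c :=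
  RingQuot.mkAlgHom k (SuperpotentialRel c) (FreeAlgebra.ι k i)

/-- The augmentation `x_i ↦ 0`, whose kernel is the ideal of elements of positive degree. -/
noncomputable def augmentation (hN : 2 ≤ N) : SuperpotentialAlgebra c →ₐ[k] k :=
  RingQuot.liftAlgHom k ⟨FreeAlgebra.lift k fun _ => (0 : k), by
    rintro _ _ ⟨l⟩
    obtain ⟨N, rfl⟩ : ∃ N', N = N' + 1 := ⟨N - 1, by omega⟩
    simp [List.ofFn_succ]⟩

lemma augmentation_x (hN : 2 ≤ N) (i : Fin n) : augmentation c hN (x c i) = 0 := by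
  simp only [augmentation, x]
  erw [RingQuot.liftAlgHom_mkAlgHom_apply]
  simp

/-! ### `N`-Koszulity

Tensors of degree `ℓ` in the generators are identified with their coefficient arrays
`(Fin ℓ → Fin n) → k`, and `A ⊗ (kⁿ)^{⊗ ℓ}` with `(Fin ℓ → Fin n) → A`. -/

/-- The relation space `R = ∂^{m-N} ⊆ (kⁿ)^{⊗ N}`. -/
def relationSpace : Submodule k ((Fin N → Fin n) → k) :=
  Submodule.span k (Set.range fun (l : Fin r → Fin n) (j : Fin N → Fin n) => c (Fin.append l j))

/-- `W_ℓ = ⋂_{s + N + t = ℓ} (kⁿ)^{⊗ s} ⊗ R ⊗ (kⁿ)^{⊗ t}`: the tensors all of whose slices along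
`N` consecutive positions lie in `R` (so `W_ℓ` is everything for `ℓ < N`, and `W_N = R`). -/
def koszulSpace (l : ℕ) : Submodule k ((Fin l → Fin n) → k) :=
  ⨅ (s : ℕ) (t : ℕ) (h : s + N + t = l) (a : Fin s → Fin n) (b : Fin t → Fin n),
    (relationSpace c).comap (LinearMap.funLeft k k fun j : Fin N → Fin n =>
      Fin.append (Fin.append a j) b ∘ Fin.cast h.symm)

/-- The free left `A`-module `A ⊗ W_ℓ`, inside `A ⊗ (kⁿ)^{⊗ ℓ}`. -/
noncomputable def koszulModule (l : ℕ) :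
    Submodule (SuperpotentialAlgebra c) ((Fin l → Fin n) → SuperpotentialAlgebra c) :=
  Submodule.span (SuperpotentialAlgebra c)
    ((fun (w : (Fin l → Fin n) → k) i => algebraMap k (SuperpotentialAlgebra c) (w i)) ''
      (koszulSpace c l : Set ((Fin l → Fin n) → k)))

/-- The `q`-fold Koszul differential
`a ⊗ z₁ ⊗ ⋯ ⊗ z_{q+ℓ} ↦ a z₁ ⋯ z_q ⊗ z_{q+1} ⊗ ⋯ ⊗ z_{q+ℓ}`. -/
noncomputable def koszulDifferential (q l : ℕ) (w : (Fin (q + l) → Fin n) → SuperpotentialAlgebra c)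
    (b : Fin l → Fin n) : SuperpotentialAlgebra c :=
  ∑ a : Fin q → Fin n, w (Fin.append a b) * (List.ofFn fun p => x c (a p)).prod

end SuperpotentialAlgebra

/-- The difference of the internal degrees of the `(i+1)`-st and the `i`-th term of the `N`-Koszul
complex: `1` for `i` even and `N - 1` for `i` odd. -/
def koszulStep (N i : ℕ) : ℕ := if Even i then 1 else N - 1

/-- The internal degree of the `i`-th term of the `N`-Koszul complex: `N p` for `i = 2 p` and
`N p + 1` for `i = 2 p + 1`. -/
def koszulDegree (N : ℕ) : ℕ → ℕ
  | 0 => 0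
  | i + 1 => koszulStep N i + koszulDegree N i

open SuperpotentialAlgebra in
/-- `A` is `N`-Koszul: the complex
`⋯ → A ⊗ W_{N+1} → A ⊗ W_N → A ⊗ W_1 → A → k → 0`, with `i`-th term `A ⊗ W_{koszulDegree N i}` and
differentials alternately the `1`-fold and the `(N-1)`-fold Koszul differential, is exact.
(Exactness at `A` and at `k` holds for every algebra generated in degree one.) -/
def IsNKoszul (c : (Fin (r + N) → Fin n) → k) : Prop :=
  ∀ i : ℕ, ∀ w ∈ koszulModule c (koszulDegree N (i + 1)),
    koszulDifferential c (koszulStep N i) (koszulDegree N i) w = 0 →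
      ∃ w' ∈ koszulModule c (koszulDegree N (i + 2)),
        koszulDifferential c (koszulStep N (i + 1)) (koszulDegree N (i + 1)) w' = w

end superpotential

/-! ## Artin-Schelter regularity -/

section regular
open CategoryTheory

/-- The left-module half of Artin-Schelter regularity of dimension `d` of an augmented algebra. -/
structure IsLeftASRegular {k A : Type u} [Field k] [Ring A] [Algebra k A] (ε : A →ₐ[k] k)
    (d : ℕ) : Prop where
  globalDim_le : ∀ M : ModuleCat.{u} A, HasProjectiveDimensionLE M d
  le_globalDim : ∃ M : ModuleCat.{u} A, ¬ HasProjectiveDimensionLT M d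
  injectiveDim_le : HasInjectiveDimensionLE (ModuleCat.of A A) d
  le_injectiveDim : ¬ HasInjectiveDimensionLT (ModuleCat.of A A) d
  ext_eq_zero : ∀ i : ℕ, i ≠ d → Subsingleton
    (Abelian.Ext ((ModuleCat.restrictScalars (ε : A →+* k)).obj (ModuleCat.of k k))
      (ModuleCat.of A A) i)
  ext_eq_one : Module.finrank k
    (Abelian.Ext ((ModuleCat.restrictScalars (ε : A →+* k)).obj (ModuleCat.of k k))
      (ModuleCat.of A A) d) = 1

/-- Artin-Schelter regularity of dimension `d` of a connected graded algebra with augmentation `ε`: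
global dimension `d` and injective dimension `d` on both sides, and `Ext^i_A(k, A)` is `k` for
`i = d` and zero otherwise, on both sides. Right modules are left modules over `Aᵐᵒᵖ`. -/
def IsASRegular {k A : Type u} [Field k] [Ring A] [Algebra k A] (ε : A →ₐ[k] k) (d : ℕ) : Prop :=
  IsLeftASRegular ε d ∧ IsLeftASRegular (ε.fromOpposite fun _ _ => Commute.all _ _) d

end regular

/-! ## Coactions -/

section coaction
variable {k : Type u} [Field k] {K : Type w} [Ring K] [HopfAlgebra k K]
  {A : Type v} [Ring A] [Algebra k A]

/-- `ρ` makes `A` a left `K`-comodule algebra. -/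
structure IsLeftCoaction (ρ : A →ₐ[k] K ⊗[k] A) : Prop where
  coassoc : (Algebra.TensorProduct.assoc k k k K K A).toAlgHom.comp
      ((Algebra.TensorProduct.map (Bialgebra.comulAlgHom k K) (AlgHom.id k A)).comp ρ) =
    (Algebra.TensorProduct.map (AlgHom.id k K) ρ).comp ρ
  counit : (Algebra.TensorProduct.lid k A).toAlgHom.comp
      ((Algebra.TensorProduct.map (Bialgebra.counitAlgHom k K) (AlgHom.id k A)).comp ρ) =
    AlgHom.id k A

/-- `ρ` makes `A` a right `K`-comodule algebra. -/
structure IsRightCoaction (ρ : A →ₐ[k] A ⊗[k] K) : Prop where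
  coassoc : (Algebra.TensorProduct.assoc k k k A K K).toAlgHom.comp
      ((Algebra.TensorProduct.map ρ (AlgHom.id k K)).comp ρ) =
    (Algebra.TensorProduct.map (AlgHom.id k A) (Bialgebra.comulAlgHom k K)).comp ρ
  counit : (Algebra.TensorProduct.rid k k A).toAlgHom.comp
      ((Algebra.TensorProduct.map (AlgHom.id k A) (Bialgebra.counitAlgHom k K)).comp ρ) =
    AlgHom.id k A

end coaction

/-! ## The homological codeterminant

`Ext^i_A(k, k)` is computed by the bar resolution `A ⊗ A^{⊗ i}` of `k`, that is, as the cohomology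
of the complex of multilinear maps `A^i → k`. A coaction of `K` on `A` extends to the bar
resolution (diagonally), hence acts on this complex, with values in maps `A^i → K`. -/

section codet
variable {k : Type u} [Field k] {A : Type v} [Ring A] [Algebra k A]

/-- The bar differential of an `i`-cochain with trivial coefficients:
`ε(a₀) φ(a₁, …, a_i) + ∑_j (-1)^{j+1} φ(…, a_j a_{j+1}, …) + (-1)^{i+1} φ(a₀, …, a_{i-1}) ε(a_i)`. -/
noncomputable def barDifferential (ε : A →ₐ[k] k) {M : Type w} [AddCommGroup M] [Module k M] {i : ℕ}
    (φ : MultilinearMap k (fun _ : Fin i => A) M) (a : Fin (i + 1) → A) : M :=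
  ε (a 0) • φ (Fin.tail a)
    + ∑ j : Fin i, (-1 : k) ^ (j.val + 1) • φ (Fin.contractNth j.castSucc (· * ·) a)
    + (-1 : k) ^ (i + 1) • ε (a (Fin.last i)) • φ (Fin.init a)

/-- The `i`-cochain `φ` is a cocycle. -/
def IsBarCocycle (ε : A →ₐ[k] k) {i : ℕ} (φ : MultilinearMap k (fun _ : Fin i => A) k) : Prop :=
  ∀ a, barDifferential ε φ a = 0

/-- The `M`-valued `i`-cochain `θ` is a coboundary. -/
def IsBarCoboundary (ε : A →ₐ[k] k) {M : Type w} [AddCommGroup M] [Module k M] :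
    (i : ℕ) → ((Fin i → A) → M) → Prop
  | 0, θ => ∀ a, θ a = 0
  | i + 1, θ => ∃ ψ : MultilinearMap k (fun _ : Fin i => A) M, ∀ a, θ a = barDifferential ε ψ a

/-- The linear form on the tensor algebra of `A` that is `φ` in degree `i` and zero in all other
degrees. -/
noncomputable def cochainForm {i : ℕ} (φ : MultilinearMap k (fun _ : Fin i => A) k) :
    TensorAlgebra k A →ₗ[k] k :=
  PiTensorProduct.lift φ ∘ₗ DirectSum.component k ℕ (fun j => TensorPower k j A) i ∘ₗ
    (TensorAlgebra.toDirectSum (R := k) (M := A)).toLinearMap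

variable {K : Type w} [Ring K] [HopfAlgebra k K]

/-- `(a₁, …, a_i) ↦ ∑ a₁₍₋₁₎ ⋯ a_i₍₋₁₎ φ(a₁₍₀₎, …, a_i₍₀₎)` for a left coaction `ρ`. -/
noncomputable def leftTwist (ρ : A →ₐ[k] K ⊗[k] A) {i : ℕ}
    (φ : MultilinearMap k (fun _ : Fin i => A) k) (a : Fin i → A) : K :=
  TensorProduct.rid k K ((cochainForm φ).lTensor K
    (TensorAlgebra.lift k ((TensorAlgebra.ι k).lTensor K ∘ₗ ρ.toLinearMap)
      (TensorAlgebra.tprod k A i a)))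

/-- `(a₁, …, a_i) ↦ ∑ φ(a₁₍₀₎, …, a_i₍₀₎) a₁₍₁₎ ⋯ a_i₍₁₎` for a right coaction `ρ`. -/
noncomputable def rightTwist (ρ : A →ₐ[k] A ⊗[k] K) {i : ℕ}
    (φ : MultilinearMap k (fun _ : Fin i => A) k) (a : Fin i → A) : K :=
  TensorProduct.lid k K ((cochainForm φ).rTensor K
    (TensorAlgebra.lift k ((TensorAlgebra.ι k).rTensor K ∘ₗ ρ.toLinearMap)
      (TensorAlgebra.tprod k A i a)))

/-- For a left coaction on `A`, with the right coaction on `Ext^d_A(k, k)` obtained by dualizing the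
bar resolution and applying the antipode: `𝔢 ↦ 𝔢 ⊗ D⁻¹` for all `𝔢`. Before the antipode is applied,
this says `𝔢 ↦ 𝔢 ⊗ D`, which is what the equation expresses on cocycles. -/
def IsLeftHomologicalCodet (ε : A →ₐ[k] k) (d : ℕ) (ρ : A →ₐ[k] K ⊗[k] A) (D : K) : Prop :=
  IsUnit D ∧ ∀ φ : MultilinearMap k (fun _ : Fin d => A) k, IsBarCocycle ε φ →
    IsBarCoboundary ε d fun a => leftTwist ρ φ a - φ a • D

/-- For a right coaction on `A`, with the left coaction on `Ext^d_A(k, k)` obtained by dualizing the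
bar resolution and applying the antipode: `𝔢 ↦ D ⊗ 𝔢` for all `𝔢`. Before the antipode is applied,
this says `𝔢 ↦ D⁻¹ ⊗ 𝔢`, which is what the equation expresses on cocycles. -/
def IsRightHomologicalCodet (ε : A →ₐ[k] k) (d : ℕ) (ρ : A →ₐ[k] A ⊗[k] K) (D : K) : Prop :=
  ∃ D' : K, D * D' = 1 ∧ D' * D = 1 ∧
    ∀ φ : MultilinearMap k (fun _ : Fin d => A) k, IsBarCocycle ε φ →
      IsBarCoboundary ε d fun a => rightTwist ρ φ a - φ a • D'

end codet

/-! ## Balanced coactions and their universal property -/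

section balanced
open SuperpotentialAlgebra
variable {k : Type u} [Field k] {r N n : ℕ}

/-- A balanced coaction of `K` on a pair of superpotential algebras: a left coaction on the first
and a right coaction on the second one, given on the generators by the same matrix over `K`. -/
structure BalancedCoaction (K : Type w) [Ring K] [HopfAlgebra k K]
    (c c' : (Fin (r + N) → Fin n) → k) where
  left : SuperpotentialAlgebra c →ₐ[k] K ⊗[k] SuperpotentialAlgebra c
  right : SuperpotentialAlgebra c' →ₐ[k] SuperpotentialAlgebra c' ⊗[k] K
  isLeftCoaction : IsLeftCoaction left
  isRightCoaction : IsRightCoaction right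
  balanced : ∃ a : Fin n → Fin n → K,
    (∀ i, left (x c i) = ∑ j, a i j ⊗ₜ[k] x c j) ∧
    (∀ j, right (x c' j) = ∑ i, x c' i ⊗ₜ[k] a i j)

namespace BalancedCoaction
variable {c c' : (Fin (r + N) → Fin n) → k} {K : Type w} [Ring K] [HopfAlgebra k K]

/-- Both coactions have trivial homological codeterminant. -/
def HasTrivialCodet (β : BalancedCoaction K c c') (hN : 2 ≤ N) (d : ℕ) : Prop :=
  IsLeftHomologicalCodet (augmentation c hN) d β.left 1 ∧
  IsRightHomologicalCodet (augmentation c' hN) d β.right 1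

/-- The Hopf algebra map `φ` carries the balanced coaction `β` to `γ`. -/
def IsMap (β : BalancedCoaction K c c') {K' : Type v} [Ring K'] [HopfAlgebra k K']
    (γ : BalancedCoaction K' c c') (φ : K →ₐc[k] K') : Prop :=
  (Algebra.TensorProduct.map (φ : K →ₐ[k] K') (AlgHom.id k _)).comp β.left = γ.left ∧
  (Algebra.TensorProduct.map (AlgHom.id k _) (φ : K →ₐ[k] K')).comp β.right = γ.right

/-- The universal property that defines the balanced quantum general linear group. -/
def IsBalancedGL (β : BalancedCoaction K c c') : Prop :=
  ∀ (K' : Type v) [Ring K'] [HopfAlgebra k K'] (γ : BalancedCoaction K' c c'),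
    ∃! φ : K →ₐc[k] K', β.IsMap γ φ

/-- The universal property that defines the balanced quantum special linear group, for algebras of
global dimension `d`. -/
def IsBalancedSL (β : BalancedCoaction K c c') (hN : 2 ≤ N) (d : ℕ) : Prop :=
  β.HasTrivialCodet hN d ∧
  ∀ (K' : Type v) [Ring K'] [HopfAlgebra k K'] (γ : BalancedCoaction K' c c'),
    γ.HasTrivialCodet hN d → ∃! φ : K →ₐc[k] K', β.IsMap γ φ

end BalancedCoaction

end balanced

end PreregularPair

open PreregularPair

/-! Write `c` for the coefficient array of `e` or `f`, `R` for the space of relations, `W_l` for the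
Koszul spaces, and `m = r + N`. Condition (ii) of preregularity says that rotating the indices of
`c` amounts to an invertible matrix acting on one index (`IsTwistedCyclic`). Hence every slice of
`c` along `N` consecutive letters lies in `R`, that is, `c ∈ W_m`
(`IsTwistedCyclic.mem_koszulSpace`). Since `m` is the degree of the `d`-th term of the Koszul
resolution and `Ext^d(k, A)` is one-dimensional, `W_m` is the line through `c`
(`koszulSpace_rank_one`).

A coaction given by a matrix preserves `R`, because `A` has no relations of degree `N` outside `R`.
So it preserves `W_m` and multiplies `c` by some `D` in `K` (`exists_multiplier`): this is the
defining relation of `H(e, f)`. The matrix is multiplicative, so the multipliers are grouplike,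
hence invertible, and the map from `H(e, f)` exists (`HAlg.exists_algHom`). It is unique because
`D_e` and `D_f⁻¹` are determined by the `u_{ij}` (`HAlg.algHom_ext_u`). Conversely, if `c` is
semi-invariant under a multiplicative matrix, cancelling the matrix on the `r` fixed letters with
the antipode shows that the relations are preserved (`IsMultiplicative.exists_left`,
`IsMultiplicative.exists_right`).

For (b), the homological codeterminant must be identified with `D`
(`isBarCoboundary_twistCochain_iff`). Cutting words of length `m` into `d` blocks of alternately `1`
and `N - 1` letters carries `W_m` into the bar complex (`evalWord`). The bar complex is compared
with the Koszul complex `P` through the double complex of multilinear maps `A^i × P_j → M`. It is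
contractible in the bar direction because the `P_j` are projective, and exact in the other direction
because `P` is. It follows that a cocycle of degree `d` is a coboundary exactly when it vanishes on
`c`, and that some cocycle does not vanish there. Twisting a cocycle by the coaction multiplies its
value on `c` by `D`, so a trivial codeterminant means `D = 1`, the relation imposed in `S(e, f)`. -/

namespace PreregularPair

/-! ## Words -/

section words
variable {n : ℕ}

lemma sum_word_append {M : Type*} [AddCommMonoid M] {s t : ℕ} (g : (Fin (s + t) → Fin n) → M) :
    ∑ i, g i = ∑ a : Fin s → Fin n, ∑ b : Fin t → Fin n, g (Fin.append a b) := by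
  rw [← (Fin.appendEquiv s t).sum_comp, Fintype.sum_prod_type]
  rfl

lemma wordProd_append {H : Type*} [Monoid H] {s t : ℕ} (a : Fin n → Fin n → H)
    (i j : Fin s → Fin n) (i' j' : Fin t → Fin n) :
    wordProd a (Fin.append i i') (Fin.append j j') = wordProd a i j * wordProd a i' j' := by
  have : (fun p : Fin (s + t) => a (Fin.append i i' p) (Fin.append j j' p)) =
      Fin.append (fun p => a (i p) (j p)) (fun p => a (i' p) (j' p)) := by
    funext p
    refine Fin.addCases (fun p => ?_) (fun p => ?_) p <;> simp
  simp only [wordProd, this, List.ofFn_fin_append, List.prod_append]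

/-- The product of the letters of a word. -/
def letterProd {H : Type*} [Monoid H] {l : ℕ} (y : Fin n → H) (j : Fin l → Fin n) : H :=
  (List.ofFn fun p => y (j p)).prod

lemma letterProd_append {H : Type*} [Monoid H] {s t : ℕ} (y : Fin n → H)
    (i : Fin s → Fin n) (j : Fin t → Fin n) :
    letterProd y (Fin.append i j) = letterProd y i * letterProd y j := by
  have : (fun p : Fin (s + t) => y (Fin.append i j p)) =
      Fin.append (fun p => y (i p)) (fun p => y (j p)) := by
    funext p
    refine Fin.addCases (fun p => ?_) (fun p => ?_) p <;> simp
  simp only [letterProd, this, List.ofFn_fin_append, List.prod_append]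

lemma letterProd_succ {H : Type*} [Monoid H] {l : ℕ} (y : Fin n → H) (j : Fin (l + 1) → Fin n) :
    letterProd y j = y (j 0) * letterProd y (Fin.tail j) := by
  simp only [letterProd, List.ofFn_succ, List.prod_cons, Fin.tail]

lemma letterProd_zero {H : Type*} [Monoid H] (y : Fin n → H) (j : Fin 0 → Fin n) :
    letterProd y j = 1 := by simp [letterProd]

lemma map_letterProd {H H' F : Type*} [Monoid H] [Monoid H'] [FunLike F H H']
    [MonoidHomClass F H H'] {l : ℕ} (φ : F) (y : Fin n → H) (j : Fin l → Fin n) :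
    φ (letterProd y j) = letterProd (fun i => φ (y i)) j := by
  simp only [letterProd, map_list_prod, List.map_ofFn, Function.comp_def]

lemma letterProd_left_matrix {k : Type*} [Field k] {K A : Type*} [Ring K] [Algebra k K] [Ring A]
    [Algebra k A] {l : ℕ} (a : Fin n → Fin n → K) (x : Fin n → A) (i : Fin l → Fin n) :
    letterProd (fun i => ∑ j, a i j ⊗ₜ[k] x j) i
      = ∑ j : Fin l → Fin n, wordProd a i j ⊗ₜ[k] letterProd x j := by
  induction l with
  | zero => simp [wordProd, letterProd, Algebra.TensorProduct.one_def]
  | succ l ih =>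
    rw [letterProd_succ, ih, sum_word_cons, Finset.sum_mul_sum]
    simp only [wordProd_succ, letterProd_succ, Fin.cons_zero, Fin.tail_cons,
      Algebra.TensorProduct.tmul_mul_tmul]

lemma letterProd_right_matrix {k : Type*} [Field k] {K A : Type*} [Ring K] [Algebra k K] [Ring A]
    [Algebra k A] {l : ℕ} (a : Fin n → Fin n → K) (x : Fin n → A) (j : Fin l → Fin n) :
    letterProd (fun j => ∑ i, x i ⊗ₜ[k] a i j) j
      = ∑ i : Fin l → Fin n, letterProd x i ⊗ₜ[k] wordProd a i j := by
  induction l with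
  | zero => simp [wordProd, letterProd, Algebra.TensorProduct.one_def]
  | succ l ih =>
    rw [letterProd_succ, ih, sum_word_cons, Finset.sum_mul_sum]
    simp only [wordProd_succ, letterProd_succ, Fin.cons_zero, Fin.tail_cons,
      Algebra.TensorProduct.tmul_mul_tmul]

end words

/-! ## Linear forms on a presented algebra -/

section descent
variable {k : Type u} [Field k] {B : Type v} [Ring B] [Algebra k B]

/-- The linear forms on `B` that vanish on the two-sided ideal generated by a relation. -/
def annihilatingForms (r : B → B → Prop) : Submodule k (Module.Dual k B) where
  carrier := {L | ∀ x y, r x y → ∀ u v, L (u * x * v) = L (u * y * v)}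
  add_mem' h h' x y hxy u v := by simp [h x y hxy, h' x y hxy]
  zero_mem' := by simp
  smul_mem' t L h x y hxy u v := by simp [h x y hxy]

/-- Right translation of forms. -/
noncomputable def annihilatingFormsAction (r : B → B → Prop) :
    B →ₐ[k] Module.End k (annihilatingForms (k := k) r) where
  toFun b :=
    { toFun := fun L => ⟨L.1 ∘ₗ LinearMap.mulRight k b, fun x y hxy u v => by
        simpa [mul_assoc] using L.2 x y hxy u (v * b)⟩
      map_add' := fun L L' => by ext; simp
      map_smul' := fun t L => by ext; simp }
  map_one' := by ext; simp
  map_mul' b b' := by ext; simp [mul_assoc]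
  map_zero' := by ext; simp
  map_add' b b' := by ext; simp [mul_add]
  commutes' t := by ext; simp [Algebra.algebraMap_eq_smul_one]

/-- The universal property of the quotient concerns algebra maps, so the form is encoded in one: the
quotient acts by right translation on the forms that vanish on the ideal, and the descended form is
`a ↦ (a · L)(1)`. -/
lemma exists_form_ringQuot (r : B → B → Prop) (L : B →ₗ[k] k)
    (hL : ∀ x y, r x y → ∀ u v, L (u * x * v) = L (u * y * v)) :
    ∃ L' : RingQuot r →ₗ[k] k, ∀ b, L' (RingQuot.mkAlgHom k r b) = L b := by
  let Φ : RingQuot r →ₐ[k] Module.End k (annihilatingForms (k := k) r) :=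
    RingQuot.liftAlgHom k ⟨annihilatingFormsAction r, fun x y hxy => by
      ext M z
      simpa [annihilatingFormsAction] using M.2 x y hxy z 1⟩
  refine ⟨⟨⟨fun a => (Φ a ⟨L, hL⟩).1 1, fun a b => by simp⟩, fun t a => by simp⟩, fun b => ?_⟩
  have : Φ (RingQuot.mkAlgHom k r b) = annihilatingFormsAction r b :=
    RingQuot.liftAlgHom_mkAlgHom_apply ..
  change (Φ (RingQuot.mkAlgHom k r b) ⟨L, hL⟩).1 1 = L b
  rw [this]
  simp [annihilatingFormsAction]

end descent

/-! ### Linear forms and independence in low degree in a superpotential algebra. -/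

namespace SuperpotentialAlgebra
variable {k : Type u} [Field k] {r N n : ℕ} (c : (Fin (r + N) → Fin n) → k)

/-- The universal property of the presentation. -/
noncomputable def lift {B : Type v} [Ring B] [Algebra k B] (y : Fin n → B)
    (hy : ∀ l : Fin r → Fin n, ∑ j : Fin N → Fin n, c (Fin.append l j) • letterProd y j = 0) :
    SuperpotentialAlgebra c →ₐ[k] B :=
  RingQuot.liftAlgHom k ⟨FreeAlgebra.lift k y, by
    rintro _ _ ⟨l⟩
    simpa [map_list_prod, letterProd, List.map_ofFn, Function.comp_def] using hy l⟩

@[simp]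
lemma lift_x {B : Type v} [Ring B] [Algebra k B] (y : Fin n → B) (hy) (i : Fin n) :
    lift c y hy (x c i) = y i := by
  simp only [lift, x]
  erw [RingQuot.liftAlgHom_mkAlgHom_apply]
  simp

variable {c} in
lemma hom_ext {B : Type v} [Ring B] [Algebra k B] {φ ψ : SuperpotentialAlgebra c →ₐ[k] B}
    (h : ∀ i, φ (x c i) = ψ (x c i)) : φ = ψ := by
  refine RingQuot.ringQuot_ext' k φ ψ (FreeAlgebra.hom_ext ?_)
  funext i
  exact h i

variable {c} in
@[elab_as_elim]
lemma induction {C : SuperpotentialAlgebra c → Prop} (z : SuperpotentialAlgebra c)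
    (hs : ∀ t : k, C (algebraMap k _ t)) (hg : ∀ i, C (x c i))
    (hm : ∀ x y, C x → C y → C (x * y)) (ha : ∀ x y, C x → C y → C (x + y)) : C z := by
  obtain ⟨y, rfl⟩ := RingQuot.mkAlgHom_surjective k (SuperpotentialRel c) z
  induction y using FreeAlgebra.induction with
  | grade0 r => simpa using! hs r
  | grade1 g => exact hg g
  | mul a b ha' hb' => rw [map_mul]; exact hm _ _ ha' hb'
  | add a b ha' hb' => rw [map_add]; exact ha _ _ ha' hb'

lemma sum_letterProd_eq_zero {θ : (Fin N → Fin n) → k} (hθ : θ ∈ relationSpace c) :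
    ∑ j, θ j • letterProd (x c) j = 0 := by
  let f : ((Fin N → Fin n) → k) →ₗ[k] SuperpotentialAlgebra c :=
    ∑ j, (LinearMap.proj j).smulRight (letterProd (x c) j)
  have hf : ∀ θ, f θ = ∑ j, θ j • letterProd (x c) j := fun θ => by simp [f]
  rw [← hf]
  suffices relationSpace c ≤ LinearMap.ker f from this hθ
  rw [relationSpace, Submodule.span_le]
  rintro _ ⟨l, rfl⟩
  have := RingQuot.mkAlgHom_rel k (SuperpotentialRel.rel (c := c) l)
  simpa [map_list_prod, letterProd, List.map_ofFn, Function.comp_def, hf, x] using! this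

/-- A form on words of length `l` as a form on the free algebra. -/
noncomputable def wordForm {l : ℕ} (lam : (Fin l → Fin n) → k) : FreeAlgebra k (Fin n) →ₗ[k] k :=
  (FreeAlgebra.basisFreeMonoid k (Fin n)).constr k fun w : FreeMonoid (Fin n) =>
    if h : w.toList.length = l then lam (fun p => w.toList.get (p.cast h.symm)) else 0

lemma basisFreeMonoid_apply (w : FreeMonoid (Fin n)) :
    FreeAlgebra.basisFreeMonoid k (Fin n) w = FreeMonoid.lift (FreeAlgebra.ι k) w := by
  simp [FreeAlgebra.basisFreeMonoid, FreeAlgebra.equivMonoidAlgebraFreeMonoid]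

lemma letterProd_ι {l : ℕ} (j : Fin l → Fin n) :
    letterProd (FreeAlgebra.ι k) j =
      FreeAlgebra.basisFreeMonoid k (Fin n) (FreeMonoid.ofList (List.ofFn j)) := by
  rw [basisFreeMonoid_apply]
  simp [FreeMonoid.lift_ofList, letterProd, List.map_ofFn, Function.comp_def]

lemma wordForm_basis_ofFn {l : ℕ} (lam : (Fin l → Fin n) → k) (j : Fin l → Fin n) :
    wordForm lam (FreeAlgebra.basisFreeMonoid k (Fin n) (FreeMonoid.ofList (List.ofFn j)))
      = lam j := by
  rw [wordForm, Module.Basis.constr_basis]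
  simp
  rfl

lemma wordForm_basis_of_ne {l : ℕ} (lam : (Fin l → Fin n) → k) (w : FreeMonoid (Fin n))
    (h : w.toList.length ≠ l) :
    wordForm lam (FreeAlgebra.basisFreeMonoid k (Fin n) w) = 0 := by
  rw [wordForm, Module.Basis.constr_basis]
  simp [h]

/-- A relation multiplied by words on both sides lives in length at least `N`, with equality only if
both words are empty. So for `l ≤ N` the sole obstruction is the value on the defining relations,
and that only if `l = N`. The case `l = N` excludes further relations of degree `N`; the case `l =
1` makes the generators independent. -/
lemma exists_form {l : ℕ} (hl : l ≤ N) (lam : (Fin l → Fin n) → k)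
    (hlam : ∀ h : N = l, ∀ θ ∈ relationSpace c,
      ∑ j : Fin N → Fin n, θ j * lam (j ∘ Fin.cast h.symm) = 0) :
    ∃ L : SuperpotentialAlgebra c →ₗ[k] k, ∀ j : Fin l → Fin n, L (letterProd (x c) j) = lam j := by
  obtain ⟨L, hL⟩ := exists_form_ringQuot (SuperpotentialRel c) (wordForm lam) (by
    rintro _ _ ⟨i⟩ u v
    rw [mul_zero, zero_mul, map_zero]
    let b := FreeAlgebra.basisFreeMonoid k (Fin n)
    have key : ∀ w w' : FreeMonoid (Fin n), wordForm lam (b w * (∑ j : Fin N → Fin n,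
        c (Fin.append i j) • letterProd (FreeAlgebra.ι k) j) * b w') = 0 := by
      intro w w'
      have e : ∀ j : Fin N → Fin n, b w * letterProd (FreeAlgebra.ι k) j * b w' =
          b (w * FreeMonoid.ofList (List.ofFn j) * w') := fun j => by
        simp only [b, letterProd_ι, basisFreeMonoid_apply, map_mul]
      simp only [Finset.mul_sum, Finset.sum_mul, mul_smul_comm, smul_mul_assoc, e, map_sum,
        map_smul, smul_eq_mul]
      by_cases h : N = l ∧ w = 1 ∧ w' = 1
      · obtain ⟨rfl, rfl, rfl⟩ := h
        have := hlam rfl _ (Submodule.subset_span ⟨i, rfl⟩)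
        simpa [b, wordForm_basis_ofFn] using this
      · refine Finset.sum_eq_zero fun j _ => ?_
        rw [wordForm_basis_of_ne, mul_zero]
        intro hlen
        simp only [FreeMonoid.toList_mul, FreeMonoid.toList_ofList, List.length_append,
          List.length_ofFn] at hlen
        refine h ⟨by omega, ?_, ?_⟩
        · exact FreeMonoid.toList.injective (List.length_eq_zero_iff.1 (by omega))
        · exact FreeMonoid.toList.injective (List.length_eq_zero_iff.1 (by omega))
    -- From words to arbitrary `u` and `v`, one side at a time, by linearity.
    have key2 : ∀ w, (wordForm lam ∘ₗ LinearMap.mulLeft k (b w * ∑ j : Fin N → Fin n,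
        c (Fin.append i j) • letterProd (FreeAlgebra.ι k) j)) = 0 := fun w =>
      b.ext fun w' => by simpa only [LinearMap.comp_apply, LinearMap.mulLeft_apply, LinearMap.zero_apply] using key w w'
    have key3 : (wordForm lam ∘ₗ LinearMap.mulRight k ((∑ j : Fin N → Fin n,
        c (Fin.append i j) • letterProd (FreeAlgebra.ι k) j) * v)) = 0 :=
      b.ext fun w => by simpa [mul_assoc] using LinearMap.congr_fun (key2 w) v
    simpa [mul_assoc, letterProd] using LinearMap.congr_fun key3 u)
  refine ⟨L, fun j => ?_⟩
  have : letterProd (x c) j =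
      RingQuot.mkAlgHom k (SuperpotentialRel c) (letterProd (FreeAlgebra.ι k) j) :=
    (map_letterProd (RingQuot.mkAlgHom k (SuperpotentialRel c)) (FreeAlgebra.ι k) j).symm
  rw [this]
  erw [hL]
  rw [letterProd_ι, wordForm_basis_ofFn]

/-- There are no relations of degree `N` besides the defining ones. -/
lemma mem_relationSpace_of_sum_eq_zero {θ : (Fin N → Fin n) → k}
    (h : ∑ j, θ j • letterProd (x c) j = 0) : θ ∈ relationSpace c := by
  by_contra hθ
  -- A functional that kills `R` but not `θ` descends to the algebra, where it would detect `θ`.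
  obtain ⟨f, hf, hf'⟩ := Submodule.exists_le_ker_of_notMem hθ
  have hfe : ∀ η : (Fin N → Fin n) → k, f η = ∑ j, η j * f (Pi.single j 1) := fun η => by
    conv_lhs => rw [pi_eq_sum_univ' η]
    simp
  obtain ⟨L, hL⟩ := exists_form c le_rfl (fun j => f (Pi.single j 1)) (fun _ η hη => by
    have : f η = 0 := hf' hη
    simpa [← hfe] using this)
  apply hf
  rw [hfe]
  simpa [hL] using congrArg L h

/-- The coordinates of degree-one elements. -/
lemma exists_coord (hN : 2 ≤ N) (i : Fin n) :
    ∃ L : SuperpotentialAlgebra c →ₗ[k] k, ∀ j, L (x c j) = if j = i then 1 else 0 := by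
  obtain ⟨L, hL⟩ := exists_form c (l := 1) (by omega) (fun j => if j 0 = i then 1 else 0)
    (fun h => by omega)
  refine ⟨L, fun j => ?_⟩
  have := hL fun _ => j
  simpa [letterProd_succ, letterProd_zero] using this

/-- Coefficients of the generators may be compared because degree-one coordinates exist; thus a
coaction determines its matrix. -/
lemma left_injective (hN : 2 ≤ N) {K : Type w} [AddCommGroup K] [Module k K] {a b : Fin n → K}
    (h : ∑ j, a j ⊗ₜ[k] x c j = ∑ j, b j ⊗ₜ[k] x c j) : a = b := by
  funext i
  obtain ⟨L, hL⟩ := exists_coord c hN i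
  simpa [hL] using congrArg ((TensorProduct.rid k K).toLinearMap ∘ₗ L.lTensor K) h

end SuperpotentialAlgebra

end PreregularPair

namespace PreregularPair

/-! ## Twisted cyclic arrays -/

/-- Cyclic rotation of the indices of `c` amounts to an invertible matrix acting on one index. -/
def IsTwistedCyclic {k : Type u} [Field k] {m n : ℕ} (c : (Fin m → Fin n) → k) : Prop :=
  ∃ M M' : Fin n → Fin n → k, ∀ (l : ℕ) (h : m = l + 1) (w : Fin l → Fin n) (b : Fin n),
    c (Fin.snoc (α := fun _ => Fin n) w b ∘ Fin.cast h)
      = ∑ p, M p b * c (Fin.cons (α := fun _ => Fin n) p w ∘ Fin.cast h) ∧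
    c (Fin.cons (α := fun _ => Fin n) b w ∘ Fin.cast h)
      = ∑ p, M' p b * c (Fin.snoc (α := fun _ => Fin n) w p ∘ Fin.cast h)

section preregular
variable {k : Type u} {Z : Type v} [Field k] [AddCommGroup Z] [Module k Z] {m n : ℕ}

lemma PreregularForm.form_cons_sum (t : PreregularForm k Z (m + 1)) (b : Module.Basis (Fin n) k Z)
    (z : Z) (w : Fin m → Fin n) :
    t.form (Fin.cons z fun p => b (w p)) = ∑ p, b.repr z p * t.coeff b (Fin.cons p w) := by
  have h : ∀ y : Z, t.form (Fin.cons y fun p => b (w p)) =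
      t.form.curryLeft y fun p => b (w p) := fun y => rfl
  rw [h]
  conv_lhs => rw [← b.sum_repr z]
  simp only [map_sum, map_smul, sum_apply, smul_apply, smul_eq_mul]
  refine Finset.sum_congr rfl fun p _ => ?_
  rw [← h]
  congr 2
  funext q
  refine Fin.cases ?_ (fun q => ?_) q <;> simp

lemma PreregularForm.form_snoc (t : PreregularForm k Z (m + 1)) {φ : Z ≃ₗ[k] Z}
    (hφ : ∀ z : Fin (m + 1) → Z, t.form z = t.form fun i =>
      if i.val = 0 then φ (z ((finRotate (m + 1)).symm i)) else z ((finRotate (m + 1)).symm i))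
    (z : Fin m → Z) (y : Z) : t.form (Fin.snoc z y) = t.form (Fin.cons (φ y) z) := by
  rw [hφ]
  congr 1
  funext p
  refine Fin.cases ?_ (fun p => ?_) p
  · have : (finRotate (m + 1)).symm 0 = Fin.last m := by
      rw [Equiv.symm_apply_eq, finRotate_last]
    simp [this]
  · have : (finRotate (m + 1)).symm p.succ = p.castSucc := by
      rw [Equiv.symm_apply_eq]; simp
    simp [this]

lemma PreregularForm.coeff_snoc (t : PreregularForm k Z (m + 1)) (b : Module.Basis (Fin n) k Z)
    (w : Fin m → Fin n) (p : Fin n) :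
    t.coeff b (Fin.snoc w p) = t.form (Fin.snoc (fun q => b (w q)) (b p)) := by
  rw [PreregularForm.coeff]
  congr 1
  funext q
  refine Fin.lastCases ?_ (fun q => ?_) q <;> simp

/-- The two matrices are those of `φ` and of its inverse; the inverse serves to rotate in the other
direction. -/
lemma PreregularForm.isTwistedCyclic (t : PreregularForm k Z m) (b : Module.Basis (Fin n) k Z) :
    IsTwistedCyclic (t.coeff b) := by
  obtain ⟨φ, hφ⟩ := t.cyclic
  refine ⟨fun p q => b.repr (φ (b q)) p, fun p q => b.repr (φ.symm (b q)) p, ?_⟩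
  rintro l rfl w q
  simp only [Fin.cast_refl, Function.comp_id]
  constructor
  · rw [t.coeff_snoc, t.form_snoc hφ, t.form_cons_sum]
  · have h1 : t.coeff b (Fin.cons q w) =
        t.form (Fin.snoc (fun q => b (w q)) (φ.symm (b q))) := by
      rw [t.form_snoc hφ, φ.apply_symm_apply, PreregularForm.coeff]
      congr 1
      funext p
      refine Fin.cases ?_ (fun p => ?_) p <;> simp
    have h2 : ∀ z : Z, t.form (Fin.snoc (fun q => b (w q)) z) =
        t.form.curryRight (fun q => b (w q)) z := fun z => rfl
    rw [h1, h2]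
    conv_lhs => rw [← b.sum_repr (φ.symm (b q))]
    rw [map_sum]
    refine Finset.sum_congr rfl fun p _ => ?_
    rw [map_smul, ← h2, t.coeff_snoc, smul_eq_mul]

/-- The zero form is degenerate at any basis vector. A nonzero coefficient is what later isolates
the multipliers. -/
lemma PreregularForm.coeff_ne_zero (t : PreregularForm k Z m) (b : Module.Basis (Fin n) k Z)
    (hn : 0 < n) : t.coeff b ≠ 0 := by
  intro h
  have h0 : t.form = 0 :=
    Module.Basis.ext_multilinear (fun _ => b) fun w => congrFun h w
  refine b.ne_zero ⟨0, hn⟩ (t.nondegenerate _ fun z i hi hz => by simp [h0])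

end preregular

/-! ## Slices of arrays -/

section slice
variable {k : Type u} [Field k] {n : ℕ}

/-- The slice of an array along `N` consecutive positions. -/
def slice {s N t l : ℕ} (h : s + N + t = l) (c : (Fin l → Fin n) → k) (a : Fin s → Fin n)
    (b : Fin t → Fin n) (j : Fin N → Fin n) : k :=
  c (Fin.append (Fin.append a j) b ∘ Fin.cast h.symm)

lemma mem_koszulSpace {r N : ℕ} {c : (Fin (r + N) → Fin n) → k} {l : ℕ}
    {w : (Fin l → Fin n) → k} :
    w ∈ SuperpotentialAlgebra.koszulSpace c l ↔ ∀ (s t : ℕ) (h : s + N + t = l)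
      (a : Fin s → Fin n) (b : Fin t → Fin n),
      slice h w a b ∈ SuperpotentialAlgebra.relationSpace c := by
  simp only [SuperpotentialAlgebra.koszulSpace, Submodule.mem_iInf, Submodule.mem_comap]
  rfl

/-- One rotation carries the last letter behind the window to the front, so slices with `t + 1`
letters behind the window are combinations of slices with `t`. -/
lemma slice_snoc_mem {s N t m : ℕ} {c : (Fin m → Fin n) → k} {M : Fin n → Fin n → k}
    (hM : ∀ (l : ℕ) (h : m = l + 1) (w : Fin l → Fin n) (b : Fin n),
      c (Fin.snoc (α := fun _ => Fin n) w b ∘ Fin.cast h)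
        = ∑ p, M p b * c (Fin.cons (α := fun _ => Fin n) p w ∘ Fin.cast h))
    (h : s + N + (t + 1) = m) (h' : s + 1 + N + t = m) (a : Fin s → Fin n)
    (b : Fin t → Fin n) (q : Fin n) :
    slice h c a (Fin.snoc b q) = ∑ p, M p q • slice h' c (Fin.cons p a) b := by
  subst h
  funext j
  simp only [slice, Finset.sum_apply, Pi.smul_apply, smul_eq_mul, Fin.append_snoc]
  have := hM _ rfl (Fin.append (Fin.append a j) b) q
  simp only [Fin.cast_refl, Function.comp_id] at this
  erw [this]
  refine Finset.sum_congr rfl fun p _ => ?_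
  congr 2
  rw [Fin.append_cons]
  funext i
  -- The lengths `s + 1 + N` and `s + N + 1` agree only up to a cast, which has to be moved out of
  -- the left factor.
  have e : ∀ {l l' : ℕ} (h : l = l') (x : Fin l' → Fin n) (i : Fin (l + t)),
    Fin.append (x ∘ Fin.cast h) b i = Fin.append x b (Fin.cast (by omega) i) := by
    rintro l _ rfl x i; rfl
  simp only [Function.comp_apply]
  erw [e (Nat.add_right_comm s 1 N)]
  rw [Fin.append_cons]
  rfl

lemma slice_cons_mem {s N t m : ℕ} {c : (Fin m → Fin n) → k} {M : Fin n → Fin n → k}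
    (hM : ∀ (l : ℕ) (h : m = l + 1) (w : Fin l → Fin n) (b : Fin n),
      c (Fin.cons (α := fun _ => Fin n) b w ∘ Fin.cast h)
        = ∑ p, M p b * c (Fin.snoc (α := fun _ => Fin n) w p ∘ Fin.cast h))
    (h : s + 1 + N + t = m) (h' : s + N + (t + 1) = m) (a : Fin s → Fin n)
    (b : Fin t → Fin n) (q : Fin n) :
    slice h c (Fin.cons q a) b = ∑ p, M p q • slice h' c a (Fin.snoc b p) := by
  subst h'
  funext j
  simp only [slice, Finset.sum_apply, Pi.smul_apply, smul_eq_mul, Fin.append_snoc]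
  have := hM _ rfl (Fin.append (Fin.append a j) b) q
  simp only [Fin.cast_refl, Function.comp_id] at this
  refine Eq.trans ?_ this
  congr 1
  rw [Fin.append_cons]
  funext i
  have e : ∀ {l l' : ℕ} (h : l = l') (x : Fin l' → Fin n) (i : Fin (l + t)),
    Fin.append (x ∘ Fin.cast h) b i = Fin.append x b (Fin.cast (by omega) i) := by
    rintro l _ rfl x i; rfl
  simp only [Function.comp_apply]
  erw [e (Nat.add_right_comm s 1 N)]
  rw [Fin.append_cons]
  rfl

open SuperpotentialAlgebra

variable {r N : ℕ} {c : (Fin (r + N) → Fin n) → k}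

/-- Rotating away the letters behind the window ends at `t = 0`, where the slices are the defining
generators of `R`. -/
lemma IsTwistedCyclic.slice_mem (hc : IsTwistedCyclic c) (t s : ℕ) (h : s + N + t = r + N)
    (a : Fin s → Fin n) (b : Fin t → Fin n) : slice h c a b ∈ relationSpace c := by
  obtain ⟨M, _, hM⟩ := hc
  induction t generalizing s with
  | zero =>
    obtain rfl : s = r := by omega
    refine Submodule.subset_span ⟨a, ?_⟩
    funext j
    simp only [slice, Fin.append_right_nil _ b rfl]
    rfl
  | succ t ih =>
    rw [← Fin.snoc_init_self b, slice_snoc_mem (fun l h w b => (hM l h w b).1) h (by omega)]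
    exact Submodule.sum_mem _ fun p _ => Submodule.smul_mem _ _ (ih _ _ _ _)

lemma IsTwistedCyclic.mem_koszulSpace (hc : IsTwistedCyclic c) : c ∈ koszulSpace c (r + N) :=
  PreregularPair.mem_koszulSpace.2 fun s t h a b => hc.slice_mem t s h a b

/-- The relations may also be read off at the front of the words. -/
lemma IsTwistedCyclic.slice_mem_front (hc : IsTwistedCyclic c) (s t : ℕ) (h : s + N + t = r + N)
    (a : Fin s → Fin n) (b : Fin t → Fin n) : slice h c a b ∈ Submodule.span k
      (Set.range fun (l : Fin r → Fin n) (j : Fin N → Fin n) =>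
        c (Fin.append j l ∘ Fin.cast (Nat.add_comm r N))) := by
  obtain ⟨_, M, hM⟩ := hc
  induction s generalizing t with
  | zero =>
    obtain rfl : t = r := by omega
    refine Submodule.subset_span ⟨b, ?_⟩
    funext j
    simp only [slice, Fin.append_left_nil a _ rfl]
    congr 1
    have e : ∀ {l l' : ℕ} (h : l = l') (x : Fin l' → Fin n) (i : Fin (l + t)),
      Fin.append (x ∘ Fin.cast h) b i = Fin.append x b (Fin.cast (by omega) i) := by
      rintro l _ rfl x i; rfl
    funext i
    simp only [Function.comp_apply, e]
    rfl
  | succ s ih =>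
    rw [← Fin.cons_self_tail a, slice_cons_mem (fun l h w b => (hM l h w b).2) h (by omega)]
    exact Submodule.sum_mem _ fun p _ => Submodule.smul_mem _ _ (ih _ _ _ _)

end slice

/-! ## Matrix coactions -/

section matrix
open SuperpotentialAlgebra
variable {k : Type u} [Field k] {r N n : ℕ} {c : (Fin (r + N) → Fin n) → k}
  {K : Type w} [Ring K] [Algebra k K]

lemma sum_smul_letterProd_left {l : ℕ} (a : Fin n → Fin n → K)
    (θ : (Fin l → Fin n) → k) :
    ∑ i, θ i • letterProd (fun i => ∑ j, a i j ⊗ₜ[k] x c j) i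
      = ∑ j, (∑ i, θ i • wordProd a i j) ⊗ₜ[k] letterProd (x c) j := by
  simp only [letterProd_left_matrix, Finset.smul_sum, TensorProduct.sum_tmul,
    TensorProduct.smul_tmul']
  exact Finset.sum_comm

/-- The coefficient spaces of a matrix coaction preserve the relations. -/
lemma relationSpace_stable (a : Fin n → Fin n → K)
    (ρ : SuperpotentialAlgebra c →ₐ[k] K ⊗[k] SuperpotentialAlgebra c)
    (hρ : ∀ i, ρ (x c i) = ∑ j, a i j ⊗ₜ[k] x c j) (ξ : K →ₗ[k] k) (g g' : K)
    {θ : (Fin N → Fin n) → k} (hθ : θ ∈ relationSpace c) :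
    (fun j => ξ (g * (∑ i, θ i • wordProd a i j) * g')) ∈ relationSpace c := by
  apply mem_relationSpace_of_sum_eq_zero
  -- The image of a relation vanishes in `K ⊗ A`. Contracting `K` with `ξ (g * · * g')` leaves a
  -- combination of words of length `N` that is zero in `A`, hence a relation. The factors `g`, `g'`
  -- make room for the letters outside a window.
  have h0 := congrArg ρ (sum_letterProd_eq_zero c hθ)
  simp only [map_sum, map_smul, map_zero, map_letterProd, hρ] at h0
  rw [sum_smul_letterProd_left] at h0
  let f : K →ₗ[k] k := ξ ∘ₗ LinearMap.mulRight k g' ∘ₗ LinearMap.mulLeft k g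
  have := congrArg ((TensorProduct.lid k (SuperpotentialAlgebra c)).toLinearMap ∘ₗ
    f.rTensor (SuperpotentialAlgebra c)) h0
  simpa [f, Finset.mul_sum, Finset.sum_mul] using this

/-- The coefficient spaces of a matrix coaction preserve the spaces of the Koszul complex. -/
lemma koszulSpace_stable (a : Fin n → Fin n → K)
    (ρ : SuperpotentialAlgebra c →ₐ[k] K ⊗[k] SuperpotentialAlgebra c)
    (hρ : ∀ i, ρ (x c i) = ∑ j, a i j ⊗ₜ[k] x c j) (ξ : K →ₗ[k] k) {l : ℕ}
    {w : (Fin l → Fin n) → k} (hw : w ∈ koszulSpace c l) :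
    (fun j => ξ (∑ i, w i • wordProd a i j)) ∈ koszulSpace c l := by
  rw [mem_koszulSpace] at hw ⊢
  rintro s t rfl α β
  -- The letters outside the window contribute the outer factors `g` and `g'` of
  -- `relationSpace_stable`.
  have : slice rfl (fun j => ξ (∑ i, w i • wordProd a i j)) α β =
      ∑ α' : Fin s → Fin n, ∑ β' : Fin t → Fin n, fun j => ξ (wordProd a α' α *
        (∑ i, slice rfl w α' β' i • wordProd a i j) * wordProd a β' β) := by
    funext j
    simp only [slice, Fin.cast_refl, Function.comp_id, Finset.sum_apply, ← map_sum]
    congr 1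
    simp only [sum_word_append, wordProd_append]
    refine Finset.sum_congr rfl fun α' _ => ?_
    rw [Finset.sum_comm]
    refine Finset.sum_congr rfl fun β' _ => ?_
    simp [Finset.mul_sum, Finset.sum_mul]
  rw [this]
  exact Submodule.sum_mem _ fun α' _ => Submodule.sum_mem _ fun β' _ =>
    relationSpace_stable a ρ hρ ξ _ _ (hw s t rfl α' β')

/-- A one-dimensional coefficient-stable space of words gives a multiplier. -/
lemma exists_multiplier (a : Fin n → Fin n → K)
    (ρ : SuperpotentialAlgebra c →ₐ[k] K ⊗[k] SuperpotentialAlgebra c)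
    (hρ : ∀ i, ρ (x c i) = ∑ j, a i j ⊗ₜ[k] x c j) {l : ℕ}
    {w : (Fin l → Fin n) → k} (hw : w ∈ koszulSpace c l) (hw0 : w ≠ 0)
    (h1 : ∀ w' ∈ koszulSpace c l, ∃ t : k, w' = t • w) :
    ∃ D : K, ∀ j, ∑ i, w i • wordProd a i j = w j • D := by
  obtain ⟨j₀, hj₀⟩ := Function.ne_iff.1 hw0
  -- `D` is read off at a coordinate where `w` does not vanish. Under each functional `ξ` the
  -- transformed array becomes a scalar multiple of `w`, so every coordinate gives the same answer,
  -- and functionals separate the points of `K`.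
  refine ⟨(w j₀)⁻¹ • ∑ i, w i • wordProd a i j₀, fun j => ?_⟩
  rw [← sub_eq_zero, ← Module.forall_dual_apply_eq_zero_iff k]
  intro ξ
  obtain ⟨t, ht⟩ := h1 _ (koszulSpace_stable a ρ hρ ξ hw)
  have e := congrFun ht j
  have e₀ := congrFun ht j₀
  simp only [Pi.smul_apply, smul_eq_mul] at e e₀
  have hj₀' : w j₀ ≠ 0 := hj₀
  rw [map_sub, map_smul, map_smul, e, e₀]
  simp only [smul_eq_mul]
  field_simp
  ring

end matrix

end PreregularPair

namespace PreregularPair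

/-! ## Bar cochains -/

section bar
variable {k : Type*} [Field k] {A : Type*} [Ring A] [Algebra k A]
  {Y : Type*} [AddCommGroup Y] [Module k Y]
  {Y' : Type*} [AddCommGroup Y'] [Module k Y']
  {M : Type*} [AddCommGroup M] [Module k M]

variable (k A Y M) in
/-- Multilinear maps `A^i × Y → M`: the `i`-cochains that compute `Ext^i_A(Y, M)` for an
`A`-module `M` on which `A` acts through an augmentation. -/
abbrev BarCochain (i : ℕ) : Type _ := MultilinearMap k (fun _ : Fin i => A) (Y →ₗ[k] M)

namespace BarCochain

lemma ext_zero {φ ψ : BarCochain k A Y M 0} (h : ∀ y, φ Fin.elim0 y = ψ Fin.elim0 y) : φ = ψ := by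
  ext a y
  rw [Subsingleton.elim a Fin.elim0, h]

/-- The operators below are described by what they do once the first argument is fixed, so
identities between them are checked in that form. -/
lemma ext_succ {i : ℕ} {φ ψ : BarCochain k A Y M (i + 1)}
    (h : ∀ a, φ.curryLeft a = ψ.curryLeft a) : φ = ψ := by
  ext a y
  have := congrArg (fun f => f (Fin.tail a) y) (h (a 0))
  simpa [Fin.cons_self_tail] using this

section curry
variable {i : ℕ} (φ ψ : BarCochain k A Y M (i + 1)) (a : A)

lemma curryLeft_add : (φ + ψ).curryLeft a = φ.curryLeft a + ψ.curryLeft a := rfl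
lemma curryLeft_sub : (φ - ψ).curryLeft a = φ.curryLeft a - ψ.curryLeft a := by
  ext; simp
lemma curryLeft_neg : (-φ).curryLeft a = -φ.curryLeft a := by
  ext; simp
lemma curryLeft_smul (t : k) : (t • φ).curryLeft a = t • φ.curryLeft a := rfl
lemma curryLeft_zero : (0 : BarCochain k A Y M (i + 1)).curryLeft a = 0 := rfl

end curry

/-- Apply a linear map to all cochains `φ(a, -)`. -/
noncomputable def shift {i j : ℕ} (F : BarCochain k A Y M i →ₗ[k] BarCochain k A Y' M j) :
    BarCochain k A Y M (i + 1) →ₗ[k] BarCochain k A Y' M (j + 1) where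
  toFun φ := (F ∘ₗ φ.curryLeft).uncurryLeft
  map_add' φ ψ := ext_succ fun a => by simp [curryLeft_add]
  map_smul' t φ := ext_succ fun a => by simp [curryLeft_smul]

lemma curryLeft_shift {i j : ℕ} (F : BarCochain k A Y M i →ₗ[k] BarCochain k A Y' M j)
    (φ : BarCochain k A Y M (i + 1)) (a : A) :
    (shift F φ).curryLeft a = F (φ.curryLeft a) := by
  simp [shift]

variable (A) in
/-- Precomposition with a linear map in the last variable. -/
noncomputable def pull (g : Y' →ₗ[k] Y) {i : ℕ} :
    BarCochain k A Y M i →ₗ[k] BarCochain k A Y' M i where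
  toFun φ := (LinearMap.lcomp k M g).compMultilinearMap φ
  map_add' φ ψ := by ext; simp
  map_smul' t φ := by ext; simp

@[simp] lemma pull_apply (g : Y' →ₗ[k] Y) {i : ℕ} (φ : BarCochain k A Y M i) (a) (y : Y') :
    pull A g φ a y = φ a (g y) := rfl

lemma curryLeft_pull (g : Y' →ₗ[k] Y) {i : ℕ} (φ : BarCochain k A Y M (i + 1)) (a : A) :
    (pull A g φ).curryLeft a = pull A g (φ.curryLeft a) := rfl

/-- `ε(a₀) φ(a₁, …)`. -/
noncomputable def augFirst (ε : A →ₐ[k] k) {i : ℕ} :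
    BarCochain k A Y M i →ₗ[k] BarCochain k A Y M (i + 1) where
  toFun φ := (ε.toLinearMap.smulRight φ).uncurryLeft
  map_add' φ ψ := ext_succ fun a => by simp [curryLeft_add]
  map_smul' t φ := ext_succ fun a => by
    simp only [LinearMap.curry_uncurryLeft, curryLeft_smul, LinearMap.smulRight_apply,
      RingHom.id_apply]
    exact smul_comm _ _ _

lemma curryLeft_augFirst (ε : A →ₐ[k] k) {i : ℕ} (φ : BarCochain k A Y M i) (a : A) :
    (augFirst ε φ).curryLeft a = ε a • φ := by
  simp [augFirst]

lemma pull_augFirst (ε : A →ₐ[k] k) (g : Y' →ₗ[k] Y) {i : ℕ} (φ : BarCochain k A Y M i) :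
    pull A g (augFirst ε φ) = augFirst ε (pull A g φ) := rfl

variable [Module A Y] [IsScalarTower k A Y] [Module A Y'] [IsScalarTower k A Y']

/-- Left multiplication by `a` on the first variable. -/
noncomputable def mulFirst (a : A) : {i : ℕ} → BarCochain k A Y M i →ₗ[k] BarCochain k A Y M i
  | 0 => pull A (Algebra.lsmul k k Y a)
  | i + 1 =>
    { toFun := fun φ => (φ.curryLeft ∘ₗ LinearMap.mulLeft k a).uncurryLeft
      map_add' := fun φ ψ => ext_succ fun b => by simp [curryLeft_add]
      map_smul' := fun t φ => ext_succ fun b => by simp [curryLeft_smul] }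

@[simp]
lemma mulFirst_zero (a : A) (φ : BarCochain k A Y M 0) (y : Y) :
    mulFirst a φ Fin.elim0 y = φ Fin.elim0 (a • y) := rfl

lemma curryLeft_mulFirst (a : A) {i : ℕ} (φ : BarCochain k A Y M (i + 1)) (b : A) :
    (mulFirst a φ).curryLeft b = φ.curryLeft (a * b) := by
  simp [mulFirst]

lemma mulFirst_mulFirst (a b : A) {i : ℕ} (φ : BarCochain k A Y M i) :
    mulFirst b (mulFirst a φ) = mulFirst (a * b) φ := by
  cases i with
  | zero => exact ext_zero fun y => by simp [mul_smul]
  | succ i => exact ext_succ fun x => by simp [curryLeft_mulFirst, mul_assoc]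

/-- `φ(a₀ a₁, a₂, …)`. -/
noncomputable def mulFirstₗ {i : ℕ} : BarCochain k A Y M i →ₗ[k] BarCochain k A Y M (i + 1) where
  toFun φ := LinearMap.uncurryLeft
    { toFun := fun a => mulFirst a φ
      map_add' := fun a b => by
        cases i with
        | zero => exact ext_zero fun y => by simp [add_smul]
        | succ i =>
          exact ext_succ fun x => by simp [curryLeft_mulFirst, curryLeft_add, add_mul]
      map_smul' := fun t a => by
        cases i with
        | zero => exact ext_zero fun y => by simp
        | succ i =>
          exact ext_succ fun x => by simp [curryLeft_mulFirst, curryLeft_smul] }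
  map_add' φ ψ := ext_succ fun a => by simp [curryLeft_add]
  map_smul' t φ := ext_succ fun a => by simp [curryLeft_smul]

lemma curryLeft_mulFirstₗ {i : ℕ} (φ : BarCochain k A Y M i) (a : A) :
    (mulFirstₗ φ).curryLeft a = mulFirst a φ := by
  simp [mulFirstₗ]

/-- The bar differential without its first term. -/
noncomputable def sigma : (i : ℕ) → BarCochain k A Y M i →ₗ[k] BarCochain k A Y M (i + 1)
  | 0 => -mulFirstₗ
  | i + 1 => -mulFirstₗ - shift (sigma i)

lemma curryLeft_sigma_zero (φ : BarCochain k A Y M 0) (a : A) :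
    (sigma 0 φ).curryLeft a = -mulFirst a φ := by
  rw [sigma, LinearMap.neg_apply, curryLeft_neg, curryLeft_mulFirstₗ]

lemma curryLeft_sigma_succ {i : ℕ} (φ : BarCochain k A Y M (i + 1)) (a : A) :
    (sigma (i + 1) φ).curryLeft a = -mulFirst a φ - sigma i (φ.curryLeft a) := by
  rw [sigma, LinearMap.sub_apply, LinearMap.neg_apply, curryLeft_sub, curryLeft_neg,
    curryLeft_mulFirstₗ, curryLeft_shift]

lemma mulFirst_augFirst (ε : A →ₐ[k] k) {i : ℕ} (φ : BarCochain k A Y M i) (a : A) :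
    mulFirst a (augFirst ε φ) = ε a • augFirst ε φ :=
  ext_succ fun b => by
    simp [curryLeft_mulFirst, curryLeft_augFirst, curryLeft_smul, mul_smul]

/-- Each term of `sigma` keeps the first argument or multiplies it on the right, so left
multiplication passes through by associativity. -/
lemma mulFirst_sigma {i : ℕ} (φ : BarCochain k A Y M i) (a : A) :
    mulFirst a (sigma i φ) = sigma i (mulFirst a φ) := by
  refine ext_succ fun b => ?_
  rw [curryLeft_mulFirst]
  cases i with
  | zero => rw [curryLeft_sigma_zero, curryLeft_sigma_zero, mulFirst_mulFirst]
  | succ i =>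
    rw [curryLeft_sigma_succ, curryLeft_sigma_succ, mulFirst_mulFirst, curryLeft_mulFirst]

/-- With the first argument `a` fixed, two copies of `sigma i (mulFirst a φ)` cancel, and what
remains is the same identity one degree lower. -/
lemma sigma_sigma {i : ℕ} (φ : BarCochain k A Y M i) : sigma (i + 1) (sigma i φ) = 0 := by
  induction i with
  | zero =>
    refine ext_succ fun a => ?_
    rw [curryLeft_sigma_succ, curryLeft_sigma_zero, mulFirst_sigma, map_neg, curryLeft_zero]
    abel
  | succ i ih =>
    refine ext_succ fun a => ?_
    rw [curryLeft_sigma_succ, curryLeft_sigma_succ, mulFirst_sigma, map_sub, map_neg, ih,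
      curryLeft_zero]
    abel

/-- The bar differential. -/
noncomputable def delta (ε : A →ₐ[k] k) (i : ℕ) :
    BarCochain k A Y M i →ₗ[k] BarCochain k A Y M (i + 1) := augFirst ε + sigma i

lemma delta_delta (ε : A →ₐ[k] k) {i : ℕ} (φ : BarCochain k A Y M i) :
    delta ε (i + 1) (delta ε i φ) = 0 := by
  simp only [delta, LinearMap.add_apply, map_add, sigma_sigma, add_zero]
  refine ext_succ fun a => ?_
  simp only [curryLeft_add, curryLeft_augFirst, curryLeft_sigma_succ, mulFirst_augFirst, map_smul,
    curryLeft_zero]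
  abel

lemma mulFirst_pull (g : Y' →ₗ[A] Y) {i : ℕ} (φ : BarCochain k A Y M i) (a : A) :
    mulFirst a (pull A (g.restrictScalars k) φ) = pull A (g.restrictScalars k) (mulFirst a φ) := by
  cases i with
  | zero => exact ext_zero fun y => by simp
  | succ i => exact ext_succ fun b => by simp [curryLeft_mulFirst, curryLeft_pull]

lemma sigma_pull (g : Y' →ₗ[A] Y) {i : ℕ} (φ : BarCochain k A Y M i) :
    sigma i (pull A (g.restrictScalars k) φ) = pull A (g.restrictScalars k) (sigma i φ) := by
  induction i with
  | zero =>
    exact ext_succ fun a => by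
      simp only [curryLeft_sigma_zero, curryLeft_pull, mulFirst_pull, map_neg]
  | succ i ih =>
    exact ext_succ fun a => by
      simp only [curryLeft_sigma_succ, curryLeft_pull, mulFirst_pull, map_neg, map_sub, ih]

lemma delta_pull (ε : A →ₐ[k] k) (g : Y' →ₗ[A] Y) {i : ℕ} (φ : BarCochain k A Y M i) :
    delta ε i (pull A (g.restrictScalars k) φ) = pull A (g.restrictScalars k) (delta ε i φ) := by
  simp only [delta, LinearMap.add_apply, map_add, sigma_pull, pull_augFirst]

section homotopy
variable {ι : Type*} [Fintype ι] (coord : ι → Y →ₗ[A] A) (e : ι → Y)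

/-- The contraction of the bar complex of a module with a dual basis. -/
noncomputable def contract : (i : ℕ) → BarCochain k A Y M (i + 1) →ₗ[k] BarCochain k A Y M i
  | 0 =>
    { toFun := fun φ => MultilinearMap.constOfIsEmpty k _
        { toFun := fun y => -∑ b, φ.curryLeft (coord b y) Fin.elim0 (e b)
          map_add' := fun y y' => by simp [Finset.sum_add_distrib, -MultilinearMap.curryLeft_apply]; abel
          map_smul' := fun t y => by
            have h : ∀ b, coord b (t • y) = t • coord b y := fun b =>
              LinearMap.map_smul_of_tower _ _ _
            simp [h, Finset.smul_sum, -MultilinearMap.curryLeft_apply] }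
      map_add' := fun φ ψ => ext_zero fun y => by
        simp [Finset.sum_add_distrib]; abel
      map_smul' := fun t φ => ext_zero fun y => by
        simp [Finset.smul_sum] }
  | i + 1 => -shift (contract i)

lemma contract_zero_apply (φ : BarCochain k A Y M 1) (y : Y) :
    contract coord e 0 φ Fin.elim0 y = -∑ b, φ.curryLeft (coord b y) Fin.elim0 (e b) := rfl

lemma curryLeft_contract_succ {i : ℕ} (φ : BarCochain k A Y M (i + 2)) (a : A) :
    (contract coord e (i + 1) φ).curryLeft a = -contract coord e i (φ.curryLeft a) := by
  rw [contract, LinearMap.neg_apply, curryLeft_neg, curryLeft_shift]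

lemma contract_mulFirst {i : ℕ} (φ : BarCochain k A Y M (i + 2)) (a : A) :
    contract coord e (i + 1) (mulFirst a φ) = mulFirst a (contract coord e (i + 1) φ) :=
  ext_succ fun b => by
    rw [curryLeft_mulFirst, curryLeft_contract_succ, curryLeft_contract_succ, curryLeft_mulFirst]

lemma contract_augFirst (ε : A →ₐ[k] k) {i : ℕ} (φ : BarCochain k A Y M (i + 1)) :
    contract coord e (i + 1) (augFirst ε φ) = -augFirst ε (contract coord e i φ) :=
  ext_succ fun b => by
    rw [curryLeft_contract_succ, curryLeft_augFirst, curryLeft_neg, curryLeft_augFirst, map_smul]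

variable (he : ∀ y, ∑ b, coord b y • e b = y)
include he

/-- The dual basis gives an `A`-linear section `y ↦ ∑ coord b y ⊗ e b` of the action map `A ⊗ Y →
Y`; inserting it in the last variable contracts the complex. Linearity of `coord` cancels the terms
in `a • y`, and `he` returns `φ`. -/
lemma sigma_contract {i : ℕ} (φ : BarCochain k A Y M (i + 1)) :
    sigma i (contract coord e i φ) + contract coord e (i + 1) (sigma (i + 1) φ) = φ := by
  induction i with
  | zero =>
    refine ext_succ fun a => ext_zero fun y => ?_
    rw [curryLeft_add, curryLeft_sigma_zero, curryLeft_contract_succ, curryLeft_sigma_succ]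
    simp only [add_apply, neg_apply, LinearMap.neg_apply, LinearMap.add_apply, mulFirst_zero,
      contract_zero_apply, curryLeft_sub, curryLeft_neg, curryLeft_mulFirst, curryLeft_sigma_zero,
      sub_neg_eq_add, map_smul, smul_eq_mul, Finset.sum_add_distrib, Finset.sum_neg_distrib, neg_neg, neg_add_rev]
    rw [← map_sum, he]
    abel
  | succ i ih =>
    refine ext_succ fun a => ?_
    rw [curryLeft_add, curryLeft_sigma_succ, curryLeft_contract_succ, curryLeft_contract_succ,
      curryLeft_sigma_succ, map_sub, map_neg, map_neg, contract_mulFirst]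
    conv_rhs => rw [← ih (φ.curryLeft a)]
    abel

lemma delta_contract (ε : A →ₐ[k] k) {i : ℕ} (φ : BarCochain k A Y M (i + 1)) :
    delta ε i (contract coord e i φ) + contract coord e (i + 1) (delta ε (i + 1) φ) = φ := by
  conv_rhs => rw [← sigma_contract coord e he φ]
  simp only [delta, LinearMap.add_apply, map_add, contract_augFirst]
  abel

/-- In degree zero the contraction leaves an error that depends on `y` only through its class in `k
⊗_A Y`. The error disappears on the image of a minimal differential. -/
lemma contract_delta_zero (ε : A →ₐ[k] k) (φ : BarCochain k A Y M 0) (y : Y) :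
    contract coord e 0 (delta ε 0 φ) Fin.elim0 y =
      φ Fin.elim0 y - ∑ b, ε (coord b y) • φ Fin.elim0 (e b) := by
  simp only [contract_zero_apply, delta, LinearMap.add_apply, curryLeft_add, curryLeft_augFirst,
    curryLeft_sigma_zero, add_apply, smul_apply, neg_apply, LinearMap.smul_apply, LinearMap.neg_apply,
    mulFirst_zero, Finset.sum_add_distrib, Finset.sum_neg_distrib]
  rw [← map_sum, he]
  abel

end homotopy

end BarCochain
end bar
end PreregularPair

namespace PreregularPair

/-! ## Minimal resolutions and bar cochains -/

/-- A complex of finitely generated projective `A`-modules, given with dual bases, that is exact in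
positive degrees and minimal with respect to an augmentation `ε`. -/
structure MinimalComplex {k : Type*} [Field k] {A : Type*} [Ring A] [Algebra k A] (ε : A →ₐ[k] k)
    (P : ℕ → Type*) [∀ j, AddCommGroup (P j)] [∀ j, Module k (P j)] [∀ j, Module A (P j)]
    [∀ j, IsScalarTower k A (P j)] where
  d : ∀ j, P (j + 1) →ₗ[A] P j
  ι : ℕ → Type
  fintype : ∀ j, Fintype (ι j)
  coord : ∀ j, ι j → P j →ₗ[A] A
  gen : ∀ j, ι j → P j
  sum_coord : ∀ j p, ∑ b, coord j b p • gen j b = p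
  d_d : ∀ j p, d j (d (j + 1) p) = 0
  exact : ∀ j p, d j p = 0 → ∃ q, d (j + 1) q = p
  minimal : ∀ j b p, ε (coord j b (d j p)) = 0

attribute [instance] MinimalComplex.fintype

namespace MinimalComplex
open BarCochain
variable {k : Type*} [Field k] {A : Type*} [Ring A] [Algebra k A] {ε : A →ₐ[k] k}
    {P : ℕ → Type*} [∀ j, AddCommGroup (P j)] [∀ j, Module k (P j)] [∀ j, Module A (P j)]
    [∀ j, IsScalarTower k A (P j)] (C : MinimalComplex ε P)
    {M : Type*} [AddCommGroup M] [Module k M]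

/-- Precomposition with the differential. -/
noncomputable def res (j : ℕ) {i : ℕ} :
    BarCochain k A (P j) M i →ₗ[k] BarCochain k A (P (j + 1)) M i :=
  pull A ((C.d j).restrictScalars k)

lemma res_apply (j : ℕ) {i : ℕ} (φ : BarCochain k A (P j) M i) (a) (p : P (j + 1)) :
    C.res j φ a p = φ a (C.d j p) := rfl

lemma res_res (j : ℕ) {i : ℕ} (φ : BarCochain k A (P j) M i) : C.res (j + 1) (C.res j φ) = 0 := by
  ext a p
  simp [res_apply, C.d_d]

lemma delta_res (j : ℕ) {i : ℕ} (φ : BarCochain k A (P j) M i) :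
    delta ε i (C.res j φ) = C.res j (delta ε i φ) := delta_pull ε (C.d j) φ

/-- The contracting homotopy of the bar complex of `P j`. -/
noncomputable def homotopy (j i : ℕ) :
    BarCochain k A (P j) M (i + 1) →ₗ[k] BarCochain k A (P j) M i :=
  contract (C.coord j) (C.gen j) i

lemma delta_homotopy (j : ℕ) {i : ℕ} (φ : BarCochain k A (P j) M (i + 1)) :
    delta ε i (C.homotopy j i φ) + C.homotopy j (i + 1) (delta ε (i + 1) φ) = φ :=
  delta_contract _ _ (C.sum_coord j) ε φ

/-- Dimension shifting on cochains. -/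
noncomputable def transfer (j i : ℕ) :
    BarCochain k A (P j) M (i + 1) →ₗ[k] BarCochain k A (P (j + 1)) M i :=
  C.res j ∘ₗ C.homotopy j i

lemma res_transfer (j i : ℕ) (φ : BarCochain k A (P j) M (i + 1)) :
    C.res (j + 1) (C.transfer j i φ) = 0 := C.res_res j _

lemma delta_transfer (j i : ℕ) {φ : BarCochain k A (P j) M (i + 1)}
    (hφ : delta ε (i + 1) φ = 0) : delta ε i (C.transfer j i φ) = C.res j φ := by
  have := C.delta_homotopy j φ
  rw [hφ, map_zero, add_zero] at this
  rw [transfer, LinearMap.comp_apply, delta_res, this]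

lemma transfer_delta_succ (j i : ℕ) {φ : BarCochain k A (P j) M (i + 1)} (hφ : C.res j φ = 0) :
    C.transfer j (i + 1) (delta ε (i + 1) φ) = -delta ε i (C.transfer j i φ) := by
  have := congrArg (C.res j) (C.delta_homotopy j φ)
  rw [hφ, map_add, ← delta_res] at this
  exact (neg_eq_of_add_eq_zero_right this).symm

/-- Here minimality enters: the coordinates of a boundary lie in the augmentation ideal, so the
error term of `contract_delta_zero` vanishes. -/
lemma transfer_delta_zero (j : ℕ) (φ : BarCochain k A (P j) M 0) :
    C.transfer j 0 (delta ε 0 φ) = C.res j φ := by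
  refine ext_zero fun p => ?_
  rw [transfer, LinearMap.comp_apply, res_apply, homotopy,
    contract_delta_zero _ _ (C.sum_coord j) ε, res_apply]
  simp [C.minimal]

/-- Iterated dimension shifting, down to cochains of degree zero. -/
noncomputable def transferAll : (i j l : ℕ) → (h : j + i = l) →
    BarCochain k A (P j) M i →ₗ[k] BarCochain k A (P l) M 0
  | 0, j, _, h => h ▸ LinearMap.id
  | i + 1, j, l, h => transferAll i (j + 1) l (by omega) ∘ₗ C.transfer j i

lemma transferAll_zero (j : ℕ) (φ : BarCochain k A (P j) M 0) :
    C.transferAll 0 j j rfl φ = φ := rfl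

lemma transferAll_succ (i j l : ℕ) (h : j + (i + 1) = l) (φ : BarCochain k A (P j) M (i + 1)) :
    C.transferAll (i + 1) j l h φ = C.transferAll i (j + 1) l (by omega) (C.transfer j i φ) := rfl

/-- Up to sign each shift sends a coboundary to the coboundary of the shifted primitive; the last
shift applies `res` to a primitive that `res` already kills. -/
lemma transferAll_delta (i j l : ℕ) (h : j + (i + 1) = l) {φ : BarCochain k A (P j) M i}
    (hφ : C.res j φ = 0) : C.transferAll (i + 1) j l h (delta ε i φ) = 0 := by
  induction i generalizing j with
  | zero =>
    subst h
    rw [transferAll_succ, transfer_delta_zero, hφ, map_zero]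
  | succ i ih =>
    rw [transferAll_succ, C.transfer_delta_succ j i hφ, map_neg,
      ih (j + 1) (by omega) (C.res_transfer j i φ), neg_zero]

/-- Row exactness. -/
lemma exists_res_eq (j : ℕ) {i : ℕ} {χ : BarCochain k A (P (j + 1)) M i}
    (hχ : C.res (j + 1) χ = 0) : ∃ η : BarCochain k A (P j) M i, C.res j η = χ := by
  let f := (C.d j).restrictScalars k
  -- The `k`-linear map `g` splits the differential over its image; cochains need not be `A`-linear,
  -- so this suffices. The error `g (d p) - p` is a cycle, hence a boundary, and `χ` vanishes on
  -- boundaries.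
  obtain ⟨s, hs⟩ := f.rangeRestrict.exists_rightInverse_of_surjective (LinearMap.range_rangeRestrict f)
  obtain ⟨g, hg⟩ := LinearMap.exists_extend s
  refine ⟨pull A g χ, ?_⟩
  ext a p
  have h1 : g (f p) = s (f.rangeRestrict p) := LinearMap.congr_fun hg (f.rangeRestrict p)
  have h2 : C.d j (g (f p) - p) = 0 := by
    rw [map_sub, h1, sub_eq_zero]
    exact congrArg Subtype.val (LinearMap.congr_fun hs (f.rangeRestrict p))
  obtain ⟨q, hq⟩ := C.exact j _ h2
  have h3 : χ a (C.d (j + 1) q) = 0 := by rw [← res_apply, hχ]; rfl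
  rw [hq, map_sub, sub_eq_zero] at h3
  exact h3

/-- If `res η = φ'`, then the shift of `δ η` differs from `φ'` by a coboundary that `transferAll`
kills. -/
lemma exists_transfer (j i : ℕ) {φ' : BarCochain k A (P (j + 1)) M i}
    (h1 : delta ε i φ' = 0) (h2 : C.res (j + 1) φ' = 0) :
    ∃ φ : BarCochain k A (P j) M (i + 1), delta ε (i + 1) φ = 0 ∧ C.res j φ = 0 ∧
      ∀ l (h : j + 1 + i = l), C.transferAll i (j + 1) l h (C.transfer j i φ - φ') = 0 := by
  obtain ⟨η, rfl⟩ := C.exists_res_eq j h2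
  refine ⟨delta ε i η, delta_delta ε η, by rw [← delta_res, h1], ?_⟩
  rintro l h
  cases i with
  | zero => rw [transfer_delta_zero, sub_self, map_zero]
  | succ i =>
    have e := congrArg (C.res j) (C.delta_homotopy j η)
    rw [map_add, ← delta_res] at e
    have : C.transfer j (i + 1) (delta ε (i + 1) η) - C.res j η =
        -delta ε i (C.transfer j i η) := by
      rw [← e, transfer, transfer, LinearMap.comp_apply, LinearMap.comp_apply]
      abel
    rw [this, map_neg, C.transferAll_delta i (j + 1) l h (C.res_transfer j i η), neg_zero]

/-- Every cocycle of degree zero is reached by iterated dimension shifting. -/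
lemma exists_transferAll_eq (i j l : ℕ) (h : j + i = l) {lam : BarCochain k A (P l) M 0}
    (h1 : delta ε 0 lam = 0) (h2 : C.res l lam = 0) :
    ∃ φ : BarCochain k A (P j) M i, delta ε i φ = 0 ∧ C.res j φ = 0 ∧
      C.transferAll i j l h φ = lam := by
  induction i generalizing j with
  | zero => subst h; exact ⟨lam, h1, h2, rfl⟩
  | succ i ih =>
    obtain ⟨φ', h1', h2', h3'⟩ := ih (j + 1) (by omega)
    obtain ⟨φ, h1'', h2'', h3''⟩ := C.exists_transfer j i h1' h2'
    refine ⟨φ, h1'', h2'', ?_⟩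
    have := h3'' l (by omega)
    rw [map_sub, sub_eq_zero, h3'] at this
    rw [transferAll_succ, this]

/-- A cocycle whose iterated shift vanishes is a coboundary. -/
lemma exists_delta_eq (i j l : ℕ) (h : j + (i + 1) = l) {φ : BarCochain k A (P j) M (i + 1)}
    (h1 : delta ε (i + 1) φ = 0) (h2 : C.res j φ = 0)
    (h3 : C.transferAll (i + 1) j l h φ = 0) :
    ∃ χ : BarCochain k A (P j) M i, C.res j χ = 0 ∧ delta ε i χ = φ := by
  have hψ : delta ε i (C.homotopy j i φ) = φ := by
    simpa [h1] using C.delta_homotopy j φ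
  induction i generalizing j with
  | zero =>
    subst h
    exact ⟨C.homotopy j 0 φ, h3, hψ⟩
  | succ i ih =>
    have e1 : delta ε (i + 1) (C.transfer j (i + 1) φ) = 0 := by
      rw [C.delta_transfer j (i + 1) h1, h2]
    obtain ⟨χ₁, h4, h5⟩ := ih (j + 1) (by omega) e1 (C.res_transfer j _ φ) h3
      (by simpa [e1] using C.delta_homotopy (j + 1) (C.transfer j (i + 1) φ))
    -- The homotopy provides a primitive of `φ`, but its `res` is `δ χ₁` instead of zero. Writing
    -- `χ₁ = res η` and subtracting `δ η` repairs this.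
    obtain ⟨η, rfl⟩ := C.exists_res_eq j h4
    refine ⟨C.homotopy j (i + 1) φ - delta ε i η, ?_, ?_⟩
    · rw [map_sub, ← delta_res, h5]
      exact sub_self _
    · rw [map_sub, hψ, delta_delta, sub_zero]

end MinimalComplex
end PreregularPair

namespace PreregularPair

/-! ## Extension groups and projective resolutions -/

section ext
open CategoryTheory Limits Abelian

variable {k : Type*} [Field k] {C : Type*} [Category C] [Abelian C] [Linear k C] [HasExt C]

-- Splitting off the kernel `K` of `π` leaves a resolution of `K` of the same shape, on which the
-- induction over the degree of `Ext` runs.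
omit [HasExt C] in
lemma exists_syzygy {X P₀ P₁ P₂ : C} (d₁ : P₂ ⟶ P₁) (d₀ : P₁ ⟶ P₀) (π : P₀ ⟶ X) [Epi π]
    (w : d₀ ≫ π = 0) (hπ : (ShortComplex.mk d₀ π w).Exact) (dd : d₁ ≫ d₀ = 0)
    (hd : (ShortComplex.mk d₁ d₀ dd).Exact) :
    ∃ (K : C) (ι : K ⟶ P₀) (wι : ι ≫ π = 0) (π' : P₁ ⟶ K) (w' : d₁ ≫ π' = 0),
      (ShortComplex.mk ι π wι).ShortExact ∧ Epi π' ∧ π' ≫ ι = d₀ ∧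
        (ShortComplex.mk d₁ π' w').Exact := by
  have hπι : kernel.lift π d₀ w ≫ kernel.ι π = d₀ := kernel.lift_ι _ _ _
  have h1 : Epi (kernel.lift π d₀ w) := (ShortComplex.exact_iff_epi_kernel_lift _).1 hπ
  have w' : d₁ ≫ kernel.lift π d₀ w = 0 := by
    rw [← cancel_mono (kernel.ι π), Category.assoc, hπι, dd, zero_comp]
  refine ⟨_, kernel.ι π, kernel.condition π, kernel.lift π d₀ w, w',
    { exact := ShortComplex.exact_kernel π }, h1, hπι, ?_⟩
  let φ : ShortComplex.mk d₁ _ w' ⟶ ShortComplex.mk d₁ d₀ dd :=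
    { τ₁ := 𝟙 _, τ₂ := 𝟙 _, τ₃ := kernel.ι π }
  have : Epi φ.τ₁ := inferInstanceAs (Epi (𝟙 _))
  have : IsIso φ.τ₂ := inferInstanceAs (IsIso (𝟙 _))
  have : Mono φ.τ₃ := inferInstanceAs (Mono (kernel.ι π))
  exact (ShortComplex.exact_iff_of_epi_of_isIso_of_mono φ).2 hd

/-- Cocycles of a projective resolution represent extension classes. -/
lemma exists_ext_of_cocycle (i : ℕ) {X : C} (P : ℕ → C) [∀ j, Projective (P j)]
    (d : ∀ j, P (j + 1) ⟶ P j) (π : P 0 ⟶ X) [Epi π] (w : d 0 ≫ π = 0)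
    (hπ : (ShortComplex.mk (d 0) π w).Exact) (dd : ∀ j, d (j + 1) ≫ d j = 0)
    (hd : ∀ j, (ShortComplex.mk (d (j + 1)) (d j) (dd j)).Exact) (Y : C) :
    ∃ Θ : LinearMap.ker (Linear.leftComp k Y (d (i + 1))) →ₗ[k] Ext X Y (i + 1),
      ∀ lam, Θ lam = 0 → ∃ η : P i ⟶ Y, d i ≫ η = lam.1 := by
  induction i generalizing X P with
  | zero =>
    obtain ⟨K, ι, wι, π', w', hS, _, hπι, hπ'⟩ := exists_syzygy _ _ π w hπ _ (hd 0)
    -- Since `π'` is a cokernel of `d 1`, cocycles of degree one are the same as maps out of the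
    -- syzygy.
    let F : (K ⟶ Y) →ₗ[k] LinearMap.ker (Linear.leftComp k Y (d 1)) :=
      (Linear.leftComp k Y π').codRestrict _ fun f => by
        simp [LinearMap.mem_ker, reassoc_of% w']
    have hF : Function.Bijective F := by
      constructor
      · intro f g hfg
        rw [← cancel_epi π']
        exact congrArg Subtype.val hfg
      · rintro ⟨f, hf⟩
        exact ⟨hπ'.desc f hf, Subtype.ext (hπ'.g_desc f hf)⟩
    let G := LinearEquiv.ofBijective F hF
    refine ⟨Ext.bilinearCompOfLinear k X K Y 1 0 1 rfl hS.extClass ∘ₗ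
      (Ext.linearEquiv₀ (R := k)).symm.toLinearMap ∘ₗ G.symm.toLinearMap, fun lam h => ?_⟩
    -- A map out of the syzygy whose connecting class vanishes extends to `P 0`.
    obtain ⟨x₂, hx₂⟩ := Ext.contravariant_sequence_exact₁ hS Y
      ((Ext.linearEquiv₀ (R := k)).symm (G.symm lam)) rfl h
    obtain ⟨η, rfl⟩ := (Ext.linearEquiv₀ (R := k)).symm.surjective x₂
    refine ⟨η, ?_⟩
    have h1 : ι ≫ η = G.symm lam := by
      apply (Ext.linearEquiv₀ (R := k)).symm.injective
      rw [← hx₂]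
      simp [Ext.linearEquiv₀, Ext.addEquiv₀]
    have h2 : π' ≫ G.symm lam = lam.1 := congrArg Subtype.val (G.apply_symm_apply lam)
    rw [← h2, ← h1, reassoc_of% hπι]
  | succ i ih =>
    obtain ⟨K, ι, wι, π', w', hS, _, hπι, hπ'⟩ := exists_syzygy _ _ π w hπ _ (hd 0)
    obtain ⟨Θ', hΘ'⟩ := ih (fun j => P (j + 1)) (fun j => d (j + 1)) π' w' hπ'
      (fun j => dd (j + 1)) (fun j => hd (j + 1))
    refine ⟨Ext.bilinearCompOfLinear k X K Y 1 (i + 1) (i + 2) (by omega) hS.extClass ∘ₗ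
      Θ', fun lam h => hΘ' lam ?_⟩
    -- In positive degree the connecting map is injective, because `P 0` is projective.
    obtain ⟨x₂, hx₂⟩ := Ext.contravariant_sequence_exact₁ hS Y (Θ' lam) (by omega) h
    rw [← hx₂]
    have : Projective (P 0) := inferInstance
    rw [Ext.eq_zero_of_projective x₂, Ext.comp_zero]

end ext
end PreregularPair

namespace PreregularPair

/-! ### Consequences of regularity for a minimal resolution. -/

section regular
open CategoryTheory Abelian

namespace MinimalComplex
variable {k A : Type u} [Field k] [Ring A] [Algebra k A] {ε : A →ₐ[k] k}
    {P : ℕ → Type u} [∀ j, AddCommGroup (P j)] [∀ j, Module k (P j)] [∀ j, Module A (P j)]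
    [∀ j, IsScalarTower k A (P j)] (C : MinimalComplex ε P)

include C in
lemma module_projective (j : ℕ) : Module.Projective A (P j) := by
  rw [Module.projective_def']
  refine ⟨∑ b, (Finsupp.lsingle (C.gen j b)) ∘ₗ C.coord j b, ?_⟩
  ext p
  simp [C.sum_coord]

/-- The trivial module. -/
noncomputable abbrev trivialModule (ε : A →ₐ[k] k) : ModuleCat.{u} A :=
  (ModuleCat.restrictScalars (ε : A →+* k)).obj (ModuleCat.of k k)

/-- A form that is semilinear over `ε` sees a vector only through the augmentations of its
coordinates, and these vanish on boundaries. -/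
lemma apply_d_eq_zero {j : ℕ} {lam : P j →ₗ[k] k} (hlam : ∀ (a : A) p, lam (a • p) = ε a * lam p)
    (q : P (j + 1)) : lam (C.d j q) = 0 := by
  rw [← C.sum_coord j (C.d j q)]
  simp [hlam, C.minimal]

lemma exists_ext (aug : P 0 →ₗ[k] k) (haug : ∀ (a : A) p, aug (a • p) = ε a * aug p)
    (hsurj : Function.Surjective aug) (hker : ∀ p, aug p = 0 → ∃ q, C.d 0 q = p) (i : ℕ)
    (Y : ModuleCat.{u} A) :
    ∃ Θ : LinearMap.ker (Linear.leftComp k Y (ModuleCat.ofHom (C.d (i + 1)))) →ₗ[k]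
        Ext (trivialModule ε) Y (i + 1),
      ∀ lam, Θ lam = 0 → ∃ η : ModuleCat.of A (P i) ⟶ Y, ModuleCat.ofHom (C.d i) ≫ η = lam.1 := by
  let augA : P 0 →ₗ[A] trivialModule ε :=
    { toFun := aug
      map_add' := aug.map_add
      map_smul' := haug }
  have : ∀ j, Projective (ModuleCat.of A (P j)) := fun j => by
    have := C.module_projective j
    infer_instance
  have : Epi (ModuleCat.ofHom augA) := (ModuleCat.epi_iff_surjective _).2 hsurj
  refine exists_ext_of_cocycle i (fun j => ModuleCat.of A (P j)) (fun j => ModuleCat.ofHom (C.d j))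
    (ModuleCat.ofHom augA) ?_ ?_ ?_ ?_ Y
  · ext q
    exact C.apply_d_eq_zero haug q
  · rw [ShortComplex.moduleCat_exact_iff]
    exact hker
  · intro j
    ext q
    exact C.d_d j q
  · intro j
    rw [ShortComplex.moduleCat_exact_iff]
    exact C.exact j

lemma ofHom_mem_ker {j : ℕ} {Y : ModuleCat.{u} A} (L : P j →ₗ[A] Y)
    (hL : ∀ q, L (C.d j q) = 0) : ModuleCat.ofHom L ∈
      LinearMap.ker (Linear.leftComp k Y (ModuleCat.ofHom (C.d j))) := by
  change ModuleCat.ofHom (C.d j) ≫ ModuleCat.ofHom L = 0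
  ext q
  exact hL q

/-- Over an algebra of projective dimension at most `d`, forms on the `d`-th term lift to
cocycles with values in the algebra. -/
lemma exists_lift_cocycle {d : ℕ} [HasProjectiveDimensionLE (trivialModule ε) d]
    (aug : P 0 →ₗ[k] k) (haug : ∀ (a : A) p, aug (a • p) = ε a * aug p)
    (hsurj : Function.Surjective aug) (hker : ∀ p, aug p = 0 → ∃ q, C.d 0 q = p)
    {lam : P d →ₗ[k] k} (hlam : ∀ (a : A) p, lam (a • p) = ε a * lam p) :
    ∃ L : P d →ₗ[A] A, (∀ q, L (C.d d q) = 0) ∧ ∀ p, ε (L p) = lam p := by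
  -- A naive lift through the dual basis: it reduces to `lam` under `ε` but need not be a cocycle.
  let L₀ : P d →ₗ[A] A :=
    ∑ b, (LinearMap.toSpanSingleton A A (algebraMap k A (lam (C.gen d b)))) ∘ₗ C.coord d b
  have hL₀ : ∀ p, ε (L₀ p) = lam p := fun p => by
    conv_rhs => rw [← C.sum_coord d p]
    simp [L₀, hlam]
  let I : Ideal A := RingHom.ker ε
  -- The defect `L₀ ∘ d` is a cocycle of degree `d + 1` with values in the augmentation ideal `I`.
  -- As `Ext^{d+1}(k, I) = 0`, it equals `η ∘ d` with `η` valued in `I`, and subtracting `η` does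
  -- not change the reduction under `ε`.
  let κ : P (d + 1) →ₗ[A] I := (L₀ ∘ₗ C.d d).codRestrict I fun q => by
    simp [I, RingHom.mem_ker, hL₀, C.apply_d_eq_zero hlam]
  obtain ⟨Θ, hΘ⟩ := C.exists_ext aug haug hsurj hker d (ModuleCat.of A I)
  obtain ⟨η, hη⟩ := hΘ ⟨_, C.ofHom_mem_ker (Y := ModuleCat.of A I) κ
    fun q => Subtype.ext (by
      change L₀ (C.d d (C.d (d + 1) q)) = 0
      rw [C.d_d, map_zero])⟩
    (Ext.eq_zero_of_hasProjectiveDimensionLT _ (d + 1) le_rfl)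
  refine ⟨L₀ - I.subtype ∘ₗ η.hom, fun q => ?_, fun p => ?_⟩
  · have h := congrArg (fun f => (f.hom q).1) hη
    have h' : (η.hom (C.d d q)).1 = L₀ (C.d d q) := h
    simp [h']
  · have : ε (η.hom p).1 = 0 := (η.hom p).2
    simp [hL₀, this]

/-- The key consequence of regularity: the top term of the minimal resolution has rank one. -/
lemma linearly_dependent {d : ℕ} (hreg : IsLeftASRegular ε (d + 1))
    (aug : P 0 →ₗ[k] k) (haug : ∀ (a : A) p, aug (a • p) = ε a * aug p)
    (hsurj : Function.Surjective aug) (hker : ∀ p, aug p = 0 → ∃ q, C.d 0 q = p)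
    {lam mu : P (d + 1) →ₗ[k] k} (hlam : ∀ (a : A) p, lam (a • p) = ε a * lam p)
    (hmu : ∀ (a : A) p, mu (a • p) = ε a * mu p) :
    ∃ s t : k, (s ≠ 0 ∨ t ≠ 0) ∧ s • lam + t • mu = 0 := by
  have : HasProjectiveDimensionLE (trivialModule ε) (d + 1) := hreg.globalDim_le _
  obtain ⟨L, hL, hL'⟩ := C.exists_lift_cocycle aug haug hsurj hker hlam
  obtain ⟨L₂, hL₂, hL₂'⟩ := C.exists_lift_cocycle aug haug hsurj hker hmu
  obtain ⟨Θ, hΘ⟩ := C.exists_ext aug haug hsurj hker d (ModuleCat.of A A)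
  have hmem := fun (L : P (d + 1) →ₗ[A] A) (hL : ∀ q, L (C.d (d + 1) q) = 0) =>
    C.ofHom_mem_ker (Y := ModuleCat.of A A) L hL
  obtain ⟨v, hv0, hv⟩ := finrank_eq_one_iff'.1 hreg.ext_eq_one
  obtain ⟨s, hs⟩ := hv (Θ ⟨_, hmem L hL⟩)
  obtain ⟨t, ht⟩ := hv (Θ ⟨_, hmem L₂ hL₂⟩)
  -- A relation between the classes makes the same combination of the lifts a coboundary. By
  -- minimality `ε` kills coboundaries, so the relation passes to `lam` and `mu`.
  have key : ∀ s t : k, s • Θ ⟨_, hmem L hL⟩ + t • Θ ⟨_, hmem L₂ hL₂⟩ = 0 →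
      s • lam + t • mu = 0 := by
    intro s t h
    rw [← map_smul, ← map_smul, ← map_add] at h
    obtain ⟨η, hη⟩ := hΘ _ h
    ext q
    have h1 : η.hom (C.d d q) = algebraMap k A s * L q + algebraMap k A t * L₂ q :=
      congrArg (fun f => f.hom q) hη
    have h2 : ε (η.hom (C.d d q)) = 0 := by
      rw [← C.sum_coord d (C.d d q), map_sum, map_sum]
      refine Finset.sum_eq_zero fun b _ => ?_
      rw [map_smul, smul_eq_mul, map_mul, C.minimal, zero_mul]
    rw [h1] at h2
    simpa [hL', hL₂'] using h2
  -- Both classes are multiples of `v`, so `(-t, s)` is a relation; if `s = 0`, the first class is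
  -- itself zero.
  by_cases hst : s = 0
  · refine ⟨1, 0, Or.inl one_ne_zero, key 1 0 ?_⟩
    simp [← hs, hst]
  · refine ⟨-t, s, Or.inr hst, key _ _ ?_⟩
    rw [← hs, ← ht, smul_smul, smul_smul, ← add_smul]
    ring_nf
    simp

end MinimalComplex
end regular
end PreregularPair

namespace PreregularPair

namespace SuperpotentialAlgebra
variable {k : Type u} [Field k] {r N n : ℕ} (c : (Fin (r + N) → Fin n) → k)

/-! ## The Koszul complex -/

/-- The array of scalars `w` as an element of `A ⊗ (kⁿ)^{⊗ l}`. -/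
noncomputable def scalarArray (l : ℕ) :
    ((Fin l → Fin n) → k) →ₗ[k] ((Fin l → Fin n) → SuperpotentialAlgebra c) where
  toFun w i := algebraMap k _ (w i)
  map_add' w w' := by ext; simp
  map_smul' t w := by ext; simp [Algebra.smul_def]

lemma scalarArray_apply {l : ℕ} (w : (Fin l → Fin n) → k) (i) :
    scalarArray c l w i = algebraMap k _ (w i) := rfl

lemma koszulModule_eq_span (l : ℕ) :
    koszulModule c l = Submodule.span (SuperpotentialAlgebra c)
      (scalarArray c l '' (koszulSpace c l : Set ((Fin l → Fin n) → k))) := rfl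

variable {c} in
lemma scalarArray_mem {l : ℕ} {w : (Fin l → Fin n) → k} (hw : w ∈ koszulSpace c l) :
    scalarArray c l w ∈ koszulModule c l := Submodule.subset_span ⟨w, hw, rfl⟩

/-- The Koszul differential as a linear map. -/
noncomputable def koszulDifferentialₗ (q l : ℕ) :
    ((Fin (q + l) → Fin n) → SuperpotentialAlgebra c) →ₗ[SuperpotentialAlgebra c]
      ((Fin l → Fin n) → SuperpotentialAlgebra c) where
  toFun := koszulDifferential c q l
  map_add' w w' := by
    ext b; simp [koszulDifferential, add_mul, Finset.sum_add_distrib]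
  map_smul' a w := by
    ext b; simp [koszulDifferential, mul_assoc, Finset.mul_sum]

lemma koszulDifferentialₗ_apply {q l : ℕ} (w : (Fin (q + l) → Fin n) → SuperpotentialAlgebra c)
    (b : Fin l → Fin n) :
    koszulDifferentialₗ c q l w b = ∑ a, w (Fin.append a b) * letterProd (x c) a := rfl

-- A window in the tail is a window of the whole word, with `a` among the letters before it.
variable {c} in
lemma koszulSpace_tail {q l : ℕ} {w : (Fin (q + l) → Fin n) → k}
    (hw : w ∈ koszulSpace c (q + l)) (a : Fin q → Fin n) :
    (fun b => w (Fin.append a b)) ∈ koszulSpace c l := by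
  rw [mem_koszulSpace] at hw ⊢
  rintro s t rfl α β
  convert hw (q + s) t (by omega) (Fin.append a α) β using 1
  funext j
  simp only [slice]
  congr 1
  have e0 := Fin.append_assoc a α j
  have e : ∀ {l l' : ℕ} (h : l = l') (y : Fin l' → Fin n) (i : Fin (l + t)),
      Fin.append (y ∘ Fin.cast h) β i = Fin.append y β (Fin.cast (by omega) i) := by
    rintro l _ rfl y i; rfl
  rw [e0]
  funext i
  simp only [Function.comp_apply, e]
  rw [Fin.append_assoc a (Fin.append α j) β]
  rfl

lemma koszulDifferentialₗ_scalarArray {q l : ℕ} (w : (Fin (q + l) → Fin n) → k) :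
    koszulDifferentialₗ c q l (scalarArray c _ w) =
      ∑ a : Fin q → Fin n, letterProd (x c) a • scalarArray c l (fun b => w (Fin.append a b)) := by
  ext b
  simp only [koszulDifferentialₗ_apply, scalarArray_apply, Finset.sum_apply, Pi.smul_apply,
    smul_eq_mul, Algebra.commutes]

lemma koszulDifferentialₗ_mem {q l : ℕ} {p : (Fin (q + l) → Fin n) → SuperpotentialAlgebra c}
    (hp : p ∈ koszulModule c (q + l)) : koszulDifferentialₗ c q l p ∈ koszulModule c l := by
  suffices koszulModule c (q + l) ≤ (koszulModule c l).comap (koszulDifferentialₗ c q l) from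
    this hp
  rw [koszulModule_eq_span, Submodule.span_le]
  rintro _ ⟨w, hw, rfl⟩
  change koszulDifferentialₗ c q l (scalarArray c _ w) ∈ koszulModule c l
  rw [koszulDifferentialₗ_scalarArray]
  exact Submodule.sum_mem _ fun a _ => Submodule.smul_mem _ _
    (scalarArray_mem (koszulSpace_tail hw a))

/-- The composite multiplies out the first `q + q' = N` letters, and the slices of an element of `W`
along these letters are relations. -/
lemma koszulDifferentialₗ_comp {q q' l : ℕ} (hq : q + q' = N)
    {p : (Fin (q + (q' + l)) → Fin n) → SuperpotentialAlgebra c}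
    (hp : p ∈ koszulModule c (q + (q' + l))) :
    koszulDifferentialₗ c q' l (koszulDifferentialₗ c q (q' + l) p) = 0 := by
  subst hq
  suffices koszulModule c (q + (q' + l)) ≤
    LinearMap.ker (koszulDifferentialₗ c q' l ∘ₗ koszulDifferentialₗ c q (q' + l)) from this hp
  rw [koszulModule_eq_span, Submodule.span_le]
  rintro _ ⟨w, hw, rfl⟩
  change koszulDifferentialₗ c q' l (koszulDifferentialₗ c q (q' + l) (scalarArray c _ w)) = 0
  ext b
  have h := sum_letterProd_eq_zero c
    (mem_koszulSpace.1 hw 0 l (by omega) Fin.elim0 b)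
  rw [sum_word_append, Finset.sum_comm] at h
  rw [koszulDifferentialₗ_apply]
  simp only [koszulDifferentialₗ_apply, Finset.sum_mul, scalarArray_apply, Pi.zero_apply]
  rw [← h]
  refine Finset.sum_congr rfl fun a' _ => Finset.sum_congr rfl fun a _ => ?_
  rw [letterProd_append, mul_assoc, Algebra.smul_def]
  congr 2
  simp only [slice]
  congr 1
  have e : ∀ {l₁ l₂ : ℕ} (h : l₁ = l₂) (y : Fin l₂ → Fin n) (i : Fin (l₁ + l)),
      Fin.append (y ∘ Fin.cast h) b i = Fin.append y b (Fin.cast (by omega) i) := by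
    rintro l _ rfl y i; rfl
  funext i
  rw [Fin.append_left_nil _ _ rfl]
  simp only [Function.comp_apply, e]
  rw [Fin.append_assoc]
  rfl

/-- A projection of all arrays onto `W_l`. -/
lemma exists_projection (l : ℕ) : ∃ π : ((Fin l → Fin n) → k) →ₗ[k] koszulSpace c l,
    ∀ w : koszulSpace c l, π w = w := by
  obtain ⟨π, hπ⟩ := (koszulSpace c l).subtype.exists_leftInverse_of_injective
    (Submodule.ker_subtype _)
  exact ⟨π, fun w => LinearMap.congr_fun hπ w⟩

/-- The projection of a word to `W_l`, as an element of the Koszul complex. -/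
noncomputable def wordGen (l : ℕ) (b : Fin l → Fin n) : koszulModule c l :=
  ⟨scalarArray c l ((exists_projection c l).choose (Pi.single b 1)),
    scalarArray_mem (Submodule.coe_mem _)⟩

lemma sum_smul_wordGen {l : ℕ} {w : (Fin l → Fin n) → k} (hw : w ∈ koszulSpace c l) :
    ∑ b, w b • (wordGen c l b : (Fin l → Fin n) → SuperpotentialAlgebra c)
      = scalarArray c l w := by
  have h := (exists_projection c l).choose_spec ⟨w, hw⟩
  set π := (exists_projection c l).choose with hπ
  have h' : (π w : (Fin l → Fin n) → k) = w := congrArg Subtype.val h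
  conv_rhs => rw [← h', pi_eq_sum_univ' w]
  simp only [wordGen, map_sum, map_smul, ← hπ, Submodule.coe_sum, Submodule.coe_smul]

/-- The projection onto `W_l`, extended `A`-linearly, fixes `A ⊗ W_l`. So the plain coordinates and
the projected words form a dual basis, which makes the terms of the Koszul complex projective. -/
lemma sum_coord_wordGen {l : ℕ} (p : koszulModule c l) : ∑ b, p.1 b • wordGen c l b = p := by
  have key : ∀ p ∈ koszulModule c l, ∑ b, p b • (wordGen c l b).1 = p := by
    intro p hp
    rw [koszulModule_eq_span] at hp
    induction hp using Submodule.span_induction with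
    | mem p hp =>
      obtain ⟨w, hw, rfl⟩ := hp
      conv_rhs => rw [← sum_smul_wordGen c hw]
      simp only [scalarArray_apply, algebraMap_smul]
    | zero => simp
    | add p q _ _ hp hq =>
      simp only [Pi.add_apply, add_smul, Finset.sum_add_distrib, hp, hq]
    | smul a p _ hp =>
      simp only [Pi.smul_apply, smul_assoc, ← Finset.smul_sum, hp]
  apply Subtype.ext
  simpa using key p.1 p.2

lemma koszulStep_add (N i : ℕ) (hN : 1 ≤ N) : koszulStep N (i + 1) + koszulStep N i = N := by
  by_cases h : Even i <;> simp [koszulStep, h, Nat.even_add_one] <;> omega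

lemma koszulStep_pos {N : ℕ} (hN : 2 ≤ N) (i : ℕ) : 0 < koszulStep N i := by
  by_cases h : Even i <;> simp [koszulStep, h]; omega

lemma augmentation_letterProd (hN : 2 ≤ N) {l : ℕ} (hl : 0 < l) (a : Fin l → Fin n) :
    augmentation c hN (letterProd (x c) a) = 0 := by
  obtain ⟨l, rfl⟩ : ∃ l', l = l' + 1 := ⟨l - 1, by omega⟩
  rw [letterProd_succ, map_mul, augmentation_x, zero_mul]

lemma augmentation_koszulDifferentialₗ (hN : 2 ≤ N) {q l : ℕ} (hq : 0 < q)
    (p : (Fin (q + l) → Fin n) → SuperpotentialAlgebra c) (b : Fin l → Fin n) :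
    augmentation c hN (koszulDifferentialₗ c q l p b) = 0 := by
  rw [koszulDifferentialₗ_apply, map_sum]
  exact Finset.sum_eq_zero fun a _ => by
    rw [map_mul, augmentation_letterProd c hN hq, mul_zero]

/-- The terms of the Koszul complex. -/
abbrev koszulTerm (j : ℕ) : Type u := koszulModule c (koszulDegree N j)

/-- The Koszul complex of an `N`-Koszul algebra. -/
noncomputable def koszulComplex (hN : 2 ≤ N) (hK : IsNKoszul c) :
    MinimalComplex (augmentation c hN) (koszulTerm c) where
  d j := (koszulDifferentialₗ c (koszulStep N j) (koszulDegree N j)).restrict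
    fun p hp => koszulDifferentialₗ_mem c hp
  ι j := Fin (koszulDegree N j) → Fin n
  fintype j := inferInstance
  coord j b := LinearMap.proj b ∘ₗ Submodule.subtype _
  gen j b := wordGen c _ b
  sum_coord j p := sum_coord_wordGen c p
  d_d j p := Subtype.ext (koszulDifferentialₗ_comp c (koszulStep_add N j (by omega)) p.2)
  exact j p hp := by
    obtain ⟨q, hq, h⟩ := hK j p.1 p.2 (congrArg Subtype.val hp)
    exact ⟨⟨q, hq⟩, Subtype.ext h⟩
  minimal j b p := by
    exact augmentation_koszulDifferentialₗ c hN (koszulStep_pos hN j) p.1 b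

lemma koszulSpace_eq_top {l : ℕ} (hl : l < N) : koszulSpace c l = ⊤ := by
  rw [eq_top_iff]
  intro w _
  rw [mem_koszulSpace]
  intro s t h
  omega

lemma koszulModule_eq_top {l : ℕ} (hl : l < N) : koszulModule c l = ⊤ := by
  rw [eq_top_iff]
  intro p _
  have : p = ∑ b, p b • scalarArray c l (Pi.single b 1) := by
    ext b
    simp [scalarArray_apply, Finset.sum_apply, Pi.single_apply, apply_ite (algebraMap k _)]
  rw [this]
  refine Submodule.sum_mem _ fun b _ => Submodule.smul_mem _ _ (scalarArray_mem ?_)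
  rw [koszulSpace_eq_top c hl]
  trivial

/-- The `x_i` generate the augmentation ideal as a left ideal. This is exactness at `A`, which
`IsNKoszul` does not include. -/
lemma exists_eq_aug_add (hN : 2 ≤ N) (z : SuperpotentialAlgebra c) :
    ∃ a : Fin n → SuperpotentialAlgebra c,
      z = algebraMap k _ (augmentation c hN z) + ∑ i, a i * x c i := by
  induction z using SuperpotentialAlgebra.induction with
  | hs t => exact ⟨0, by simp⟩
  | hg i =>
    refine ⟨Pi.single i 1, ?_⟩
    simp [augmentation_x, Pi.single_apply]
  | hm z z' h h' =>
    obtain ⟨a, ha⟩ := h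
    obtain ⟨a', ha'⟩ := h'
    -- Expand `z'` in the product, and then `z` in the resulting term `ε(z') z`.
    refine ⟨fun i => augmentation c hN z' • a i + z * a' i, ?_⟩
    conv_lhs => rw [ha', mul_add, ← Algebra.commutes, ha]
    conv_lhs => enter [2]; rw [← ha]
    simp only [add_mul, mul_add, Finset.sum_add_distrib, map_mul, Finset.mul_sum, mul_assoc,
      Algebra.smul_def, add_assoc]
    rw [Algebra.commutes (augmentation c hN z)]
  | ha z z' h h' =>
    obtain ⟨a, ha⟩ := h
    obtain ⟨a', ha'⟩ := h'
    refine ⟨fun i => a i + a' i, ?_⟩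
    conv_lhs => rw [ha, ha']
    simp only [add_mul, Finset.sum_add_distrib, map_add]
    abel

lemma exists_koszulDifferential_eq (hN : 2 ≤ N) {q : ℕ} (hq : q = 1)
    (p : (Fin 0 → Fin n) → SuperpotentialAlgebra c)
    (hp : augmentation c hN (p Fin.elim0) = 0) :
    ∃ p' ∈ koszulModule c (q + 0), koszulDifferentialₗ c q 0 p' = p := by
  subst hq
  obtain ⟨a, ha⟩ := exists_eq_aug_add c hN (p Fin.elim0)
  rw [hp, map_zero, zero_add] at ha
  refine ⟨fun i => a (i 0), by rw [koszulModule_eq_top c (by omega)]; trivial, ?_⟩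
  ext b
  rw [Subsingleton.elim b Fin.elim0, ha, koszulDifferentialₗ_apply, sum_word_cons]
  simp [letterProd_succ, letterProd_zero]

/-- The augmentation of the Koszul complex. -/
noncomputable def koszulAug (hN : 2 ≤ N) : koszulTerm c 0 →ₗ[k] k :=
  (augmentation c hN).toLinearMap ∘ₗ
    (LinearMap.proj (Fin.elim0 : Fin 0 → Fin n)) ∘ₗ (Submodule.subtype _).restrictScalars k

lemma koszulAug_apply (hN : 2 ≤ N) (p : koszulTerm c 0) :
    koszulAug c hN p = augmentation c hN (p.1 Fin.elim0) := rfl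

lemma koszulAug_smul (hN : 2 ≤ N) (a : SuperpotentialAlgebra c) (p : koszulTerm c 0) :
    koszulAug c hN (a • p) = augmentation c hN a * koszulAug c hN p := by
  simp only [koszulAug_apply]
  exact map_mul _ _ _

/-- The generator of the zeroth term of the Koszul complex. -/
noncomputable def koszulOne (hN : 2 ≤ N) : koszulTerm c 0 :=
  ⟨scalarArray c 0 fun _ => 1, scalarArray_mem (by
    rw [koszulSpace_eq_top c (show koszulDegree N 0 < N by simp only [koszulDegree]; omega)]
    trivial)⟩

lemma koszulAug_one (hN : 2 ≤ N) : koszulAug c hN (koszulOne c hN) = 1 := by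
  rw [koszulAug_apply]
  simp [koszulOne, scalarArray_apply]

lemma koszulAug_surjective (hN : 2 ≤ N) : Function.Surjective (koszulAug c hN) := fun t =>
  ⟨t • koszulOne c hN, by rw [map_smul, koszulAug_one, smul_eq_mul, mul_one]⟩

lemma exists_of_koszulAug_eq_zero (hN : 2 ≤ N) (hK : IsNKoszul c) (p : koszulTerm c 0)
    (hp : koszulAug c hN p = 0) : ∃ q, (koszulComplex c hN hK).d 0 q = p := by
  obtain ⟨q, hq, h⟩ := exists_koszulDifferential_eq c hN (q := koszulStep N 0)
    (by simp [koszulStep]) p.1 hp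
  exact ⟨⟨q, hq⟩, Subtype.ext h⟩

/-- A form on arrays of words, extended to the Koszul complex. -/
noncomputable def extendForm (hN : 2 ≤ N) {l : ℕ} (f : ((Fin l → Fin n) → k) →ₗ[k] k) :
    koszulModule c l →ₗ[k] k :=
  f ∘ₗ LinearMap.compLeft (augmentation c hN).toLinearMap _ ∘ₗ
    (Submodule.subtype _).restrictScalars k

lemma extendForm_smul (hN : 2 ≤ N) {l : ℕ} (f : ((Fin l → Fin n) → k) →ₗ[k] k)
    (a : SuperpotentialAlgebra c) (p : koszulModule c l) :
    extendForm c hN f (a • p) = augmentation c hN a * extendForm c hN f p := by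
  rw [← smul_eq_mul, ← map_smul]
  simp only [extendForm, LinearMap.comp_apply]
  congr 1
  ext b
  simp

lemma extendForm_scalarArray (hN : 2 ≤ N) {l : ℕ} (f : ((Fin l → Fin n) → k) →ₗ[k] k)
    {w : (Fin l → Fin n) → k} (hw : w ∈ koszulSpace c l) :
    extendForm c hN f ⟨scalarArray c l w, scalarArray_mem hw⟩ = f w := by
  simp only [extendForm, LinearMap.comp_apply]
  congr 1
  ext b
  simp [scalarArray_apply]

/-- The top term of the Koszul complex of a regular algebra has rank one. -/
lemma koszulSpace_rank_one (hN : 2 ≤ N) (hK : IsNKoszul c) {d : ℕ}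
    (hR : IsLeftASRegular (augmentation c hN) (d + 1)) {w : (Fin (koszulDegree N (d + 1)) → Fin n) → k}
    (hw : w ∈ koszulSpace c (koszulDegree N (d + 1))) (hw0 : w ≠ 0) :
    ∀ w' ∈ koszulSpace c (koszulDegree N (d + 1)), ∃ t : k, w' = t • w := by
  intro w' hw'
  by_contra hcon
  -- If `w'` were not a multiple of `w`, a form `f'` with `f' w = 0 ≠ f' w'` and a form `f` with `f
  -- w ≠ 0` would extend to independent forms on the top term, against `linearly_dependent`.
  have h1 : w' ∉ Submodule.span k {w} := fun h => by
    obtain ⟨t, ht⟩ := Submodule.mem_span_singleton.1 h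
    exact hcon ⟨t, ht.symm⟩
  obtain ⟨f', hf', hle⟩ := Submodule.exists_le_ker_of_notMem h1
  have hf'w : f' w = 0 := hle (Submodule.mem_span_singleton_self w)
  obtain ⟨f, hf⟩ : ∃ f : Module.Dual k _, f w ≠ 0 := by
    by_contra! h
    exact hw0 ((Module.forall_dual_apply_eq_zero_iff k w).1 h)
  obtain ⟨s, t, hst, h⟩ := (koszulComplex c hN hK).linearly_dependent hR (koszulAug c hN)
    (koszulAug_smul c hN) (koszulAug_surjective c hN) (exists_of_koszulAug_eq_zero c hN hK)
    (extendForm_smul c hN f) (extendForm_smul c hN f')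
  have e := LinearMap.congr_fun h ⟨_, scalarArray_mem hw⟩
  have e' := LinearMap.congr_fun h ⟨_, scalarArray_mem hw'⟩
  simp only [LinearMap.add_apply, LinearMap.smul_apply, extendForm_scalarArray,
    LinearMap.zero_apply, hw, hw', hf'w, smul_eq_mul, mul_zero, add_zero] at e e'
  have hs : s = 0 := (mul_eq_zero.1 e).resolve_right hf
  subst hs
  have ht : t = 0 := (mul_eq_zero.1 (by simpa using e')).resolve_right hf'
  simp [ht] at hst

end SuperpotentialAlgebra
end PreregularPair

namespace PreregularPair

/-! ## Evaluation of bar cocycles on the Koszul complex -/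

namespace BarCochain
variable {k : Type*} [Field k] {A : Type*} [Ring A] [Algebra k A]
  {Y : Type*} [AddCommGroup Y] [Module k Y] [Module A Y] [IsScalarTower k A Y]
  {M : Type*} [AddCommGroup M] [Module k M]

lemma contractNth_zero_cons {α : Type*} (op : α → α → α) {i : ℕ} (a : Fin (i + 2) → α) :
    Fin.contractNth (0 : Fin (i + 1)).castSucc op a =
      Fin.cons (op (a 0) (a 1)) (Fin.tail (Fin.tail a)) := by
  funext p
  refine Fin.cases ?_ (fun p => ?_) p
  · simp [Fin.contractNth]
  · simp [Fin.contractNth, Fin.tail]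

lemma contractNth_succ_cons {α : Type*} (op : α → α → α) {i : ℕ} (j : Fin i)
    (a : Fin (i + 2) → α) :
    Fin.contractNth j.succ.castSucc op a =
      Fin.cons (a 0) (Fin.contractNth j.castSucc op (Fin.tail a)) := by
  funext p
  refine Fin.cases ?_ (fun p => ?_) p
  · simp [Fin.contractNth]
  · simp [Fin.contractNth, Fin.tail]

/-- The recursion unfolds to the alternating sum, which connects the recursive complex with
`barDifferential`. -/
lemma sigma_apply {i : ℕ} (φ : BarCochain k A Y M i) (a : Fin (i + 1) → A) (y : Y) :
    sigma i φ a y = ∑ j : Fin i, (-1 : k) ^ (j.val + 1) •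
        φ (Fin.contractNth j.castSucc (· * ·) a) y
      + (-1 : k) ^ (i + 1) • φ (Fin.init a) (a (Fin.last i) • y) := by
  have h : ∀ {i : ℕ} (ψ : BarCochain k A Y M (i + 1)) (a : Fin (i + 1) → A),
      ψ a = ψ.curryLeft (a 0) (Fin.tail a) := fun ψ a => by
    simp [Fin.cons_self_tail]
  induction i with
  | zero =>
    rw [h, curryLeft_sigma_zero]
    simp [mulFirst]
    congr 2
    exact Subsingleton.elim _ _
  | succ i ih =>
    rw [h, curryLeft_sigma_succ, Fin.sum_univ_succ]
    have h1 : mulFirst (a 0) φ (Fin.tail a) y =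
        φ (Fin.contractNth (0 : Fin (i + 1)).castSucc (· * ·) a) y := by
      rw [h, curryLeft_mulFirst, contractNth_zero_cons]
      rfl
    have h2 : ∀ j : Fin i, φ.curryLeft (a 0) (Fin.contractNth j.castSucc (· * ·) (Fin.tail a)) y
        = φ (Fin.contractNth j.succ.castSucc (· * ·) a) y := fun j => by
      rw [contractNth_succ_cons]
      rfl
    have h3 : φ.curryLeft (a 0) (Fin.init (Fin.tail a)) = φ (Fin.init a) := by
      rw [h φ (Fin.init a)]
      rfl
    simp only [sub_apply, neg_apply, LinearMap.sub_apply, LinearMap.neg_apply, h1, ih, h2, h3]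
    simp only [Fin.tail, Fin.succ_last, Fin.val_zero, zero_add, Fin.val_succ,
      pow_succ, mul_neg, mul_one, neg_smul, Finset.sum_neg_distrib, neg_neg]
    simp
    abel

lemma delta_apply (ε : A →ₐ[k] k) {i : ℕ} (φ : BarCochain k A Y M i) (a : Fin (i + 1) → A) (y : Y) :
    delta ε i φ a y = ε (a 0) • φ (Fin.tail a) y + sigma i φ a y := rfl

/-- Evaluation in the last variable. -/
noncomputable def evalAt (y : Y) {i : ℕ} (φ : BarCochain k A Y M i) :
    MultilinearMap k (fun _ : Fin i => A) M :=
  (LinearMap.applyₗ y).compMultilinearMap φ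

omit [Module A Y] [IsScalarTower k A Y] in
@[simp] lemma evalAt_apply (y : Y) {i : ℕ} (φ : BarCochain k A Y M i) (a) :
    evalAt y φ a = φ a y := rfl

/-- Semilinearity at `y` turns the last term of `delta` into the one for trivial coefficients.
Together with `delta_smulForm` this passes between cochains on `A^i` and cochains on `A^i × P 0`. -/
lemma barDifferential_evalAt (ε : A →ₐ[k] k) {i : ℕ} (φ : BarCochain k A Y M i) (y : Y)
    (h : ∀ (x : A) a, φ a (x • y) = ε x • φ a y) (a : Fin (i + 1) → A) :
    barDifferential ε (evalAt y φ) a = delta ε i φ a y := by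
  rw [delta_apply, sigma_apply, barDifferential, h]
  simp only [evalAt_apply, add_assoc]

/-- Multiplication by a linear form in the last variable. -/
noncomputable def smulForm (f : Y →ₗ[k] k) {i : ℕ} (φ : MultilinearMap k (fun _ : Fin i => A) M) :
    BarCochain k A Y M i :=
  (LinearMap.smulRightₗ f).compMultilinearMap φ

omit [Module A Y] [IsScalarTower k A Y] in
@[simp] lemma smulForm_apply (f : Y →ₗ[k] k) {i : ℕ}
    (φ : MultilinearMap k (fun _ : Fin i => A) M) (a) (y : Y) :
    smulForm f φ a y = f y • φ a := rfl

lemma delta_smulForm (ε : A →ₐ[k] k) {f : Y →ₗ[k] k} (hf : ∀ (x : A) y, f (x • y) = ε x * f y)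
    {i : ℕ} (φ : MultilinearMap k (fun _ : Fin i => A) M) (a : Fin (i + 1) → A) (y : Y) :
    delta ε i (smulForm f φ) a y = f y • barDifferential ε φ a := by
  rw [delta_apply, sigma_apply, barDifferential]
  simp only [smulForm_apply, hf, smul_add, Finset.smul_sum, smul_smul, add_assoc]
  congr 1
  · rw [mul_comm]
  · congr 1
    · exact Finset.sum_congr rfl fun j _ => by rw [mul_comm]
    · congr 1; ring

end BarCochain

namespace MinimalComplex
open BarCochain
variable {k : Type*} [Field k] {A : Type*} [Ring A] [Algebra k A] {ε : A →ₐ[k] k}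
    {P : ℕ → Type*} [∀ j, AddCommGroup (P j)] [∀ j, Module k (P j)] [∀ j, Module A (P j)]
    [∀ j, IsScalarTower k A (P j)] (C : MinimalComplex ε P)
    {M : Type*} [AddCommGroup M] [Module k M]

lemma delta_transferAll (i j l : ℕ) (h : j + i = l) {φ : BarCochain k A (P j) M i}
    (h1 : delta ε i φ = 0) (h2 : C.res j φ = 0) : delta ε 0 (C.transferAll i j l h φ) = 0 := by
  induction i generalizing j with
  | zero => subst h; exact h1
  | succ i ih =>
    rw [transferAll_succ]
    exact ih (j + 1) (by omega) (by rw [C.delta_transfer j i h1, h2]) (C.res_transfer j i φ)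

lemma curryLeft_transfer_succ (j i : ℕ) (φ : BarCochain k A (P j) M (i + 2)) (a : A) :
    (C.transfer j (i + 1) φ).curryLeft a = -C.transfer j i (φ.curryLeft a) := by
  rw [transfer, LinearMap.comp_apply, res, curryLeft_pull, homotopy, curryLeft_contract_succ,
    map_neg]
  rfl

/-- The iterated shift, with the first variable treated last. -/
lemma transferAll_eq_transfer_shift (i j l : ℕ) (h : j + i = l)
    (φ : BarCochain k A (P j) M (i + 1)) :
    C.transferAll (i + 1) j (l + 1) (by omega) φ =
      (-1 : k) ^ i • C.transfer l 0 (shift (C.transferAll i j l h) φ) := by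
  induction i generalizing j with
  | zero =>
    subst h
    rw [pow_zero, one_smul, transferAll_succ]
    exact congrArg (C.transfer j 0) (ext_succ fun a => by rw [curryLeft_shift]; rfl)
  | succ i ih =>
    have key : shift (C.transferAll i (j + 1) l (by omega)) (C.transfer j (i + 1) φ) =
        -shift (C.transferAll (i + 1) j l h) φ := by
      refine ext_succ fun a => ?_
      rw [curryLeft_shift, curryLeft_neg, curryLeft_shift, curryLeft_transfer_succ, map_neg]
      rfl
    rw [transferAll_succ, ih (j + 1) (by omega), key, map_neg, pow_succ, mul_neg_one]
    exact (smul_neg _ _).trans (neg_smul _ _).symm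

end MinimalComplex

namespace SuperpotentialAlgebra
open BarCochain
variable {k : Type u} [Field k] {r N n : ℕ} (c : (Fin (r + N) → Fin n) → k)
  {M : Type w} [AddCommGroup M] [Module k M]

/-- Cut a word of length `koszulDegree N i` into `i` blocks, and multiply the letters of each. -/
noncomputable def blocks {H : Type*} [Monoid H] (N : ℕ) (y : Fin n → H) :
    (i : ℕ) → (Fin (koszulDegree N i) → Fin n) → Fin i → H
  | 0, _ => Fin.elim0
  | i + 1, v => Fin.cons (α := fun _ => H)
      (letterProd y fun p : Fin (koszulStep N i) => v (Fin.castAdd (koszulDegree N i) p))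
      (blocks N y i fun p => v (Fin.natAdd (koszulStep N i) p))

lemma blocks_append {H : Type*} [Monoid H] (y : Fin n → H) (i : ℕ)
    (α : Fin (koszulStep N i) → Fin n) (β : Fin (koszulDegree N i) → Fin n) :
    blocks N y (i + 1) (Fin.append α β) =
      Fin.cons (α := fun _ => H) (letterProd y α) (blocks N y i β) := by
  simp [blocks]

/-- The value of a cochain on the image of `w ∈ W_l` in the bar complex. -/
noncomputable def evalWord {i : ℕ} (w : (Fin (koszulDegree N i) → Fin n) → k)
    (φ : MultilinearMap k (fun _ : Fin i => SuperpotentialAlgebra c) M) : M :=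
  ∑ v, w v • φ (blocks N (x c) i v)

variable (hN : 2 ≤ N) (hK : IsNKoszul c)

lemma sum_smul_wordGen_eq {l : ℕ} {w : (Fin l → Fin n) → k} (hw : w ∈ koszulSpace c l) :
    ∑ b, w b • wordGen c l b = ⟨scalarArray c l w, scalarArray_mem hw⟩ := by
  apply Subtype.ext
  rw [Submodule.coe_sum]
  exact sum_smul_wordGen c hw

/-- The coordinates of the differential of a scalar array are combinations of products over the
first block, so one shift inserts such a product in the cochain and leaves the rest of the word. -/
lemma transfer_zero_scalarArray {i : ℕ}
    (ψ : BarCochain k (SuperpotentialAlgebra c) (koszulTerm c i) M 1)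
    {w : (Fin (koszulStep N i + koszulDegree N i) → Fin n) → k}
    (hw : w ∈ koszulSpace c (koszulStep N i + koszulDegree N i)) :
    (koszulComplex c hN hK).transfer i 0 ψ Fin.elim0 ⟨scalarArray c _ w, scalarArray_mem hw⟩ =
      -∑ α : Fin (koszulStep N i) → Fin n, ψ.curryLeft (letterProd (x c) α) Fin.elim0
        ⟨scalarArray c _ fun b => w (Fin.append α b), scalarArray_mem (koszulSpace_tail hw α)⟩ := by
  rw [MinimalComplex.transfer, LinearMap.comp_apply, MinimalComplex.res_apply,
    MinimalComplex.homotopy, contract_zero_apply]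
  congr 1
  have h1 : ∀ b : Fin (koszulDegree N i) → Fin n,
      koszulDifferentialₗ c _ _ (scalarArray c (koszulStep N i + koszulDegree N i) w) b =
      ∑ α : Fin (koszulStep N i) → Fin n, w (Fin.append α b) • letterProd (x c) α := by
    intro b
    rw [koszulDifferentialₗ_apply]
    simp only [scalarArray_apply, Algebra.smul_def]
  have h2 : ∀ α : Fin (koszulStep N i) → Fin n, ψ.curryLeft (letterProd (x c) α) Fin.elim0
      ⟨scalarArray c _ fun b => w (Fin.append α b), scalarArray_mem (koszulSpace_tail hw α)⟩ =
      ∑ b, w (Fin.append α b) • ψ.curryLeft (letterProd (x c) α) Fin.elim0 (wordGen c _ b) := by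
    intro α
    refine (congrArg (ψ.curryLeft (letterProd (x c) α) Fin.elim0)
      (sum_smul_wordGen_eq c (koszulSpace_tail hw α)).symm).trans ?_
    simp only [map_sum, map_smul]
  refine Eq.trans ?_ (Finset.sum_congr rfl fun α _ => (h2 α).symm)
  refine Eq.trans ?_ Finset.sum_comm
  refine Finset.sum_congr rfl fun b _ => ?_
  refine (congrArg (fun z => ψ.curryLeft z Fin.elim0 (wordGen c _ b)) (h1 b)).trans ?_
  simp only [map_sum, map_smul, sum_apply, smul_apply, LinearMap.sum_apply, LinearMap.smul_apply]

/-- By `transferAll_eq_transfer_shift` the last shift may be made to consume the first argument,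
which receives the first block; so iterated shifting is evaluation on the blocks of `w`. Of the
sign, only its nonvanishing is needed. -/
lemma exists_sign_transferAll (i : ℕ) : ∃ s : k, s ≠ 0 ∧
    ∀ (φ : BarCochain k (SuperpotentialAlgebra c) (koszulTerm c 0) M i)
      (w : (Fin (koszulDegree N i) → Fin n) → k) (hw : w ∈ koszulSpace c (koszulDegree N i)),
      (koszulComplex c hN hK).transferAll i 0 i (zero_add i) φ Fin.elim0
        ⟨scalarArray c _ w, scalarArray_mem hw⟩ = s • evalWord c w (evalAt (koszulOne c hN) φ) := by
  induction i with
  | zero =>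
    refine ⟨1, one_ne_zero, fun φ w hw => ?_⟩
    rw [MinimalComplex.transferAll_zero, one_smul, evalWord]
    have e : ∀ b : Fin (koszulDegree N 0) → Fin n, b = (Fin.elim0 : Fin 0 → Fin n) :=
      fun b => Subsingleton.elim (α := Fin 0 → Fin n) _ _
    have : (⟨scalarArray c _ w, scalarArray_mem hw⟩ : koszulTerm c 0) =
        w (Fin.elim0 : Fin 0 → Fin n) • koszulOne c hN := by
      apply Subtype.ext
      funext b
      rw [e b]
      change algebraMap k (SuperpotentialAlgebra c) _ = w _ • algebraMap k (SuperpotentialAlgebra c) 1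
      rw [map_one, Algebra.algebraMap_eq_smul_one]
    rw [this, map_smul]
    exact (Fintype.sum_unique (ι := Fin 0 → Fin n) fun v =>
      w v • evalAt (koszulOne c hN) φ (blocks N (x c) 0 v)).symm
  | succ i ih =>
    obtain ⟨s, hs, h⟩ := ih
    -- The power of `-1` comes from treating the first argument last, the other sign from the
    -- contraction.
    refine ⟨-((-1) ^ i * s), by simp [hs], fun φ w hw => ?_⟩
    rw [MinimalComplex.transferAll_eq_transfer_shift _ i 0 i (zero_add i)]
    rw [smul_apply, LinearMap.smul_apply]
    have h1 := transfer_zero_scalarArray c hN hK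
      (shift ((koszulComplex c hN hK).transferAll i 0 i (zero_add i)) φ) hw
    have h3 : ∀ α : Fin (koszulStep N i) → Fin n,
        (shift ((koszulComplex c hN hK).transferAll i 0 i (zero_add i)) φ).curryLeft
          (letterProd (x c) α) Fin.elim0 ⟨scalarArray c _ fun b => w (Fin.append α b),
            scalarArray_mem (koszulSpace_tail hw α)⟩ =
        s • evalWord c (fun b => w (Fin.append α b))
          (evalAt (koszulOne c hN) (φ.curryLeft (letterProd (x c) α))) := fun α => by
      rw [curryLeft_shift]
      exact h _ _ (koszulSpace_tail hw α)
    refine (congrArg ((-1 : k) ^ i • ·) (h1.trans (congrArg (fun z => -z)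
      (Finset.sum_congr rfl fun α _ => h3 α)))).trans ?_
    rw [← Finset.smul_sum]
    rw [smul_neg, neg_smul, mul_smul]
    refine congrArg (fun z => -((-1 : k) ^ i • s • z)) ?_
    refine Eq.symm ((sum_word_append (s := koszulStep N i) (t := koszulDegree N i) _).trans ?_)
    refine Finset.sum_congr rfl fun α _ => Finset.sum_congr rfl fun β _ => ?_
    rw [blocks_append]
    rfl

end SuperpotentialAlgebra
end PreregularPair

namespace PreregularPair

/-! ### Bar cohomology read off from the Koszul spaces. -/

namespace SuperpotentialAlgebra
open BarCochain
variable {k : Type u} [Field k] {r N n : ℕ} (c : (Fin (r + N) → Fin n) → k)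
  {M : Type w} [AddCommGroup M] [Module k M] (hN : 2 ≤ N) (hK : IsNKoszul c)

lemma res_smulForm {i : ℕ}
    (φ : MultilinearMap k (fun _ : Fin i => SuperpotentialAlgebra c) M) :
    (koszulComplex c hN hK).res 0 (smulForm (koszulAug c hN) φ) = 0 := by
  ext a p
  rw [MinimalComplex.res_apply, smulForm_apply,
    (koszulComplex c hN hK).apply_d_eq_zero (koszulAug_smul c hN), zero_smul]
  rfl

lemma evalAt_smulForm {i : ℕ}
    (φ : MultilinearMap k (fun _ : Fin i => SuperpotentialAlgebra c) M) :
    evalAt (koszulOne c hN) (smulForm (koszulAug c hN) φ) = φ := by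
  ext a
  rw [evalAt_apply, smulForm_apply, koszulAug_one, one_smul]

/-- A cochain that vanishes on the image of the differential is semilinear. -/
lemma apply_smul_of_res_eq_zero {i : ℕ}
    {χ : BarCochain k (SuperpotentialAlgebra c) (koszulTerm c 0) M i}
    (h : (koszulComplex c hN hK).res 0 χ = 0) (z : SuperpotentialAlgebra c) (a) :
    χ a (z • koszulOne c hN) = augmentation c hN z • χ a (koszulOne c hN) := by
  obtain ⟨q, hq⟩ := exists_of_koszulAug_eq_zero c hN hK
    (z • koszulOne c hN - augmentation c hN z • koszulOne c hN) (by
      rw [map_sub, koszulAug_smul, map_smul, smul_eq_mul, sub_self])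
  have e : χ a ((koszulComplex c hN hK).d 0 q) = 0 := by
    rw [← MinimalComplex.res_apply, h]; rfl
  rw [hq, map_sub, sub_eq_zero] at e
  exact e.trans (map_smul _ _ _)

lemma evalWord_eq_zero_iff {i : ℕ} {w : (Fin (koszulDegree N i) → Fin n) → k}
    (hw : w ∈ koszulSpace c (koszulDegree N i))
    (φ : BarCochain k (SuperpotentialAlgebra c) (koszulTerm c 0) M i) :
    (koszulComplex c hN hK).transferAll i 0 i (zero_add i) φ Fin.elim0
      ⟨scalarArray c _ w, scalarArray_mem hw⟩ = 0 ↔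
      evalWord c w (evalAt (koszulOne c hN) φ) = 0 := by
  obtain ⟨s, hs, h⟩ := exists_sign_transferAll c (M := M) hN hK i
  rw [h φ w hw, smul_eq_zero, or_iff_right hs]

lemma delta_smulForm_eq_zero {i : ℕ}
    {φ : MultilinearMap k (fun _ : Fin i => SuperpotentialAlgebra c) M}
    (h : ∀ a, barDifferential (augmentation c hN) φ a = 0) :
    delta (augmentation c hN) i (smulForm (koszulAug c hN) φ) = 0 := by
  ext a p
  rw [delta_smulForm _ (koszulAug_smul c hN), h, smul_zero]
  rfl

include hK in
/-- Coboundaries vanish on the Koszul complex. -/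
lemma evalWord_barDifferential {i : ℕ} {w : (Fin (koszulDegree N (i + 1)) → Fin n) → k}
    (hw : w ∈ koszulSpace c (koszulDegree N (i + 1)))
    {θ : MultilinearMap k (fun _ : Fin (i + 1) => SuperpotentialAlgebra c) M}
    {ψ : MultilinearMap k (fun _ : Fin i => SuperpotentialAlgebra c) M}
    (h : ∀ a, θ a = barDifferential (augmentation c hN) ψ a) : evalWord c w θ = 0 := by
  have e : smulForm (koszulAug c hN) θ =
      delta (augmentation c hN) i (smulForm (koszulAug c hN) ψ) := by
    ext a p
    rw [delta_smulForm _ (koszulAug_smul c hN), smulForm_apply, h]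
  rw [← evalAt_smulForm c hN θ, ← evalWord_eq_zero_iff c hN hK hw, e,
    MinimalComplex.transferAll_delta _ _ _ _ _ (res_smulForm c hN hK ψ)]
  rfl

include hK in
/-- There is a cocycle that does not vanish on a given nonzero element of `W`. -/
lemma exists_cocycle_evalWord_ne_zero {i : ℕ} {w : (Fin (koszulDegree N i) → Fin n) → k}
    (hw : w ∈ koszulSpace c (koszulDegree N i)) (hw0 : w ≠ 0) :
    ∃ φ : MultilinearMap k (fun _ : Fin i => SuperpotentialAlgebra c) k,
      IsBarCocycle (augmentation c hN) φ ∧ evalWord c w φ ≠ 0 := by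
  obtain ⟨f, hf⟩ : ∃ f : Module.Dual k _, f w ≠ 0 := by
    by_contra! h
    exact hw0 ((Module.forall_dual_apply_eq_zero_iff k w).1 h)
  -- The form `f`, seen on the `i`-th Koszul term. It is reached by dimension shifting from a bar
  -- cocycle, whose value on `w` is then `f w` up to a nonzero scalar.
  let lam : BarCochain k (SuperpotentialAlgebra c) (koszulTerm c i) k 0 :=
    MultilinearMap.constOfIsEmpty k _ (extendForm c hN f)
  obtain ⟨φ, h1, h2, h3⟩ := (koszulComplex c hN hK).exists_transferAll_eq i 0 i (zero_add i)
    (lam := lam) (by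
      ext a p
      rw [delta_apply, sigma_apply]
      simp [lam, extendForm_smul]) (by
      ext a p
      exact (koszulComplex c hN hK).apply_d_eq_zero (extendForm_smul c hN f) p)
  refine ⟨evalAt (koszulOne c hN) φ, fun a => ?_, fun h => ?_⟩
  · rw [barDifferential_evalAt _ _ _ (apply_smul_of_res_eq_zero c hN hK h2), h1]
    rfl
  · rw [← evalWord_eq_zero_iff c hN hK hw, h3] at h
    exact hf ((extendForm_scalarArray c hN f hw).symm.trans h)

include hK in
/-- A cocycle that vanishes on the Koszul complex is a coboundary. -/
lemma exists_barDifferential_eq {i : ℕ} {w : (Fin (koszulDegree N (i + 1)) → Fin n) → k}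
    (hw : w ∈ koszulSpace c (koszulDegree N (i + 1)))
    (h1 : ∀ w' ∈ koszulSpace c (koszulDegree N (i + 1)), ∃ t : k, w' = t • w)
    {θ : MultilinearMap k (fun _ : Fin (i + 1) => SuperpotentialAlgebra c) M}
    (hθ : ∀ a, barDifferential (augmentation c hN) θ a = 0) (h0 : evalWord c w θ = 0) :
    ∃ ψ : MultilinearMap k (fun _ : Fin i => SuperpotentialAlgebra c) M,
      ∀ a, θ a = barDifferential (augmentation c hN) ψ a := by
  have hδ := delta_smulForm_eq_zero c hN hθ
  have hr := res_smulForm c hN hK θ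
  have h0' : (koszulComplex c hN hK).transferAll (i + 1) 0 (i + 1) (zero_add _)
      (smulForm (koszulAug c hN) θ) = 0 := by
    have hd := (koszulComplex c hN hK).delta_transferAll (i + 1) 0 (i + 1) (zero_add _) hδ hr
    set lam := (koszulComplex c hN hK).transferAll (i + 1) 0 (i + 1) (zero_add _)
      (smulForm (koszulAug c hN) θ) with hlam
    refine ext_zero fun p => ?_
    obtain ⟨p, hp⟩ := p
    -- The cocycle condition in degree zero is semilinearity over the augmentation.
    have hs : ∀ z (p : koszulTerm c (i + 1)),
        lam Fin.elim0 (z • p) = augmentation c hN z • lam Fin.elim0 p := by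
      intro z p
      have e := congrArg (fun φ => φ (fun _ => z) p) hd
      simp only [delta_apply, sigma_apply] at e
      simp only [Finset.univ_eq_empty, Finset.sum_empty, zero_add, pow_one, neg_smul, one_smul] at e
      have e' := sub_eq_zero.1 ((sub_eq_add_neg _ _).trans e)
      rw [Subsingleton.elim (Fin.tail _) Fin.elim0, Subsingleton.elim (Fin.init _) Fin.elim0] at e'
      exact e'.symm
    -- By semilinearity it is enough to look at `W`, which is spanned by `w`. The membership proof
    -- is part of the claim so that span induction applies.
    have key : ∀ q ∈ koszulModule c (koszulDegree N (i + 1)),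
        ∃ h : q ∈ koszulModule c (koszulDegree N (i + 1)), lam Fin.elim0 ⟨q, h⟩ = 0 := by
      intro q hq
      rw [koszulModule_eq_span] at hq
      induction hq using Submodule.span_induction with
      | mem q hq =>
        obtain ⟨w', hw', rfl⟩ := hq
        obtain ⟨t, rfl⟩ := h1 w' hw'
        refine ⟨scalarArray_mem hw', ?_⟩
        have e : (⟨scalarArray c _ (t • w), scalarArray_mem hw'⟩ :
            koszulTerm c (i + 1)) = t • ⟨scalarArray c _ w, scalarArray_mem hw⟩ :=
          Subtype.ext (map_smul _ _ _)
        rw [e, map_smul, hlam, (evalWord_eq_zero_iff c hN hK hw _).2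
          (by rw [evalAt_smulForm, h0]), smul_zero]
      | zero => exact ⟨zero_mem _, map_zero _⟩
      | add q q' _ _ hq hq' =>
        obtain ⟨h, e⟩ := hq
        obtain ⟨h', e'⟩ := hq'
        refine ⟨add_mem h h', ?_⟩
        have := map_add (lam Fin.elim0) ⟨q, h⟩ ⟨q', h'⟩
        rw [e, e', add_zero] at this
        exact this
      | smul z q _ hq =>
        obtain ⟨h, e⟩ := hq
        refine ⟨Submodule.smul_mem _ _ h, ?_⟩
        have := hs z ⟨q, h⟩
        rw [e, smul_zero] at this
        exact this
    exact (key p hp).2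
  obtain ⟨χ, h2, h3⟩ := (koszulComplex c hN hK).exists_delta_eq i 0 (i + 1) (zero_add _) hδ hr h0'
  refine ⟨evalAt (koszulOne c hN) χ, fun a => ?_⟩
  rw [barDifferential_evalAt _ _ _ (apply_smul_of_res_eq_zero c hN hK h2), h3,
    smulForm_apply, koszulAug_one, one_smul]

end SuperpotentialAlgebra
end PreregularPair

namespace PreregularPair

/-! ## Cochains twisted by a coaction -/

section twist
open BarCochain
variable {k : Type u} [Field k] {A : Type v} [Ring A] [Algebra k A] {K : Type w} [Ring K]
  [Algebra k K]

lemma multilinear_ext_tmul {M : Type*} [AddCommGroup M] [Module k M] {i : ℕ}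
    {f g : MultilinearMap k (fun _ : Fin i => K ⊗[k] A) M}
    (h : ∀ (κ : Fin i → K) (b : Fin i → A),
      f (fun p => κ p ⊗ₜ b p) = g (fun p => κ p ⊗ₜ b p)) : f = g := by
  induction i with
  | zero =>
    ext y
    rw [Subsingleton.elim y fun p => (Fin.elim0 p : K) ⊗ₜ (Fin.elim0 p : A)]
    exact h _ _
  | succ i ih =>
    have key : f.curryLeft = g.curryLeft := by
      ext κ b : 3
      refine ih fun κ' b' => ?_
      have := h (Fin.cons κ κ') (Fin.cons b b')
      have e : (fun p => (Fin.cons κ κ' : Fin (i + 1) → K) p ⊗ₜ[k] (Fin.cons b b' : Fin (i + 1) → A) p)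
          = (Fin.cons (κ ⊗ₜ b) fun p => κ' p ⊗ₜ b' p : Fin (i + 1) → K ⊗[k] A) := by
        funext p
        refine Fin.cases ?_ (fun p => ?_) p <;> rfl
      rw [e] at this
      exact this
    ext y
    rw [← Fin.cons_self_tail y]
    exact congrArg (fun F => F (y 0) (Fin.tail y)) key

lemma prod_ofFn_contractNth {i : ℕ} (κ : Fin (i + 1) → K) (j : Fin i) :
    (List.ofFn (Fin.contractNth j.castSucc (· * ·) κ)).prod = (List.ofFn κ).prod := by
  induction i with
  | zero => exact j.elim0
  | succ i ih =>
    refine Fin.cases ?_ (fun j => ?_) j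
    · rw [contractNth_zero_cons]
      simp [List.ofFn_succ, Fin.tail, mul_assoc]
    · rw [contractNth_succ_cons]
      simp only [List.ofFn_succ, List.prod_cons, Fin.cons_zero, Fin.cons_succ]
      have := ih (Fin.tail κ) j
      simp only [List.ofFn_succ, List.prod_cons] at this
      rw [this]
      rfl

lemma cochainForm_tprod {i : ℕ} (φ : MultilinearMap k (fun _ : Fin i => A) k) (b : Fin i → A) :
    cochainForm φ (TensorAlgebra.tprod k A i b) = φ b := by
  simp only [cochainForm, LinearMap.comp_apply, AlgHom.toLinearMap_apply,
    TensorAlgebra.toDirectSum_tensorPower_tprod]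
  rw [← DirectSum.lof_eq_of k, DirectSum.component.lof_self, PiTensorProduct.lift.tprod]

/-- The extension `(κ₁ ⊗ b₁, …, κ_i ⊗ b_i) ↦ φ(b₁, …, b_i) κ₁ ⋯ κ_i` of a cochain. -/
noncomputable def extendCochain (K : Type w) [Ring K] [Algebra k K] {i : ℕ}
    (φ : MultilinearMap k (fun _ : Fin i => A) k) :
    MultilinearMap k (fun _ : Fin i => K ⊗[k] A) K :=
  ((TensorProduct.rid k K).toLinearMap ∘ₗ (cochainForm φ).lTensor K).compMultilinearMap
    ((MultilinearMap.mkPiAlgebraFin k i (K ⊗[k] TensorAlgebra k A)).compLinearMap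
      fun _ => (TensorAlgebra.ι k).lTensor K)

lemma prod_ofFn_tmul {B : Type*} [Ring B] [Algebra k B] {i : ℕ} (κ : Fin i → K) (b : Fin i → B) :
    (List.ofFn fun p => κ p ⊗ₜ[k] b p).prod = (List.ofFn κ).prod ⊗ₜ[k] (List.ofFn b).prod := by
  induction i with
  | zero => simp [Algebra.TensorProduct.one_def]
  | succ i ih => simp [List.ofFn_succ, ih]

lemma extendCochain_tmul {i : ℕ} (φ : MultilinearMap k (fun _ : Fin i => A) k) (κ : Fin i → K)
    (b : Fin i → A) :
    extendCochain K φ (fun p => κ p ⊗ₜ b p) = φ b • (List.ofFn κ).prod := by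
  simp only [extendCochain, LinearMap.compMultilinearMap_apply, MultilinearMap.compLinearMap_apply,
    MultilinearMap.mkPiAlgebraFin_apply, LinearMap.lTensor_tmul, prod_ofFn_tmul,
    LinearMap.comp_apply, ← TensorAlgebra.tprod_apply, cochainForm_tprod]
  simp

lemma extendCochain_cons {i : ℕ} (φ : MultilinearMap k (fun _ : Fin (i + 1) => A) k) (κ : K)
    (b : A) (y : Fin i → K ⊗[k] A) :
    extendCochain K φ (Fin.cons (κ ⊗ₜ b) y) = κ * extendCochain K (φ.curryLeft b) y := by
  have key : (extendCochain K φ).curryLeft (κ ⊗ₜ b) =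
      (LinearMap.mulLeft k κ).compMultilinearMap (extendCochain K (φ.curryLeft b)) := by
    refine multilinear_ext_tmul fun κ' b' => ?_
    rw [LinearMap.compMultilinearMap_apply, extendCochain_tmul, MultilinearMap.curryLeft_apply,
      MultilinearMap.curryLeft_apply, LinearMap.mulLeft_apply]
    have e : (Fin.cons (κ ⊗ₜ b) fun p => κ' p ⊗ₜ b' p : Fin (i + 1) → K ⊗[k] A) =
        fun p => (Fin.cons κ κ' : Fin (i + 1) → K) p ⊗ₜ[k] (Fin.cons b b' : Fin (i + 1) → A) p := by
      funext p
      refine Fin.cases ?_ (fun p => ?_) p <;> rfl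
    rw [e, extendCochain_tmul]
    simp [List.ofFn_succ]
  exact congrArg (fun F => F y) key

lemma extendCochain_zero (φ : MultilinearMap k (fun _ : Fin 0 => A) k) (y : Fin 0 → K ⊗[k] A) :
    extendCochain K φ y = φ Fin.elim0 • 1 := by
  have := extendCochain_tmul φ (Fin.elim0 : Fin 0 → K) Fin.elim0
  rw [Subsingleton.elim y fun p => (Fin.elim0 p : K) ⊗ₜ (Fin.elim0 p : A), this]
  simp

/-- The extension of an augmentation of `A` to `K ⊗ A`. -/
noncomputable def extendAug (K : Type w) [Ring K] [Algebra k K] (ε : A →ₐ[k] k) :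
    K ⊗[k] A →ₐ[k] K :=
  (Algebra.TensorProduct.rid k k K).toAlgHom.comp (Algebra.TensorProduct.map (AlgHom.id k K) ε)

lemma extendAug_tmul (ε : A →ₐ[k] k) (κ : K) (b : A) : extendAug K ε (κ ⊗ₜ b) = ε b • κ := by
  simp [extendAug]

/-- The extension of a cocycle satisfies the cocycle identity over `K`. -/
lemma extendCochain_cocycle (ε : A →ₐ[k] k) {i : ℕ} {φ : MultilinearMap k (fun _ : Fin i => A) k}
    (hφ : IsBarCocycle ε φ) (y : Fin (i + 1) → K ⊗[k] A) :
    extendAug K ε (y 0) * extendCochain K φ (Fin.tail y)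
      + ∑ j : Fin i, (-1 : k) ^ (j.val + 1) •
          extendCochain K φ (Fin.contractNth j.castSucc (· * ·) y)
      + (-1 : k) ^ (i + 1) • (extendCochain K φ (Fin.init y) * extendAug K ε (y (Fin.last i)))
      = 0 := by
  -- `K` need not be commutative, so the outer terms are products in `K` on a prescribed side. With
  -- the right-hand factor as an extra variable, set to `1`, the middle and last terms form `sigma i
  -- T`, and `L` supplies the first. The sum is multilinear, so pure tensors suffice.
  let T : BarCochain k (K ⊗[k] A) (K ⊗[k] A) K i :=
    ((LinearMap.lcomp k K (extendAug K ε).toLinearMap) ∘ₗ LinearMap.mul k K).compMultilinearMap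
      (extendCochain K φ)
  let L : (K ⊗[k] A) →ₗ[k] MultilinearMap k (fun _ : Fin i => K ⊗[k] A) K :=
    { toFun := fun z => (LinearMap.mulLeft k (extendAug K ε z)).compMultilinearMap
        (extendCochain K φ)
      map_add' := fun z z' => by ext; simp [add_mul]
      map_smul' := fun t z => by ext; simp }
  have hT : ∀ y z, T y z = extendCochain K φ y * extendAug K ε z := fun y z => rfl
  have key : L.uncurryLeft + evalAt (1 : K ⊗[k] A) (sigma i T) = 0 := by
    refine multilinear_ext_tmul fun κ b => ?_
    have h := congrArg (· • (List.ofFn κ).prod) (hφ b)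
    simp only [barDifferential, zero_smul, add_smul, Finset.sum_smul] at h
    refine Eq.trans ?_ h
    have hc : ∀ j : Fin i, Fin.contractNth j.castSucc (· * ·) (fun p => κ p ⊗ₜ[k] b p) =
        fun p => Fin.contractNth j.castSucc (· * ·) κ p ⊗ₜ[k]
          Fin.contractNth j.castSucc (· * ·) b p := by
      intro j
      funext p
      simp only [Fin.contractNth]
      split_ifs <;> simp
    have h1 : (List.ofFn κ).prod = κ 0 * (List.ofFn (Fin.tail κ)).prod := by
      rw [List.ofFn_succ, List.prod_cons]; rfl
    have h2 : (List.ofFn κ).prod = (List.ofFn (Fin.init κ)).prod * κ (Fin.last i) := by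
      rw [List.ofFn_succ', List.concat_eq_append, List.prod_append, List.prod_singleton]; rfl
    have ht : extendCochain K φ (Fin.tail fun p => κ p ⊗ₜ b p) =
        φ (Fin.tail b) • (List.ofFn (Fin.tail κ)).prod := extendCochain_tmul φ _ _
    have hi : extendCochain K φ (Fin.init fun p => κ p ⊗ₜ b p) =
        φ (Fin.init b) • (List.ofFn (Fin.init κ)).prod := extendCochain_tmul φ _ _
    rw [add_assoc, add_apply, evalAt_apply, sigma_apply]
    congr 1
    · rw [LinearMap.uncurryLeft_apply]
      change extendAug K ε (κ 0 ⊗ₜ b 0) * extendCochain K φ (Fin.tail fun p => κ p ⊗ₜ[k] b p) = _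
      rw [ht, extendAug_tmul, smul_mul_smul_comm, ← h1, smul_eq_mul]
    · congr 1
      · refine Finset.sum_congr rfl fun j _ => ?_
        rw [hT, map_one, mul_one, hc, extendCochain_tmul, prod_ofFn_contractNth, smul_smul,
          smul_eq_mul]
      · rw [hT, smul_eq_mul, mul_one, hi, extendAug_tmul, smul_mul_smul_comm, ← h2, smul_smul,
          smul_eq_mul, smul_eq_mul, mul_comm (φ _)]
  have := congrArg (fun F => F y) key
  rw [add_apply, evalAt_apply, sigma_apply, LinearMap.uncurryLeft_apply,
    ← add_assoc] at this
  refine Eq.trans ?_ this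
  congr 1
  · congr 1
    exact Finset.sum_congr rfl fun j _ => by rw [hT, map_one, mul_one]
  · rw [hT, smul_eq_mul, mul_one]

end twist

section twistHopf
variable {k : Type u} [Field k] {A : Type v} [Ring A] [Algebra k A] {K : Type w} [Ring K]
  [HopfAlgebra k K]

/-- The twist of a cochain as a multilinear map. -/
noncomputable def twistCochain (ρ : A →ₐ[k] K ⊗[k] A) {i : ℕ}
    (φ : MultilinearMap k (fun _ : Fin i => A) k) : MultilinearMap k (fun _ : Fin i => A) K :=
  (extendCochain K φ).compLinearMap fun _ => ρ.toLinearMap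

lemma twistCochain_apply (ρ : A →ₐ[k] K ⊗[k] A) {i : ℕ}
    (φ : MultilinearMap k (fun _ : Fin i => A) k) (a : Fin i → A) :
    twistCochain ρ φ a = extendCochain K φ fun p => ρ (a p) := rfl

lemma leftTwist_eq (ρ : A →ₐ[k] K ⊗[k] A) {i : ℕ}
    (φ : MultilinearMap k (fun _ : Fin i => A) k) : leftTwist ρ φ = twistCochain ρ φ := by
  funext a
  rw [leftTwist, TensorAlgebra.tprod_apply, map_list_prod, List.map_ofFn, twistCochain_apply,
    extendCochain]
  simp [Function.comp_def]

/-- Exchanging the tensor factors turns `ρ` into an algebra map `A → K ⊗ A`. It need not be a left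
coaction, but the arguments on cochains use coassociativity nowhere, so one treatment covers both
sides. -/
lemma rightTwist_eq (ρ : A →ₐ[k] A ⊗[k] K) {i : ℕ}
    (φ : MultilinearMap k (fun _ : Fin i => A) k) :
    rightTwist ρ φ = twistCochain ((Algebra.TensorProduct.comm k A K).toAlgHom.comp ρ) φ := by
  funext a
  have h1 : ∀ z : TensorAlgebra k A ⊗[k] K, TensorProduct.lid k K ((cochainForm φ).rTensor K z) =
      TensorProduct.rid k K ((cochainForm φ).lTensor K
        (Algebra.TensorProduct.comm k (TensorAlgebra k A) K z)) := fun z => by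
    induction z using TensorProduct.induction_on with
    | zero => simp
    | tmul x y => simp
    | add x y hx hy => simp only [map_add, hx, hy]
  have h2 : ∀ z : A ⊗[k] K, Algebra.TensorProduct.comm k (TensorAlgebra k A) K
      ((TensorAlgebra.ι k).rTensor K z) =
      (TensorAlgebra.ι k).lTensor K (Algebra.TensorProduct.comm k A K z) := fun z => by
    induction z using TensorProduct.induction_on with
    | zero => simp
    | tmul x y => simp
    | add x y hx hy => simp only [map_add, hx, hy]
  rw [rightTwist, TensorAlgebra.tprod_apply, map_list_prod, List.map_ofFn, h1, map_list_prod,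
    List.map_ofFn, twistCochain_apply, extendCochain]
  simp [Function.comp_def, h2]

/-- The cocycle identity over `K ⊗ A` is applied to the elements `ρ (a p)`: `ρ` respects products,
and `hρ` makes the outer factors scalars. -/
lemma barDifferential_twistCochain {ε : A →ₐ[k] k} {ρ : A →ₐ[k] K ⊗[k] A}
    (hρ : ∀ x, extendAug K ε (ρ x) = algebraMap k K (ε x)) {i : ℕ}
    {φ : MultilinearMap k (fun _ : Fin i => A) k} (hφ : IsBarCocycle ε φ) (a : Fin (i + 1) → A) :
    barDifferential ε (twistCochain ρ φ) a = 0 := by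
  refine Eq.trans ?_ (extendCochain_cocycle ε hφ fun p => ρ (a p))
  rw [barDifferential]
  congr 1
  · congr 1
    · rw [hρ, Algebra.smul_def]; rfl
    · refine Finset.sum_congr rfl fun j _ => ?_
      rw [twistCochain_apply]
      congr 2
      funext p
      simp only [Fin.contractNth]
      split_ifs <;> simp
  · rw [hρ, ← Algebra.commutes, ← Algebra.smul_def]; rfl

end twistHopf

/-! ### Twisted cochains on the Koszul complex. -/

namespace SuperpotentialAlgebra
variable {k : Type u} [Field k] {r N n : ℕ} (c : (Fin (r + N) → Fin n) → k)
  {K : Type w} [Ring K] [HopfAlgebra k K] {ρ : SuperpotentialAlgebra c →ₐ[k] K ⊗[k]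
    SuperpotentialAlgebra c} {a : Fin n → Fin n → K} (hρ : ∀ i, ρ (x c i) = ∑ j, a i j ⊗ₜ[k] x c j)
  (hN : 2 ≤ N) (hK : IsNKoszul c)

include hρ in
lemma extendAug_coaction (z : SuperpotentialAlgebra c) :
    extendAug K (augmentation c hN) (ρ z) = algebraMap k K (augmentation c hN z) := by
  have : (extendAug K (augmentation c hN)).comp ρ =
      (Algebra.ofId k K).comp (augmentation c hN) := by
    refine hom_ext fun i => ?_
    simp [hρ, extendAug_tmul, augmentation_x]
  exact DFunLike.congr_fun this z

-- The matrix entries appear in the order of the letters, block after block, so they assemble to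
-- `wordProd a v v'`.
include hρ in
lemma extendCochain_blocks {i : ℕ}
    (φ : MultilinearMap k (fun _ : Fin i => SuperpotentialAlgebra c) k)
    (v : Fin (koszulDegree N i) → Fin n) :
    extendCochain K φ (blocks N (fun l => ρ (x c l)) i v) =
      ∑ v', φ (blocks N (x c) i v') • wordProd a v v' := by
  induction i with
  | zero =>
    rw [extendCochain_zero]
    refine Eq.symm ((Fintype.sum_unique (ι := Fin 0 → Fin n) fun v' =>
      φ (blocks N (x c) 0 v') • wordProd a (m := 0) v v').trans ?_)
    simp [wordProd]
    rfl
  | succ i ih =>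
    obtain ⟨⟨α, β⟩, rfl⟩ := (Fin.appendEquiv (koszulStep N i) (koszulDegree N i)).surjective v
    change extendCochain K φ (blocks N _ (i + 1) (Fin.append α β)) = _
    rw [blocks_append]
    refine Eq.trans ?_ (Eq.symm ((sum_word_append (s := koszulStep N i)
      (t := koszulDegree N i) _)))
    simp only [hρ]
    rw [letterProd_left_matrix]
    have e : ∀ z y, extendCochain K φ (Fin.cons z y) = (extendCochain K φ).curryLeft z y :=
      fun _ _ => rfl
    rw [e, map_sum, sum_apply]
    refine Finset.sum_congr rfl fun α' _ => ?_
    rw [← e, extendCochain_cons]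
    simp only [← hρ]
    rw [ih, Finset.mul_sum]
    refine Finset.sum_congr rfl fun β' _ => ?_
    rw [mul_smul_comm, ← wordProd_append, blocks_append]
    rfl

lemma map_blocks {H H' F : Type*} [Monoid H] [Monoid H'] [FunLike F H H']
    [MonoidHomClass F H H'] (φ : F) (y : Fin n → H) (i : ℕ) (v : Fin (koszulDegree N i) → Fin n)
    (p : Fin i) : φ (blocks N y i v p) = blocks N (fun l => φ (y l)) i v p := by
  induction i with
  | zero => exact p.elim0
  | succ i ih =>
    refine Fin.cases ?_ (fun p => ?_) p
    · exact map_letterProd φ y _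
    · exact ih _ p

-- Evaluation moves the matrix from `φ` to `w`, on which it acts through the multiplier.
include hρ in
lemma evalWord_twistCochain {i : ℕ} {w : (Fin (koszulDegree N i) → Fin n) → k} {D : K}
    (hD : ∀ j, ∑ i, w i • wordProd a i j = w j • D)
    (φ : MultilinearMap k (fun _ : Fin i => SuperpotentialAlgebra c) k) :
    evalWord c w (twistCochain ρ φ) = evalWord c w φ • D := by
  have h : ∀ v, twistCochain ρ φ (blocks N (x c) i v) =
      ∑ v', φ (blocks N (x c) i v') • wordProd a v v' := fun v => by
    rw [← extendCochain_blocks c hρ, twistCochain_apply]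
    simp only [map_blocks]
  simp only [evalWord, h, Finset.smul_sum, Finset.sum_smul]
  rw [Finset.sum_comm]
  refine Finset.sum_congr rfl fun v' _ => ?_
  rw [smul_eq_mul, mul_comm, mul_smul, ← hD, Finset.smul_sum]
  exact Finset.sum_congr rfl fun v _ => smul_comm _ _ _

include hρ hK in
/-- The homological codeterminant is the multiplier of the top term of the Koszul complex. -/
theorem isBarCoboundary_twistCochain_iff {d : ℕ}
    {w : (Fin (koszulDegree N (d + 1)) → Fin n) → k}
    (hw : w ∈ koszulSpace c (koszulDegree N (d + 1))) (hw0 : w ≠ 0)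
    (h1 : ∀ w' ∈ koszulSpace c (koszulDegree N (d + 1)), ∃ t : k, w' = t • w) {D : K}
    (hD : ∀ j, ∑ i, w i • wordProd a i j = w j • D) (D₀ : K) :
    (∀ φ : MultilinearMap k (fun _ : Fin (d + 1) => SuperpotentialAlgebra c) k,
      IsBarCocycle (augmentation c hN) φ → IsBarCoboundary (augmentation c hN) (d + 1)
        fun a => twistCochain ρ φ a - φ a • D₀) ↔ D₀ = D := by
  let θ (φ : MultilinearMap k (fun _ : Fin (d + 1) => SuperpotentialAlgebra c) k) :
      MultilinearMap k (fun _ : Fin (d + 1) => SuperpotentialAlgebra c) K :=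
    twistCochain ρ φ - (LinearMap.toSpanSingleton k K D₀).compMultilinearMap φ
  have hθ : ∀ φ b, θ φ b = twistCochain ρ φ b - φ b • D₀ := fun _ _ => rfl
  have hev : ∀ φ, evalWord c w (θ φ) = evalWord c w φ • (D - D₀) := fun φ => by
    rw [smul_sub, ← evalWord_twistCochain c hρ hD]
    simp only [evalWord, hθ, smul_sub, Finset.sum_sub_distrib, Finset.sum_smul, smul_eq_mul,
      mul_smul]
  constructor
  · intro h
    -- Coboundaries vanish on `w`, so a cocycle with nonzero value there detects `D - D₀`.
    obtain ⟨φ, hφ, hne⟩ := exists_cocycle_evalWord_ne_zero c hN hK hw hw0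
    obtain ⟨ψ, hψ⟩ := h φ hφ
    have := evalWord_barDifferential c hN hK hw (θ := θ φ) hψ
    rw [hev, smul_eq_zero, or_iff_right hne, sub_eq_zero] at this
    exact this.symm
  · rintro rfl φ hφ
    -- For `D₀ = D` the difference is a cocycle that vanishes on `w`, hence a coboundary.
    refine exists_barDifferential_eq c hN hK hw h1 (θ := θ φ) (fun b => ?_)
      (by rw [hev, sub_self, smul_zero])
    have e1 := barDifferential_twistCochain (extendAug_coaction c hρ hN) hφ b
    have e2 : barDifferential (augmentation c hN) (θ φ) b =
        barDifferential (augmentation c hN) (twistCochain ρ φ) b -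
          barDifferential (augmentation c hN) φ b • D₀ := by
      simp only [barDifferential, hθ, smul_sub, Finset.sum_sub_distrib, add_smul, Finset.sum_smul,
        smul_assoc]
      abel
    rw [e2, e1, hφ, zero_smul, sub_zero]

end SuperpotentialAlgebra
end PreregularPair

namespace PreregularPair

/-! ## Coactions given by multiplicative matrices -/

lemma wordProd_sum_tmul {k : Type u} [Field k] {H : Type w} [Ring H] [Algebra k H] {m n : ℕ}
    (a b : Fin n → Fin n → H) (i j : Fin m → Fin n) :
    wordProd (fun x y => ∑ l, a x l ⊗ₜ[k] b l y) i j
      = ∑ l : Fin m → Fin n, wordProd a i l ⊗ₜ[k] wordProd b l j := by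
  induction m with
  | zero => simp [wordProd, Algebra.TensorProduct.one_def]
  | succ m ih =>
    rw [wordProd_succ, ih, sum_word_cons, Finset.sum_mul_sum]
    simp only [wordProd_succ, Fin.cons_zero, Fin.tail_cons, Algebra.TensorProduct.tmul_mul_tmul]

/-- A multiplicative matrix over a coalgebra: `Δ(a_{ij}) = ∑ a_{il} ⊗ a_{lj}` and
`ε(a_{ij}) = δ_{ij}`. -/
structure IsMultiplicative (k : Type u) [Field k] {n : ℕ} {K : Type w} [Ring K] [HopfAlgebra k K]
    (a : Fin n → Fin n → K) : Prop where
  comul : ∀ i j, Bialgebra.comulAlgHom k K (a i j) = ∑ l, a i l ⊗ₜ[k] a l j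
  counit : ∀ i j, Bialgebra.counitAlgHom k K (a i j) = if i = j then 1 else 0

namespace IsMultiplicative
open SuperpotentialAlgebra
variable {k : Type u} [Field k] {n : ℕ} {K : Type w} [Ring K] [HopfAlgebra k K]
  {a : Fin n → Fin n → K} (ha : IsMultiplicative k a)

include ha

lemma mul_antipode (i j : Fin n) :
    ∑ l, a i l * HopfAlgebra.antipode k (a l j) = if i = j then 1 else 0 := by
  have h := HopfAlgebra.mul_antipode_lTensor_comul_apply (R := k) (a i j)
  have h1 : Coalgebra.comul (R := k) (a i j) = ∑ l, a i l ⊗ₜ[k] a l j := ha.comul i j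
  have h2 : Coalgebra.counit (R := k) (a i j) = if i = j then 1 else 0 := ha.counit i j
  rw [h1, h2] at h
  simpa [apply_ite (algebraMap k K)] using h

lemma antipode_mul (i j : Fin n) :
    ∑ l, HopfAlgebra.antipode k (a i l) * a l j = if i = j then 1 else 0 := by
  have h := HopfAlgebra.mul_antipode_rTensor_comul_apply (R := k) (a i j)
  have h1 : Coalgebra.comul (R := k) (a i j) = ∑ l, a i l ⊗ₜ[k] a l j := ha.comul i j
  have h2 : Coalgebra.counit (R := k) (a i j) = if i = j then 1 else 0 := ha.counit i j
  rw [h1, h2] at h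
  simpa [apply_ite (algebraMap k K)] using h

lemma comul_wordProd {m : ℕ} (i j : Fin m → Fin n) :
    Bialgebra.comulAlgHom k K (wordProd a i j) = ∑ l, wordProd a i l ⊗ₜ[k] wordProd a l j := by
  rw [← wordProd_sum_tmul, wordProd, wordProd, map_list_prod, List.map_ofFn]
  simp only [Function.comp_def, ha.comul]

lemma counit_wordProd {m : ℕ} (i j : Fin m → Fin n) :
    Bialgebra.counitAlgHom k K (wordProd a i j) = if i = j then 1 else 0 := by
  rw [← wordProd_delta, wordProd, wordProd, map_list_prod, List.map_ofFn]
  simp only [Function.comp_def, ha.counit]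

/-- The multiplier of a semi-invariant form is grouplike. -/
lemma isGroupLikeElem_left {m : ℕ} {c : (Fin m → Fin n) → k} (hc : c ≠ 0) {D : K}
    (hD : ∀ j, ∑ i, c i • wordProd a i j = c j • D) : IsGroupLikeElem k D := by
  obtain ⟨j, hj⟩ := Function.ne_iff.1 hc
  have hj : c j ≠ 0 := hj
  constructor
  · have h := congrArg (Bialgebra.counitAlgHom k K) (hD j)
    simp only [map_sum, map_smul, ha.counit_wordProd] at h
    simp only [smul_eq_mul, mul_ite, mul_one, mul_zero, Finset.sum_ite_eq', Finset.mem_univ,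
      if_true] at h
    exact (mul_left_cancel₀ hj (h.symm.trans (mul_one _).symm))
  -- Applying `hD` in each tensor factor turns the coproduct of the left side into `c j • D ⊗ D`.
  · have h := congrArg (Bialgebra.comulAlgHom k K) (hD j)
    simp only [map_sum, map_smul, ha.comul_wordProd, Finset.smul_sum] at h
    rw [Finset.sum_comm] at h
    simp only [TensorProduct.smul_tmul', ← TensorProduct.sum_tmul, hD] at h
    simp only [TensorProduct.smul_tmul, ← TensorProduct.tmul_sum, hD] at h
    rw [TensorProduct.tmul_smul] at h
    exact (smul_right_injective _ hj h).symm

/-- The multiplier of a semi-invariant form is grouplike. -/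
lemma isGroupLikeElem_right {m : ℕ} {c : (Fin m → Fin n) → k} (hc : c ≠ 0) {D : K}
    (hD : ∀ j, ∑ i, c i • wordProd a j i = c j • D) : IsGroupLikeElem k D := by
  obtain ⟨j, hj⟩ := Function.ne_iff.1 hc
  have hj : c j ≠ 0 := hj
  constructor
  · have h := congrArg (Bialgebra.counitAlgHom k K) (hD j)
    simp only [map_sum, map_smul, ha.counit_wordProd] at h
    simp only [smul_eq_mul, mul_ite, mul_one, mul_zero, Finset.sum_ite_eq, Finset.mem_univ,
      if_true] at h
    exact (mul_left_cancel₀ hj (h.symm.trans (mul_one _).symm))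
  · have h := congrArg (Bialgebra.comulAlgHom k K) (hD j)
    simp only [map_sum, map_smul, ha.comul_wordProd, Finset.smul_sum] at h
    rw [Finset.sum_comm] at h
    simp only [← TensorProduct.tmul_smul, ← TensorProduct.tmul_sum, hD] at h
    simp only [← TensorProduct.smul_tmul, ← TensorProduct.sum_tmul, hD] at h
    rw [← TensorProduct.smul_tmul'] at h
    exact (smul_right_injective _ hj h).symm

/-! ### Coactions from semi-invariant forms. -/

section coactions
variable {r N : ℕ} {c : (Fin (r + N) → Fin n) → k}

omit ha in
lemma sum_letterProd_front (hc : IsTwistedCyclic c) (p : Fin r → Fin n) :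
    ∑ j : Fin N → Fin n, c (Fin.append j p ∘ Fin.cast (Nat.add_comm r N)) •
      letterProd (x c) j = 0 := by
  refine sum_letterProd_eq_zero c ?_
  convert hc.slice_mem r 0 (by omega) Fin.elim0 p using 1
  funext j
  simp only [slice]
  congr 1
  have e : ∀ {l l' : ℕ} (h : l = l') (y : Fin l' → Fin n) (i : Fin (l + r)),
      Fin.append (y ∘ Fin.cast h) p i = Fin.append y p (Fin.cast (by omega) i) := by
    rintro l _ rfl y i; rfl
  funext i
  rw [Fin.append_left_nil _ _ rfl]
  simp only [Function.comp_apply, e]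
  rfl

/-- A semi-invariant twisted cyclic form gives a left coaction. -/
lemma exists_left (hc : IsTwistedCyclic c) {D : K}
    (hD : ∀ j, ∑ i, c i • wordProd a i j = c j • D) :
    ∃ ρ : SuperpotentialAlgebra c →ₐ[k] K ⊗[k] SuperpotentialAlgebra c,
      (∀ i, ρ (x c i) = ∑ j, a i j ⊗ₜ[k] x c j) ∧ IsLeftCoaction ρ := by
  let s (i j : Fin n) : K := HopfAlgebra.antipode k (a i j)
  let Q {m : ℕ} (i j : Fin m → Fin n) : K :=
    MulOpposite.unop (wordProd (fun x y => MulOpposite.op (s x y)) i j)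
  have hQ : ∀ {m : ℕ} (i j : Fin m → Fin n), ∑ l, wordProd a i l * Q l j = if i = j then 1 else 0 :=
    fun i j => sum_wordProd_mul_op a s ha.mul_antipode i j
  -- `Q` cancels the matrix from the right, so it reaches the last letters of a word: the `r` fixed
  -- letters must stand behind the window.
  let c₂ : (Fin (N + r) → Fin n) → k := fun w => c (w ∘ Fin.cast (Nat.add_comm r N))
  have hD₂ : ∀ j, ∑ i, c₂ i • wordProd a i j = c₂ j • D := by
    have : ∀ (m' : ℕ) (h : r + N = m') (j : Fin m' → Fin n),
        ∑ i : Fin m' → Fin n, c (i ∘ Fin.cast h) • wordProd a i j = c (j ∘ Fin.cast h) • D := by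
      rintro _ rfl j; exact hD j
    exact this _ _
  have hfront : ∀ l : Fin r → Fin n, ∑ j : Fin N → Fin n, c₂ (Fin.append j l) •
      letterProd (fun i => ∑ j, a i j ⊗ₜ[k] x c j) j = 0 := by
    intro l
    rw [sum_smul_letterProd_left]
    have h1 : ∀ j' : Fin N → Fin n, ∑ j : Fin N → Fin n, c₂ (Fin.append j l) • wordProd a j j' =
        ∑ p : Fin r → Fin n, c₂ (Fin.append j' p) • (D * Q p l) := by
      intro j'
      have h2 : ∀ p : Fin r → Fin n, c₂ (Fin.append j' p) • (D * Q p l) =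
          ∑ j : Fin N → Fin n, ∑ l' : Fin r → Fin n, c₂ (Fin.append j l') •
            (wordProd a j j' * (wordProd a l' p * Q p l)) := by
        intro p
        rw [← smul_mul_assoc, ← hD₂, sum_word_append, Finset.sum_mul]
        refine Finset.sum_congr rfl fun j _ => ?_
        rw [Finset.sum_mul]
        refine Finset.sum_congr rfl fun l' _ => ?_
        rw [wordProd_append, smul_mul_assoc, mul_assoc]
      simp only [h2]
      rw [Finset.sum_comm]
      refine Finset.sum_congr rfl fun j _ => ?_
      rw [Finset.sum_comm]
      simp only [← Finset.smul_sum, ← Finset.mul_sum, hQ]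
      simp
    simp only [h1, TensorProduct.sum_tmul]
    rw [Finset.sum_comm]
    refine Finset.sum_eq_zero fun p _ => ?_
    simp only [TensorProduct.smul_tmul, ← TensorProduct.tmul_sum]
    rw [sum_letterProd_front hc, TensorProduct.tmul_zero]
  -- By twisted cyclicity the defining relations are combinations of the front slices.
  have hrel : ∀ l : Fin r → Fin n, ∑ j : Fin N → Fin n, c (Fin.append l j) •
      letterProd (fun i => ∑ j, a i j ⊗ₜ[k] x c j) j = 0 := by
    intro l
    let L : ((Fin N → Fin n) → k) →ₗ[k] K ⊗[k] SuperpotentialAlgebra c :=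
      ∑ j, (LinearMap.proj j).smulRight (letterProd (fun i => ∑ j, a i j ⊗ₜ[k] x c j) j)
    have hL : ∀ θ, L θ = ∑ j, θ j • letterProd (fun i => ∑ j, a i j ⊗ₜ[k] x c j) j :=
      fun θ => by simp [L]
    have h1 := hc.slice_mem_front r 0 rfl l Fin.elim0
    have h2 : Submodule.span k (Set.range fun (l : Fin r → Fin n) (j : Fin N → Fin n) =>
        c (Fin.append j l ∘ Fin.cast (Nat.add_comm r N))) ≤ LinearMap.ker L := by
      rw [Submodule.span_le]
      rintro _ ⟨p, rfl⟩
      exact (hL _).trans (hfront p)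
    have h3 := (hL _).symm.trans (h2 h1)
    rw [← h3]
    refine Finset.sum_congr rfl fun j _ => ?_
    simp only [slice]
    rw [Fin.append_right_nil _ _ rfl]
    rfl
  refine ⟨lift c _ hrel, fun i => lift_x c _ hrel i, ?_, ?_⟩
  · refine hom_ext fun i => ?_
    simp [ha.comul, TensorProduct.sum_tmul, TensorProduct.tmul_sum]
    exact Finset.sum_comm
  · refine hom_ext fun i => ?_
    simp [ha.counit, ite_smul]

/-- A semi-invariant form gives a right coaction. -/
lemma exists_right {D : K} (hD : ∀ j, ∑ i, c i • wordProd a j i = c j • D) :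
    ∃ ρ : SuperpotentialAlgebra c →ₐ[k] SuperpotentialAlgebra c ⊗[k] K,
      (∀ j, ρ (x c j) = ∑ i, x c i ⊗ₜ[k] a i j) ∧ IsRightCoaction ρ := by
  let s (i j : Fin n) : K := HopfAlgebra.antipode k (a i j)
  let Q {m : ℕ} (i j : Fin m → Fin n) : K :=
    MulOpposite.unop (wordProd (fun x y => MulOpposite.op (s x y)) i j)
  have hQ : ∀ {m : ℕ} (i j : Fin m → Fin n), ∑ l, Q i l * wordProd a l j = if i = j then 1 else 0 :=
    fun i j => sum_op_mul_wordProd a s ha.antipode_mul i j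
  -- Here `Q` cancels from the left, where the fixed letters already stand, so no rotation is
  -- needed.
  have hrel : ∀ l : Fin r → Fin n, ∑ j : Fin N → Fin n, c (Fin.append l j) •
      letterProd (fun j => ∑ i, x c i ⊗ₜ[k] a i j) j = 0 := by
    intro l
    have h1 : ∀ j' : Fin N → Fin n, ∑ j : Fin N → Fin n, c (Fin.append l j) • wordProd a j' j =
        ∑ p : Fin r → Fin n, c (Fin.append p j') • (Q l p * D) := by
      intro j'
      have h2 : ∀ p : Fin r → Fin n, c (Fin.append p j') • (Q l p * D) =
          ∑ l' : Fin r → Fin n, ∑ j : Fin N → Fin n, c (Fin.append l' j) •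
            (Q l p * wordProd a p l' * wordProd a j' j) := by
        intro p
        rw [← mul_smul_comm, ← hD, sum_word_append, Finset.mul_sum]
        refine Finset.sum_congr rfl fun l' _ => ?_
        rw [Finset.mul_sum]
        refine Finset.sum_congr rfl fun j _ => ?_
        rw [wordProd_append, mul_smul_comm, mul_assoc]
      simp only [h2]
      rw [Finset.sum_comm]
      simp only [fun l' : Fin r → Fin n => Finset.sum_comm (s := (Finset.univ : Finset (Fin r → Fin n)))
        (t := (Finset.univ : Finset (Fin N → Fin n))) (f := fun p j => c (Fin.append l' j) •
            (Q l p * wordProd a p l' * wordProd a j' j)),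
        ← Finset.smul_sum, ← Finset.sum_mul, hQ]
      simp
    simp only [letterProd_right_matrix, Finset.smul_sum]
    rw [Finset.sum_comm]
    simp only [← TensorProduct.tmul_smul, ← TensorProduct.tmul_sum, h1]
    simp only [TensorProduct.tmul_sum]
    rw [Finset.sum_comm]
    refine Finset.sum_eq_zero fun p _ => ?_
    simp only [← TensorProduct.smul_tmul, ← TensorProduct.sum_tmul]
    rw [sum_letterProd_eq_zero c (Submodule.subset_span ⟨p, rfl⟩), TensorProduct.zero_tmul]
  refine ⟨lift c _ hrel, fun i => lift_x c _ hrel i, ?_, ?_⟩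
  · refine hom_ext fun i => ?_
    simp [ha.comul, TensorProduct.sum_tmul, TensorProduct.tmul_sum]
    exact Finset.sum_comm
  · refine hom_ext fun i => ?_
    simp [ha.counit, ite_smul]

end coactions

end IsMultiplicative

/-! ### Balanced coactions and multiplicative matrices. -/

section balanced
open SuperpotentialAlgebra
variable {k : Type u} [Field k] {r N n : ℕ} {K : Type w} [Ring K] [HopfAlgebra k K]

/-- The matrix of a left coaction is multiplicative. -/
lemma IsLeftCoaction.isMultiplicative {c : (Fin (r + N) → Fin n) → k} (hN : 2 ≤ N)
    {ρ : SuperpotentialAlgebra c →ₐ[k] K ⊗[k] SuperpotentialAlgebra c} (h : IsLeftCoaction ρ)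
    {a : Fin n → Fin n → K} (hρ : ∀ i, ρ (x c i) = ∑ j, a i j ⊗ₜ[k] x c j) :
    IsMultiplicative k a := by
  constructor
  · intro i j
    refine congrFun (left_injective c hN (a := fun j => Bialgebra.comulAlgHom k K (a i j))
      (b := fun j => ∑ l, a i l ⊗ₜ[k] a l j) ?_) j
    apply (Algebra.TensorProduct.assoc k k k K K (SuperpotentialAlgebra c)).injective
    have e := DFunLike.congr_fun h.coassoc (x c i)
    simp only [AlgHom.comp_apply, hρ, map_sum, Algebra.TensorProduct.map_tmul, AlgHom.coe_id,
      id_eq] at e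
    simp only [map_sum]
    refine Eq.trans e ?_
    simp only [TensorProduct.tmul_sum, TensorProduct.sum_tmul, map_sum,
      Algebra.TensorProduct.assoc_tmul]
    exact Finset.sum_comm
  · intro i j
    obtain ⟨L, hL⟩ := exists_coord c hN j
    have e := congrArg L (DFunLike.congr_fun h.counit (x c i))
    simp only [AlgHom.comp_apply, hρ, map_sum, Algebra.TensorProduct.map_tmul, AlgHom.coe_id,
      id_eq] at e
    rw [hL] at e
    rw [← e]
    simp [hL]

/-- Semi-invariance of a pair of forms gives a balanced coaction. -/
lemma IsMultiplicative.exists_balanced {c c' : (Fin (r + N) → Fin n) → k}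
    (hc : IsTwistedCyclic c) {a : Fin n → Fin n → K} (ha : IsMultiplicative k a) {D D' : K}
    (hD : ∀ j, ∑ i, c i • wordProd a i j = c j • D)
    (hD' : ∀ j, ∑ i, c' i • wordProd a j i = c' j • D') :
    ∃ β : BalancedCoaction K c c', (∀ i, β.left (x c i) = ∑ j, a i j ⊗ₜ[k] x c j) ∧
      (∀ j, β.right (x c' j) = ∑ i, x c' i ⊗ₜ[k] a i j) := by
  obtain ⟨ρ, h1, h2⟩ := ha.exists_left hc hD
  obtain ⟨ρ', h1', h2'⟩ := ha.exists_right hD'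
  exact ⟨⟨ρ, ρ', h2, h2', a, h1, h1'⟩, h1, h1'⟩

end balanced

end PreregularPair

namespace PreregularPair

/-! ## Multipliers and codeterminants of balanced coactions -/

section multiplier
open SuperpotentialAlgebra
variable {k : Type u} [Field k] {r N n d : ℕ} {c : (Fin (r + N) → Fin n) → k}
  {K : Type w} [Ring K] [HopfAlgebra k K]

/-- The form spans the top space of the Koszul complex of a regular algebra. -/
lemma IsTwistedCyclic.exists_smul_eq (hc : IsTwistedCyclic c) (hc0 : c ≠ 0) (hN : 2 ≤ N)
    (hd : r + N = koszulDegree N (d + 1)) (hK : IsNKoszul c)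
    (hR : IsASRegular (augmentation c hN) (d + 1)) :
    ∀ w' ∈ koszulSpace c (r + N), ∃ t : k, w' = t • c := by
  -- With the length as a variable, `r + N` can be replaced by the Koszul degree inside the type of
  -- the array.
  have key : ∀ (l : ℕ) (_ : l = koszulDegree N (d + 1)) (w : (Fin l → Fin n) → k),
      w ∈ koszulSpace c l → w ≠ 0 → ∀ w' ∈ koszulSpace c l, ∃ t : k, w' = t • w := by
    rintro _ rfl w hw hw0
    exact koszulSpace_rank_one c hN hK hR.1 hw hw0
  exact key _ hd c hc.mem_koszulSpace hc0

/-- The homological codeterminant of a matrix coaction is the multiplier of the form. -/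
lemma IsTwistedCyclic.isBarCoboundary_iff (hc : IsTwistedCyclic c) (hc0 : c ≠ 0) (hN : 2 ≤ N)
    (hd : r + N = koszulDegree N (d + 1)) (hK : IsNKoszul c)
    (hR : IsASRegular (augmentation c hN) (d + 1))
    {ρ : SuperpotentialAlgebra c →ₐ[k] K ⊗[k] SuperpotentialAlgebra c} {a : Fin n → Fin n → K}
    (hρ : ∀ i, ρ (x c i) = ∑ j, a i j ⊗ₜ[k] x c j) {D : K}
    (hD : ∀ j, ∑ i, c i • wordProd a i j = c j • D) (D₀ : K) :
    (∀ φ : MultilinearMap k (fun _ : Fin (d + 1) => SuperpotentialAlgebra c) k,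
      IsBarCocycle (augmentation c hN) φ → IsBarCoboundary (augmentation c hN) (d + 1)
        fun a => twistCochain ρ φ a - φ a • D₀) ↔ D₀ = D := by
  have key : ∀ (l : ℕ) (_ : l = koszulDegree N (d + 1)) (w : (Fin l → Fin n) → k),
      w ∈ koszulSpace c l → w ≠ 0 → (∀ w' ∈ koszulSpace c l, ∃ t : k, w' = t • w) →
      (∀ j, ∑ i, w i • wordProd a i j = w j • D) →
      ((∀ φ : MultilinearMap k (fun _ : Fin (d + 1) => SuperpotentialAlgebra c) k,
        IsBarCocycle (augmentation c hN) φ → IsBarCoboundary (augmentation c hN) (d + 1)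
          fun a => twistCochain ρ φ a - φ a • D₀) ↔ D₀ = D) := by
    rintro _ rfl w hw hw0 h1 hD
    exact isBarCoboundary_twistCochain_iff c hρ hN hK hw hw0 h1 hD D₀
  exact key _ hd c hc.mem_koszulSpace hc0 (hc.exists_smul_eq hc0 hN hd hK hR) hD

lemma comm_right_apply {ρ : SuperpotentialAlgebra c →ₐ[k] SuperpotentialAlgebra c ⊗[k] K}
    {a : Fin n → Fin n → K} (hρ : ∀ j, ρ (x c j) = ∑ i, x c i ⊗ₜ[k] a i j) (j : Fin n) :
    (Algebra.TensorProduct.comm k (SuperpotentialAlgebra c) K).toAlgHom.comp ρ (x c j) =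
      ∑ i, a i j ⊗ₜ[k] x c i := by
  simp [hρ]

/-- The multiplier of a left matrix coaction. -/
lemma IsTwistedCyclic.exists_left_multiplier (hc : IsTwistedCyclic c) (hc0 : c ≠ 0) (hN : 2 ≤ N)
    (hd : r + N = koszulDegree N (d + 1)) (hK : IsNKoszul c)
    (hR : IsASRegular (augmentation c hN) (d + 1))
    {ρ : SuperpotentialAlgebra c →ₐ[k] K ⊗[k] SuperpotentialAlgebra c} {a : Fin n → Fin n → K}
    (hρ : ∀ i, ρ (x c i) = ∑ j, a i j ⊗ₜ[k] x c j) :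
    ∃ D : K, ∀ j, ∑ i, c i • wordProd a i j = c j • D :=
  exists_multiplier a ρ hρ hc.mem_koszulSpace hc0 (hc.exists_smul_eq hc0 hN hd hK hR)

/-- The multiplier of a right matrix coaction. -/
lemma IsTwistedCyclic.exists_right_multiplier (hc : IsTwistedCyclic c) (hc0 : c ≠ 0) (hN : 2 ≤ N)
    (hd : r + N = koszulDegree N (d + 1)) (hK : IsNKoszul c)
    (hR : IsASRegular (augmentation c hN) (d + 1))
    {ρ : SuperpotentialAlgebra c →ₐ[k] SuperpotentialAlgebra c ⊗[k] K} {a : Fin n → Fin n → K}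
    (hρ : ∀ j, ρ (x c j) = ∑ i, x c i ⊗ₜ[k] a i j) :
    ∃ D : K, ∀ j, ∑ i, c i • wordProd a j i = c j • D :=
  -- The flipped map is an algebra map with the transposed matrix, which is all that the left-hand
  -- argument requires.
  hc.exists_left_multiplier hc0 hN hd hK hR (a := fun i j => a j i) (comm_right_apply hρ)

lemma IsTwistedCyclic.isLeftHomologicalCodet_one_iff (hc : IsTwistedCyclic c) (hc0 : c ≠ 0)
    (hN : 2 ≤ N) (hd : r + N = koszulDegree N (d + 1)) (hK : IsNKoszul c)
    (hR : IsASRegular (augmentation c hN) (d + 1))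
    {ρ : SuperpotentialAlgebra c →ₐ[k] K ⊗[k] SuperpotentialAlgebra c} {a : Fin n → Fin n → K}
    (hρ : ∀ i, ρ (x c i) = ∑ j, a i j ⊗ₜ[k] x c j) {D : K}
    (hD : ∀ j, ∑ i, c i • wordProd a i j = c j • D) :
    IsLeftHomologicalCodet (augmentation c hN) (d + 1) ρ 1 ↔ D = 1 := by
  rw [eq_comm, ← hc.isBarCoboundary_iff hc0 hN hd hK hR hρ hD, IsLeftHomologicalCodet,
    and_iff_right isUnit_one]
  simp only [leftTwist_eq]

lemma IsTwistedCyclic.isRightHomologicalCodet_one_iff (hc : IsTwistedCyclic c) (hc0 : c ≠ 0)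
    (hN : 2 ≤ N) (hd : r + N = koszulDegree N (d + 1)) (hK : IsNKoszul c)
    (hR : IsASRegular (augmentation c hN) (d + 1))
    {ρ : SuperpotentialAlgebra c →ₐ[k] SuperpotentialAlgebra c ⊗[k] K} {a : Fin n → Fin n → K}
    (hρ : ∀ j, ρ (x c j) = ∑ i, x c i ⊗ₜ[k] a i j) {D : K}
    (hD : ∀ j, ∑ i, c i • wordProd a j i = c j • D) :
    IsRightHomologicalCodet (augmentation c hN) (d + 1) ρ 1 ↔ D = 1 := by
  rw [eq_comm, ← hc.isBarCoboundary_iff hc0 hN hd hK hR (a := fun i j => a j i)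
    (comm_right_apply hρ) hD, IsRightHomologicalCodet]
  simp only [rightTwist_eq]
  constructor
  · rintro ⟨D', h1, _, h⟩
    -- The cochain condition is stated for the inverse of the codeterminant, which here is `1` as
    -- well.
    rw [one_mul] at h1
    subst h1
    exact h
  · exact fun h => ⟨1, one_mul 1, one_mul 1, h⟩

end multiplier

/-! ## Maps out of `H(e, f)` -/

namespace HAlg
variable {k : Type u} [Field k] {m n : ℕ} {E F : (Fin m → Fin n) → k}
  {K : Type w} [Ring K] [HopfAlgebra k K] {a : Fin n → Fin n → K} {D D' : K}

lemma isMultiplicative_u {V : Type v} [AddCommGroup V] [Module k V]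
    (v : Module.Basis (Fin n) k V) (e : PreregularForm k V m)
    (f : PreregularForm k (Module.Dual k V) m) :
    IsMultiplicative k (u (e.coeff v) (f.coeff v.dualBasis)) :=
  ⟨comulAlg_u _ _, counitAlg_u _ _⟩

/-- The bialgebra map from `H(e, f)` given by a multiplicative matrix. -/
lemma exists_algHom (ha : IsMultiplicative k a) (hE0 : E ≠ 0) (hF0 : F ≠ 0)
    (hD : ∀ j, ∑ i, E i • wordProd a i j = E j • D)
    (hD' : ∀ j, ∑ i, F i • wordProd a j i = F j • D') :
    ∃ φ : HAlg k E F →ₐ[k] K, (∀ i j, φ (u E F i j) = a i j) ∧ φ (gen E F .De) = D ∧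
      φ (gen E F .DfInv) = D' ∧
      (Bialgebra.counitAlgHom k K).comp φ = Bialgebra.counitAlgHom k (HAlg k E F) ∧
      (Algebra.TensorProduct.map φ φ).comp (Bialgebra.comulAlgHom k (HAlg k E F)) =
        (Bialgebra.comulAlgHom k K).comp φ := by
  have hg := ha.isGroupLikeElem_left hE0 hD
  have hg' := ha.isGroupLikeElem_right hF0 hD'
  -- The relation for `f` involves `D_f⁻¹`, so `D'` is the image of `DfInv`; the antipode inverts
  -- grouplike elements.
  let t : Gen n → K := fun g => match g with
    | .u i j => a i j
    | .De => D
    | .DeInv => HopfAlgebra.antipode k D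
    | .Df => HopfAlgebra.antipode k D'
    | .DfInv => D'
  let φ : HAlg k E F →ₐ[k] K := lift E F t hD hD' hg.mul_antipode_cancel hg.antipode_mul_cancel
    hg'.antipode_mul_cancel hg'.mul_antipode_cancel
  have hφ : ∀ g, φ (gen E F g) = t g := lift_gen _ _ _ _ _ _ _ _ _
  have hs := hg.antipode
  have hs' := hg'.antipode
  refine ⟨φ, fun i j => hφ _, hφ _, hφ _, ?_, ?_⟩
  · refine hom_ext fun g => ?_
    rw [AlgHom.comp_apply, hφ]
    cases g with
    | u i j => exact (ha.counit i j).trans (counitAlg_u _ _ i j).symm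
    | De => exact hg.counit_eq_one.trans (counitAlg_De _ _).symm
    | DeInv => exact hs.counit_eq_one.trans (counitAlg_DeInv _ _).symm
    | Df => exact hs'.counit_eq_one.trans (counitAlg_Df _ _).symm
    | DfInv => exact hg'.counit_eq_one.trans (counitAlg_DfInv _ _).symm
  · refine hom_ext fun g => ?_
    rw [AlgHom.comp_apply, AlgHom.comp_apply, hφ]
    cases g with
    | u i j =>
      refine Eq.trans (congrArg _ (comulAlg_u E F i j)) (Eq.trans ?_ (ha.comul i j).symm)
      simp only [map_sum, Algebra.TensorProduct.map_tmul, hφ]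
      rfl
    | De =>
      refine Eq.trans (congrArg _ (comulAlg_De E F)) (Eq.trans ?_ hg.comul_eq_tmul_self.symm)
      rw [Algebra.TensorProduct.map_tmul, hφ]
    | DeInv =>
      refine Eq.trans (congrArg _ (comulAlg_DeInv E F)) (Eq.trans ?_ hs.comul_eq_tmul_self.symm)
      rw [Algebra.TensorProduct.map_tmul, hφ]
    | Df =>
      refine Eq.trans (congrArg _ (comulAlg_Df E F)) (Eq.trans ?_ hs'.comul_eq_tmul_self.symm)
      rw [Algebra.TensorProduct.map_tmul, hφ]
    | DfInv =>
      refine Eq.trans (congrArg _ (comulAlg_DfInv E F)) (Eq.trans ?_ hg'.comul_eq_tmul_self.symm)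
      rw [Algebra.TensorProduct.map_tmul, hφ]

/-- Maps from `H(e, f)` are determined by the images of the `u_{ij}`. -/
lemma algHom_ext_u {B : Type*} [Ring B] [Algebra k B] (hE0 : E ≠ 0) (hF0 : F ≠ 0)
    {φ ψ : HAlg k E F →ₐ[k] B} (h : ∀ i j, φ (u E F i j) = ψ (u E F i j)) : φ = ψ := by
  have hw : ∀ i j : Fin m → Fin n, φ (wordProd (u E F) i j) = ψ (wordProd (u E F) i j) := by
    intro i j
    simp only [wordProd, map_list_prod, List.map_ofFn, Function.comp_def, h]
  -- The relation at a word with nonzero coefficient expresses `D_e` through the `u_{ij}`.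
  have hDe : φ (gen E F .De) = ψ (gen E F .De) := by
    obtain ⟨j, hj⟩ := Function.ne_iff.1 hE0
    have hj : E j ≠ 0 := hj
    refine smul_right_injective _ hj ?_
    change E j • _ = E j • _
    rw [← map_smul, ← map_smul, ← relE]
    simp only [map_sum, map_smul, hw]
  have hDf : φ (gen E F .DfInv) = ψ (gen E F .DfInv) := by
    obtain ⟨j, hj⟩ := Function.ne_iff.1 hF0
    have hj : F j ≠ 0 := hj
    refine smul_right_injective _ hj ?_
    change F j • _ = F j • _
    rw [← map_smul, ← map_smul, ← relF]
    simp only [map_sum, map_smul, hw]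
  refine hom_ext fun g => ?_
  cases g with
  | u i j => exact h i j
  | De => exact hDe
  | DfInv => exact hDf
  | DeInv =>
    refine left_inv_eq_right_inv (a := φ (gen E F .De)) ?_ ?_
    · rw [← map_mul, mul_De, map_one]
    · rw [hDe, ← map_mul, De_mul, map_one]
  | Df =>
    refine left_inv_eq_right_inv (a := φ (gen E F .DfInv)) ?_ ?_
    · rw [← map_mul, Df_mul, map_one]
    · rw [hDf, ← map_mul, mul_Df, map_one]

end HAlg

namespace QuantumS
variable {k : Type u} {V : Type v} [Field k] [AddCommGroup V] [Module k V] {m n : ℕ}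
    (v : Module.Basis (Fin n) k V) (e : PreregularForm k V m)
    (f : PreregularForm k (Module.Dual k V) m)

lemma isMultiplicative_u : IsMultiplicative k (QuantumS.u v e f) := by
  have hH := HAlg.isMultiplicative_u v e f
  constructor
  · intro i j
    change Algebra.TensorProduct.map (Ideal.Quotient.mkₐ k (QuantumH.slIdeal v e f))
        (Ideal.Quotient.mkₐ k (QuantumH.slIdeal v e f))
      (Bialgebra.comulAlgHom k (QuantumH v e f) (HAlg.u _ _ i j)) = _
    rw [hH.comul, map_sum]
    rfl
  · exact fun i j => hH.counit i j

lemma wordProd_u (i j : Fin m → Fin n) : wordProd (QuantumS.u v e f) i j =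
    Ideal.Quotient.mkₐ k (QuantumH.slIdeal v e f) (wordProd (HAlg.u _ _) i j) := by
  simp only [wordProd, map_list_prod, List.map_ofFn, Function.comp_def]
  rfl

lemma sum_left (j : Fin m → Fin n) :
    ∑ i, e.coeff v i • wordProd (QuantumS.u v e f) i j = e.coeff v j • 1 := by
  simp only [wordProd_u, ← map_smul, ← map_sum, HAlg.relE]
  rw [map_smul]
  exact congrArg _ (QuantumH.mk_De v e f)

lemma sum_right (j : Fin m → Fin n) :
    ∑ i, f.coeff v.dualBasis i • wordProd (QuantumS.u v e f) j i =
      f.coeff v.dualBasis j • 1 := by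
  simp only [wordProd_u, ← map_smul, ← map_sum, HAlg.relF]
  rw [map_smul]
  exact congrArg _ (QuantumH.mk_DfInv v e f)

end QuantumS

namespace BalancedCoaction
open SuperpotentialAlgebra
variable {k : Type u} [Field k] {r N n : ℕ} {c c' : (Fin (r + N) → Fin n) → k}
  {K : Type w} [Ring K] [HopfAlgebra k K] {K' : Type v} [Ring K'] [HopfAlgebra k K']

/-- Maps of balanced coactions are the maps of Hopf algebras that respect the matrices. -/
lemma isMap_iff (hN : 2 ≤ N) (β : BalancedCoaction K c c') (γ : BalancedCoaction K' c c')
    {a : Fin n → Fin n → K} {b : Fin n → Fin n → K'}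
    (h1 : ∀ i, β.left (x c i) = ∑ j, a i j ⊗ₜ[k] x c j)
    (h2 : ∀ j, β.right (x c' j) = ∑ i, x c' i ⊗ₜ[k] a i j)
    (h3 : ∀ i, γ.left (x c i) = ∑ j, b i j ⊗ₜ[k] x c j)
    (h4 : ∀ j, γ.right (x c' j) = ∑ i, x c' i ⊗ₜ[k] b i j) (φ : K →ₐc[k] K') :
    β.IsMap γ φ ↔ ∀ i j, φ (a i j) = b i j := by
  constructor
  · rintro ⟨h, -⟩ i j
    refine congrFun (left_injective c hN (a := fun j => φ (a i j)) (b := b i) ?_) j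
    have e := DFunLike.congr_fun h (x c i)
    rw [AlgHom.comp_apply, h1, h3, map_sum] at e
    exact e
  · intro h
    refine ⟨hom_ext fun i => ?_, hom_ext fun j => ?_⟩
    · rw [AlgHom.comp_apply, h1, h3, map_sum]
      exact Finset.sum_congr rfl fun j _ => congrArg (· ⊗ₜ[k] x c j) (h i j)
    · rw [AlgHom.comp_apply, h2, h4, map_sum]
      exact Finset.sum_congr rfl fun i _ => congrArg (x c' i ⊗ₜ[k] ·) (h i j)

end BalancedCoaction

end PreregularPair

/-! ### The universal properties. -/

theorem mainTheorem1 {k : Type u} [Field k] {V : Type v} [AddCommGroup V] [Module k V]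
    {n r N d : ℕ} (hn : 0 < n) (hN : 2 ≤ N) (hd : r + N = koszulDegree N d)
    (v : Module.Basis (Fin n) k V)
    (e : PreregularForm k V (r + N)) (f : PreregularForm k (Module.Dual k V) (r + N))
    (hKe : IsNKoszul (e.coeff v))
    (hRe : IsASRegular (SuperpotentialAlgebra.augmentation (e.coeff v) hN) d)
    (hKf : IsNKoszul (f.coeff v.dualBasis))
    (hRf : IsASRegular (SuperpotentialAlgebra.augmentation (f.coeff v.dualBasis) hN) d) :
    (∃ β : BalancedCoaction (QuantumH v e f) (e.coeff v) (f.coeff v.dualBasis),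
      (∀ i, β.left (SuperpotentialAlgebra.x _ i)
        = ∑ j, HAlg.u _ _ i j ⊗ₜ[k] SuperpotentialAlgebra.x _ j) ∧
      (∀ j, β.right (SuperpotentialAlgebra.x _ j)
        = ∑ i, SuperpotentialAlgebra.x _ i ⊗ₜ[k] HAlg.u _ _ i j) ∧
      BalancedCoaction.IsBalancedGL.{u, w} β) ∧
    (∃ β : BalancedCoaction (QuantumS v e f) (e.coeff v) (f.coeff v.dualBasis),
      (∀ i, β.left (SuperpotentialAlgebra.x _ i)
        = ∑ j, QuantumS.u v e f i j ⊗ₜ[k] SuperpotentialAlgebra.x _ j) ∧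
      (∀ j, β.right (SuperpotentialAlgebra.x _ j)
        = ∑ i, SuperpotentialAlgebra.x _ i ⊗ₜ[k] QuantumS.u v e f i j) ∧
      BalancedCoaction.IsBalancedSL.{u, w} β hN d) := by
  -- Dimension zero is excluded, since `koszulDegree N 0 = 0 < r + N`.
  obtain _ | d := d
  · exact absurd hd (by simp only [koszulDegree]; omega)
  have hce := e.isTwistedCyclic v
  have hcf := f.isTwistedCyclic v.dualBasis
  have he0 := e.coeff_ne_zero v hn
  have hf0 := f.coeff_ne_zero v.dualBasis hn
  obtain ⟨βH, hH1, hH2⟩ := (HAlg.isMultiplicative_u v e f).exists_balanced hce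
    (HAlg.relE _ _) (HAlg.relF _ _)
  obtain ⟨βS, hS1, hS2⟩ := (QuantumS.isMultiplicative_u v e f).exists_balanced hce
    (QuantumS.sum_left v e f) (QuantumS.sum_right v e f)
  refine ⟨⟨βH, hH1, hH2, ?_⟩, βS, hS1, hS2, ⟨?_, ?_⟩, ?_⟩
  · intro K' _ _ γ
    obtain ⟨a, ha1, ha2⟩ := γ.balanced
    have ha := γ.isLeftCoaction.isMultiplicative hN ha1
    obtain ⟨D, hD⟩ := hce.exists_left_multiplier he0 hN hd hKe hRe ha1
    obtain ⟨D', hD'⟩ := hcf.exists_right_multiplier hf0 hN hd hKf hRf ha2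
    obtain ⟨φ, hφ, -, -, h1, h2⟩ := HAlg.exists_algHom ha he0 hf0 hD hD'
    refine ⟨BialgHom.ofAlgHom φ h1 h2, ?_, fun ψ hψ => ?_⟩
    · exact (BalancedCoaction.isMap_iff hN βH γ hH1 hH2 ha1 ha2 _).2 hφ
    · have hψ' := (BalancedCoaction.isMap_iff hN βH γ hH1 hH2 ha1 ha2 ψ).1 hψ
      have e : (ψ : QuantumH v e f →ₐ[k] K') = φ :=
        HAlg.algHom_ext_u he0 hf0 fun i j => (hψ' i j).trans (hφ i j).symm
      exact DFunLike.ext _ _ fun z => DFunLike.congr_fun e z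
  · exact (hce.isLeftHomologicalCodet_one_iff he0 hN hd hKe hRe hS1
      (QuantumS.sum_left v e f)).2 rfl
  · exact (hcf.isRightHomologicalCodet_one_iff hf0 hN hd hKf hRf hS2
      (QuantumS.sum_right v e f)).2 rfl
  · intro K' _ _ γ hγ
    obtain ⟨a, ha1, ha2⟩ := γ.balanced
    have ha := γ.isLeftCoaction.isMultiplicative hN ha1
    obtain ⟨D, hD⟩ := hce.exists_left_multiplier he0 hN hd hKe hRe ha1
    obtain ⟨D', hD'⟩ := hcf.exists_right_multiplier hf0 hN hd hKf hRf ha2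
    -- Trivial codeterminants force both multipliers to be `1`, so the map out of `H(e, f)` factors
    -- through `S(e, f)`.
    obtain rfl := (hce.isLeftHomologicalCodet_one_iff he0 hN hd hKe hRe ha1 hD).1 hγ.1
    obtain rfl := (hcf.isRightHomologicalCodet_one_iff hf0 hN hd hKf hRf ha2 hD').1 hγ.2
    obtain ⟨φ, hφ, hDe, hDf, h1, h2⟩ := HAlg.exists_algHom ha he0 hf0 hD hD'
    have hDf' : φ (HAlg.gen _ _ .Df) = 1 := by
      have := congrArg φ (HAlg.Df_mul (e.coeff v) (f.coeff v.dualBasis))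
      rwa [map_mul, hDf, mul_one, map_one] at this
    let φS : QuantumS v e f →ₐ[k] K' := Ideal.Quotient.liftₐ (QuantumH.slIdeal v e f) φ
      fun z hz => QuantumH.map_eq_zero_of_mem_slIdeal v e f φ.toRingHom hDe hDf' hz
    have h3 : (Bialgebra.counitAlgHom k K').comp φS = Bialgebra.counitAlgHom k _ :=
      Ideal.Quotient.algHom_ext k (by exact h1)
    have h4 : (Algebra.TensorProduct.map φS φS).comp (Bialgebra.comulAlgHom k (QuantumS v e f)) =
        (Bialgebra.comulAlgHom k K').comp φS := by
      refine Ideal.Quotient.algHom_ext k ?_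
      refine Eq.trans ?_ h2
      -- Algebra maps out of `H(e, f)` are determined on the `u_{ij}`, so the grouplike generators
      -- need no separate check.
      refine HAlg.algHom_ext_u he0 hf0 fun i j => ?_
      have e1 := (QuantumS.isMultiplicative_u v e f).comul i j
      have e2 := (HAlg.isMultiplicative_u v e f).comul i j
      refine (congrArg (Algebra.TensorProduct.map φS φS) e1).trans
        (Eq.trans ?_ (congrArg (Algebra.TensorProduct.map φ φ) e2).symm)
      simp only [map_sum, Algebra.TensorProduct.map_tmul]
      rfl
    refine ⟨BialgHom.ofAlgHom φS h3 h4, ?_, fun ψ hψ => ?_⟩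
    · exact (BalancedCoaction.isMap_iff hN βS γ hS1 hS2 ha1 ha2 _).2 hφ
    · have hψ' := (BalancedCoaction.isMap_iff hN βS γ hS1 hS2 ha1 ha2 ψ).1 hψ
      have e : (ψ : QuantumS v e f →ₐ[k] K') = φS := by
        refine Ideal.Quotient.algHom_ext k (HAlg.algHom_ext_u he0 hf0 fun i j => ?_)
        exact (hψ' i j).trans (hφ i j).symm
      exact DFunLike.ext _ _ fun z => DFunLike.congr_fun e z
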